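/- **Circuits.** Let $\mathcal M$ be a strict symmetric premonoidal category: objects form a monoid $(\otimes, I)$, there are functors $X\rtimes -$ and $-\ltimes X$ acting on objects by $X\otimes -$ and $-\otimes X$ (strictly compatible with the monoid structure and with each other), and there is a natural, involutive, central symmetry $X\otimes Y\to Y\otimes X$ satisfying the hexagon law; no interchange law is required. Let $W$ be a set of wire types $w$, each with an object $⟦w⟧$ of $\mathcal M$. A label context $Q=\ell_1:w_1,\dots,\ell_n:w_n$ has distinct labels, and $⟦Q⟧=⟦w_1⟧\otimes\dots\otimes⟦w_n⟧$. A circuit $C:Q\to L$ is a morphism $⟦Q⟧\to⟦L⟧$. If $L,L'$ agree up to order, $perm:L\to L'$ denotes the permutation isomorphism built from symmetries that moves each label to its position in $L'$. **Proto-Quipper-C.** Bundle types $T,U::=1\mid w\mid T\otimes U$, identified in closure annotations up to strict associativity and unit. Types $A,B::=1\mid \mathrm{Nat}\mid w\mid A\otimes B\mid\,!A\mid \mathrm{Circ}(T,U)\mid A\multimap_T B$. Parameter types $P,R::=1\mid\mathrm{Nat}\mid P\otimes R\mid\,!A\mid\mathrm{Circ}(T,U)$. Wire bundles $b,c::=*\mid\ell\mid\langle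 b,c\rangle$. Values $V::=x\mid\ell\mid *\mid n\mid\lambda x^A.N\mid\mathrm{lift}\,N\mid(b,D,c)\mid\langle V,V'\rangle$, where $D$ is a circuit. Terms $N::=V\,V'\mid\mathrm{force}\,V\mid\mathrm{box}_T V\mid\mathrm{apply}(V,V')\mid\mathrm{let}\,\langle x,y\rangle=V\,\mathrm{in}\,N\mid\mathrm{ifz}\,V\,\mathrm{then}\,N\,\mathrm{else}\,N'\mid\mathrm{return}\,V\mid\mathrm{let}\,x=N\,\mathrm{in}\,N'$. The circuit part of a type is $\sharp1=\sharp\mathrm{Nat}=\sharp!A=\sharp\mathrm{Circ}(T,U)=1$, $\sharp w=w$, $\sharp(A\otimes B)=\sharp A\otimes\sharp B$, $\sharp(A\multimap_TB)=T$. Contexts $\Gamma$ are ordered lists of labels $\ell:w$ and variables $x:A$; $\sharp\Gamma$ is the tensor of the $\sharp$ of its entries; $\Phi$ ranges over contexts all of whose entries have parameter type. *Value rules.* $\Phi\vdash *:1$; $\ \Phi\vdash n:\mathrm{Nat}$; $\ \Phi,\ell:w\vdash\ell:w$; $\ \Phi,x:A\vdash x:A$; if $\Gamma,x:A\vdash N:B$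 then $\Gamma\vdash\lambda x^A.N:A\multimap_{\sharp\Gamma}B$; if $\Phi\vdash N:A$ then $\Phi\vdash\mathrm{lift}\,N:\,!A$; if $Q\vdash b:T$, $L\vdash c:U$, and $D$ goes from $Q$ to $L$ up to reordering of the labels, then $\Phi\vdash(b,D,c):\mathrm{Circ}(T,U)$; if $\Phi,\Gamma_1\vdash V:A$ and $\Phi,\Gamma_2\vdash V':B$ then $\Phi,\Gamma_1,\Gamma_2\vdash\langle V,V'\rangle:A\otimes B$. *Computation rules.* If $\Phi,\Gamma_1\vdash V:A\multimap_TB$ and $\Phi,\Gamma_2\vdash V':A$ then $\Phi,\Gamma_1,\Gamma_2\vdash V\,V':B$; if $\Phi\vdash V:\,!A$ then $\Phi\vdash\mathrm{force}\,V:A$; if $\Phi\vdash V:T\multimap_IU$ (empty annotation) then $\Phi\vdash\mathrm{box}_TV:\mathrm{Circ}(T,U)$; if $\Phi,\Gamma_1\vdash V:\mathrm{Circ}(T,U)$ and $\Phi,\Gamma_2\vdash V':T$ then $\Phi,\Gamma_1,\Gamma_2\vdash\mathrm{apply}(V,V'):U$; if $\Phi,\Gamma_1\vdash V:A\otimes B$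 and $\Phi,\Gamma_2,x:A,y:B\vdash N:C$ then $\Phi,\Gamma_2,\Gamma_1\vdash\mathrm{let}\,\langle x,y\rangle=V\,\mathrm{in}\,N:C$; if $\Phi\vdash V:\mathrm{Nat}$, $\Phi,\Gamma\vdash N:A$ and $\Phi,\Gamma\vdash N':A$ then $\Phi,\Gamma\vdash\mathrm{ifz}\,V\,\mathrm{then}\,N\,\mathrm{else}\,N':A$; if $\Gamma\vdash V:A$ then $\Gamma\vdash\mathrm{return}\,V:A$; if $\Phi,\Gamma_1\vdash N:A$ and $\Phi,\Gamma_2,x:A\vdash N':B$ then $\Phi,\Gamma_2,\Gamma_1\vdash\mathrm{let}\,x=N\,\mathrm{in}\,N':B$; and exchange of two adjacent context entries, for computations only. *Configurations.* $Q\vdash(C,N):A;Q'$ holds if, up to reordering of its output labels, $C$ is a circuit $Q\to L,Q'$ for some $L$ with $L\vdash N:A$. Likewise $Q\vdash(C,V):A;Q'$ for values. *Evaluation* $(C,N)\Downarrow(C',V)$ is the least relation with the following rules. $(C,\mathrm{return}\,V)\Downarrow(C,V)$. Each of $(\lambda x^A.N)\,V$, $\mathrm{let}\,\langle x,y\rangle=\langle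 V,V'\rangle\,\mathrm{in}\,N$, $\mathrm{force}(\mathrm{lift}\,N)$, $\mathrm{ifz}\,0\,\mathrm{then}\,N\,\mathrm{else}\,N'$, $\mathrm{ifz}\,(n{+}1)\,\mathrm{then}\,N\,\mathrm{else}\,N'$ evaluates, from $C$, to whatever $N[V/x]$, $N[V/x,V'/y]$, $N$, $N$, $N'$ respectively evaluates to from $C$. If $(C,N)\Downarrow(C',V)$ and $(C',N'[V/x])\Downarrow(C'',X)$ then $(C,\mathrm{let}\,x=N\,\mathrm{in}\,N')\Downarrow(C'',X)$. If $K$ is a label context, $K\vdash b:T$ and $(id_K,V\,b)\Downarrow(D,c)$ with $c$ a wire bundle, then $(C,\mathrm{box}_TV)\Downarrow(C,(b,D,c))$. Finally $(C,\mathrm{apply}((b,D,c),t))\Downarrow(C',k)$, where $C'$ is $C$ followed by $D$ on the wires that $t$ lists (matched with the inputs listed by $b$), leaving the others unchanged; the resulting new wires are listed by $k$ (matched with the outputs listed by $c$), and all output labels of $C'$ are distinct. Output labels of circuits may be ordered in any way. **Interpretation.** Let $\mathcal T(T,U,X)=X\times\mathcal M(T,U)$, an indexed monad with unit $x\mapsto(x,id)$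 and multiplication given by composition in $\mathcal M$. Its Kleisli category $\mathcal K$ has objects $(X,T)$, with $X$ a set and $T$ an object of $\mathcal M$, and morphisms $(X,T)\to(Y,U)$ the functions $X\to\mathcal T(T,U,Y)$. Let $J:\mathbf{Set}\times\mathcal M\to\mathcal K$ be the identity-on-objects functor $J(f,C)(x)=(f(x),C)$. A type is interpreted as $⟦A⟧=(\flat A,⟦\sharp A⟧)$ with $\flat1=\flat w=1$, $\flat\mathrm{Nat}=\mathbb N$, $\flat(A\otimes B)=\flat A\times\flat B$, $\flat(!A)=\mathcal T(I,⟦\sharp A⟧,\flat A)$, $\flat\mathrm{Circ}(T,U)=\mathcal M(⟦T⟧,⟦U⟧)$, $\flat(A\multimap_TB)=\flat A\Rightarrow\mathcal T(⟦T⟧\otimes⟦\sharp A⟧,⟦\sharp B⟧,\flat B)$; contexts are interpreted componentwise. By recursion on derivations, a value judgment $\Gamma\vdash V:A$ denotes a morphism $⟦\Gamma⟧\to⟦A⟧$ of $\mathbf{Set}\times\mathrm{disc}(\mathrm{Ob}\,\mathcal M)$, and a computation judgment $\Gamma\vdash N:A$ denotes a morphism $⟦\Gamma⟧\to⟦A⟧$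 of $\mathcal K$. In the latter, variables are shared through the $\flat$ part; $\mathrm{return}$ is the Kleisli unit; let is Kleisli composition, with the first computation acting on the rightmost wires; application, force and apply run the denoted function, thunk or circuit; box is the isomorphism $\flat(T\multimap_IU)\cong\mathcal M(⟦T⟧,⟦U⟧)$; and exchange is precomposition with the symmetry. For configurations, with $C;perm:Q\to L,Q'$ and $L\vdash N:A$ (resp. $L\vdash V:A$), $$⟦(C,N)⟧=J(id,\,C;perm);(⟦N⟧\ltimes⟦Q'⟧):J(1,⟦Q⟧)\to J(\flat A,⟦\sharp A⟧\otimes⟦Q'⟧),$$ a morphism of $\mathcal K$, and $$⟦(C,V)⟧=(id,\,C;perm);(⟦V⟧\ltimes⟦Q'⟧),$$ a morphism of $\mathbf{Set}\times\mathcal M$. **Theorem (soundness).** Suppose $Q\vdash(C,N):A;Q'$ and $(C,N)\Downarrow(C',V)$. Then $Q\vdash(C',V):A;Q'$ and $$⟦(C,N)⟧=J(⟦(C',V)⟧).$$ More precisely, since meanings are defined on derivations: for every derivation of $Q\vdash(C,N):A;Q'$ there is a derivation of $Q\vdash(C',V):A;Q'$ such that the two meanings satisfy this equation. -/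

import Mathlib

open CategoryTheory

universe v u w

/-! ### Circuits: strict symmetric premonoidal categories -/

/-- A strict symmetric premonoidal category.  The tensor of objects is the multiplication of a monoid
(so that it is strictly associative and unital), `lwhisk X f` is `X ⋊ f`, `rwhisk f X` is `f ⋉ X`, and
`braid X Y : X ⊗ Y ⟶ Y ⊗ X` is the symmetry, which is central.  No interchange law is required.
Heterogeneous equalities and `eqToHom`s only account for the strict object equalities. -/
class StrictSymmPremonoidal (M : Type u) extends Category.{v} M, Monoid M where
  lwhisk (X : M) {Y Z : M} (f : Y ⟶ Z) : (X * Y ⟶ X * Z)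
  rwhisk {Y Z : M} (f : Y ⟶ Z) (X : M) : (Y * X ⟶ Z * X)
  braid (X Y : M) : (X * Y ⟶ Y * X)
  lwhisk_id (X Y : M) : lwhisk X (𝟙 Y) = 𝟙 (X * Y)
  rwhisk_id (X Y : M) : rwhisk (𝟙 Y) X = 𝟙 (Y * X)
  lwhisk_comp (X : M) {Y Z Z' : M} (f : Y ⟶ Z) (g : Z ⟶ Z') :
    lwhisk X (f ≫ g) = lwhisk X f ≫ lwhisk X g
  rwhisk_comp (X : M) {Y Z Z' : M} (f : Y ⟶ Z) (g : Z ⟶ Z') :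
    rwhisk (f ≫ g) X = rwhisk f X ≫ rwhisk g X
  one_lwhisk {Y Z : M} (f : Y ⟶ Z) : lwhisk 1 f ≍ f
  rwhisk_one {Y Z : M} (f : Y ⟶ Z) : rwhisk f 1 ≍ f
  mul_lwhisk (X X' : M) {Y Z : M} (f : Y ⟶ Z) : lwhisk (X * X') f ≍ lwhisk X (lwhisk X' f)
  rwhisk_mul (X X' : M) {Y Z : M} (f : Y ⟶ Z) : rwhisk f (X * X') ≍ rwhisk (rwhisk f X) X'
  lwhisk_rwhisk (X X' : M) {Y Z : M} (f : Y ⟶ Z) :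
    rwhisk (lwhisk X f) X' ≍ lwhisk X (rwhisk f X')
  braid_braid (X Y : M) : braid X Y ≫ braid Y X = 𝟙 (X * Y)
  braid_naturality {X X' : M} (f : X ⟶ X') (Y : M) :
    rwhisk f Y ≫ braid X' Y = braid X Y ≫ lwhisk Y f
  hexagon (X Y Z : M) :
    braid X (Y * Z) = eqToHom (mul_assoc X Y Z).symm ≫ rwhisk (braid X Y) Z ≫
      eqToHom (mul_assoc Y X Z) ≫ lwhisk Y (braid X Z) ≫ eqToHom (mul_assoc Y Z X).symm
  braid_central_left (X Y : M) {A B : M} (f : A ⟶ B) :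
    rwhisk (braid X Y) A ≫ lwhisk (Y * X) f = lwhisk (X * Y) f ≫ rwhisk (braid X Y) B
  braid_central_right (X Y : M) {A B : M} (f : A ⟶ B) :
    lwhisk A (braid X Y) ≫ rwhisk f (Y * X) = rwhisk f (X * Y) ≫ lwhisk B (braid X Y)

namespace ProtoQuipperC

open StrictSymmPremonoidal

/-! ### The circuit monad and its Kleisli category -/

section Monad

variable {M : Type u} [StrictSymmPremonoidal.{v} M]

/-- The category-action indexed monad `T(T, U, X) = X × M(T, U)`. -/
abbrev Circ (T U : M) (X : Type v) : Type v := X × (T ⟶ U)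

namespace Circ

variable {S T T' U V : M} {X Y : Type v}

/-- Unit of the indexed monad. -/
def eta (T : M) (x : X) : Circ T T X := (x, 𝟙 T)

/-- Functorial action of the indexed monad in its third argument. -/
def map (f : X → Y) (m : Circ T U X) : Circ T U Y := (f m.1, m.2)

/-- Multiplication of the indexed monad. -/
def mu (m : Circ T U (Circ U V X)) : Circ T V X := (m.1.1, m.2 ≫ m.1.2)

/-- Kleisli extension. -/
def bind (m : Circ T U X) (k : X → Circ U V Y) : Circ T V Y := mu (map k m)

/-- Contravariant action of the indexed monad in its first argument. -/
def pre (f : T' ⟶ T) (m : Circ T U X) : Circ T' U X := (m.1, f ≫ m.2)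

/-- Covariant action of the indexed monad in its second argument. -/
def post (m : Circ T U X) (f : U ⟶ V) : Circ T V X := (m.1, m.2 ≫ f)

/-- Lifting of `S ⋊ -` to the indexed monad. -/
def liftL (S : M) (m : Circ T U X) : Circ (S * T) (S * U) X := (m.1, lwhisk S m.2)

/-- Lifting of `- ⋉ S` to the indexed monad. -/
def liftR (m : Circ T U X) (S : M) : Circ (T * S) (U * S) X := (m.1, rwhisk m.2 S)

end Circ

/-- Objects `(X, T)` of the Kleisli category of the circuit monad. -/
structure Kl (M : Type u) where
  /-- the set of parameters -/
  val : Type v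
  /-- the circuit interface -/
  cir : M

/-- The Kleisli category: a morphism `(X, T) ⟶ (Y, U)` is a function `X → Y × M(T, U)`. -/
instance : Category (Kl.{v, u} M) where
  Hom P R := P.val → Circ P.cir R.cir R.val
  id P := fun x => Circ.eta P.cir x
  comp f g := fun x => Circ.bind (f x) g
  id_comp f := by funext x; simp [Circ.bind, Circ.mu, Circ.map, Circ.eta]
  comp_id f := by funext x; simp [Circ.bind, Circ.mu, Circ.map, Circ.eta]
  assoc f g h := by funext x; simp [Circ.bind, Circ.mu, Circ.map]

/-- The identity-on-objects functor `J : Set × M ⥤ Kl` of the parameterized Freyd category. -/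
def J : Type v × M ⥤ Kl.{v, u} M where
  obj P := ⟨P.1, P.2⟩
  map f := fun x => (f.1 x, f.2)
  map_id P := by funext x; rfl
  map_comp f g := by funext x; rfl

/-- The lifting of `- ⋉ S` to the Kleisli category. -/
def liftR {P R : Kl.{v, u} M} (f : P ⟶ R) (S : M) :
    (⟨P.val, P.cir * S⟩ : Kl.{v, u} M) ⟶ ⟨R.val, R.cir * S⟩ :=
  fun x => Circ.liftR (f x) S

/-- The inclusion of the category `Set × disc(Ob M)`, where values are interpreted,
into `Set × M`. -/
def valIncl : Type v × Discrete M ⥤ Type v × M := (𝟭 (Type v)).prod (Discrete.functor id)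

end Monad

/-! ### Types and contexts -/

section Types

/-- Bundle types `T, U ::= 1 | w | T ⊗ U` over a set `W` of wire types. -/
inductive BTy (W : Type w) : Type w
  | unit
  | wire (a : W)
  | tensor (T U : BTy W)

/-- Types.  The closure annotation `T` of an arrow type `A ⊸_T B` is a bundle type up to the strict
associativity and unit laws of the tensor, i.e. a word of wire types. -/
inductive Ty (W : Type w) : Type w
  | unit
  | nat
  | wire (a : W)
  | tensor (A B : Ty W)
  | bang (A : Ty W)
  | circ (T U : BTy W)
  | arrow (A B : Ty W) (T : List W)

variable {W : Type w}

/-- Bundle types are types. -/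
def BTy.toTy : BTy W → Ty W
  | .unit => .unit
  | .wire a => .wire a
  | .tensor T U => .tensor T.toTy U.toTy

/-- Parameter types `P, R ::= 1 | Nat | P ⊗ R | !A | Circ(T, U)`. -/
def Ty.IsParam : Ty W → Prop
  | .unit => True
  | .nat => True
  | .wire _ => False
  | .tensor A B => A.IsParam ∧ B.IsParam
  | .bang _ => True
  | .circ _ _ => True
  | .arrow _ _ _ => False

/-- The circuit part `♯A` of a type, as a word of wire types. -/
def Ty.sharp : Ty W → List W
  | .unit => []
  | .nat => []
  | .wire a => [a]
  | .tensor A B => A.sharp ++ B.sharp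
  | .bang _ => []
  | .circ _ _ => []
  | .arrow _ _ T => T

/-- A context entry: a label `ℓ : w`, or the variable of de Bruijn index `i` with its type.
The order of the entries in a context is independent of the indices. -/
inductive Entry (W : Type w) : Type w
  | lab (l : ℕ) (a : W)
  | var (i : ℕ) (A : Ty W)

/-- The type of a context entry. -/
def Entry.ty : Entry W → Ty W
  | .lab _ a => .wire a
  | .var _ A => A

/-- Shift the variable of an entry under `k` binders. -/
def Entry.shift (k : ℕ) : Entry W → Entry W
  | .lab l a => .lab l a
  | .var i A => .var (i + k) A

/-- (Ordered) typing contexts. -/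
abbrev Ctx (W : Type w) : Type w := List (Entry W)

/-- Shift all variables of a context under `k` binders. -/
def Ctx.shift (k : ℕ) : Ctx W → Ctx W := List.map (Entry.shift k)

/-- Parameter contexts `Φ`: all entries have a parameter type. -/
def Ctx.IsParam (Γ : Ctx W) : Prop := ∀ e ∈ Γ, e.ty.IsParam

/-- The circuit part `♯Γ` of a context. -/
def Ctx.sharp (Γ : Ctx W) : List W := Γ.flatMap fun e => e.ty.sharp

/-- Lists of labels with their wire types. -/
abbrev LabCtx (W : Type w) : Type w := List (ℕ × W)

/-- A label context has pairwise distinct labels. -/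
def LabCtx.Valid (Q : LabCtx W) : Prop := (Q.map Prod.fst).Nodup

/-- A label context as a typing context. -/
def LabCtx.toCtx (Q : LabCtx W) : Ctx W := Q.map fun p => .lab p.1 p.2

theorem Ty.IsParam.sharp_eq : {A : Ty W} → A.IsParam → A.sharp = []
  | .unit, _ => rfl
  | .nat, _ => rfl
  | .tensor A B, h => by simp [Ty.sharp, Ty.IsParam.sharp_eq h.1, Ty.IsParam.sharp_eq h.2]
  | .bang _, _ => rfl
  | .circ _ _, _ => rfl

theorem Ctx.sharp_append (Γ Δ : Ctx W) : Ctx.sharp (Γ ++ Δ) = Ctx.sharp Γ ++ Ctx.sharp Δ := by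
  simp [Ctx.sharp]

theorem Ctx.IsParam.sharp_eq {Γ : Ctx W} (h : Ctx.IsParam Γ) : Ctx.sharp Γ = [] := by
  simp only [Ctx.sharp, List.flatMap_eq_nil_iff]
  exact fun e he => (h e he).sharp_eq

theorem Ctx.sharp_shift (k : ℕ) (Γ : Ctx W) : Ctx.sharp (Ctx.shift k Γ) = Ctx.sharp Γ := by
  simp only [Ctx.sharp, Ctx.shift, List.flatMap_map]
  congr 1
  funext e
  cases e <;> rfl

theorem LabCtx.sharp_toCtx (Q : LabCtx W) : Ctx.sharp Q.toCtx = Q.map Prod.snd := by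
  induction Q with
  | nil => rfl
  | cons p Q ih =>
    simp only [Ctx.sharp, LabCtx.toCtx, List.map_cons, List.flatMap_cons] at ih ⊢
    rw [ih]
    rfl

end Types

/-! ### Interfaces and permutations -/

section Interfaces

variable {W : Type w} {M : Type u} [StrictSymmPremonoidal.{v} M] (ob : W → M)

/-- The object of `M` denoted by a word of wire types. -/
def obj : List W → M
  | [] => 1
  | a :: T => ob a * obj T

theorem obj_append (S T : List W) : obj ob (S ++ T) = obj ob S * obj ob T := by
  induction S with
  | nil => simp [obj]
  | cons a S ih => simp [obj, ih, mul_assoc]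

/-- The object `⟦Q⟧` of `M` denoted by a label context. -/
def labObj (Q : LabCtx W) : M := obj ob (Q.map Prod.snd)

theorem labObj_append (Q R : LabCtx W) : labObj ob (Q ++ R) = labObj ob Q * labObj ob R := by
  simp [labObj, obj_append]

/-- `IsPerm ob p` says that `p : ⟦Q⟧ ⟶ ⟦Q'⟧` is a permutation isomorphism between two label contexts
that agree up to order: a composite of whiskered symmetries of adjacent wires that moves every
label of `Q` to its position in `Q'`. -/
inductive IsPerm : {Q Q' : LabCtx W} → (labObj ob Q ⟶ labObj ob Q') → Prop
  | nil : IsPerm (Q := []) (Q' := []) (𝟙 _)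
  | cons (a : ℕ × W) {Q Q' : LabCtx W} {p : labObj ob Q ⟶ labObj ob Q'} :
      IsPerm p → IsPerm (Q := a :: Q) (Q' := a :: Q') (lwhisk (ob a.2) p)
  | swap (a b : ℕ × W) (Q : LabCtx W) :
      IsPerm (Q := a :: b :: Q) (Q' := b :: a :: Q)
        (eqToHom (mul_assoc (ob a.2) (ob b.2) (labObj ob Q)).symm ≫
          rwhisk (braid (ob a.2) (ob b.2)) (labObj ob Q) ≫
          eqToHom (mul_assoc (ob b.2) (ob a.2) (labObj ob Q)))
  | trans {Q Q' Q'' : LabCtx W} {p : labObj ob Q ⟶ labObj ob Q'}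
      {q : labObj ob Q' ⟶ labObj ob Q''} : IsPerm p → IsPerm q → IsPerm (p ≫ q)

/-- Circuits `D : Q → L` between label contexts are morphisms `⟦Q⟧ ⟶ ⟦L⟧` of `M`. -/
structure Circuit where
  dom : LabCtx W
  cod : LabCtx W
  hom : labObj ob dom ⟶ labObj ob cod

end Interfaces

/-! ### Grammar of the calculus -/

section Grammar

/-- Wire bundles: `* | ℓ | ⟨b, c⟩`. -/
inductive Bdl : Type
  | unit
  | lab (l : ℕ)
  | pair (b c : Bdl)

/-- Typing of wire bundles, `Q ⊢ b : T` (the value typing rules restricted to wire bundles). -/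
inductive BdlTy {W : Type w} : LabCtx W → Bdl → BTy W → Prop
  | unit : BdlTy [] .unit .unit
  | lab (l : ℕ) (a : W) : BdlTy [(l, a)] (.lab l) (.wire a)
  | pair {Q R : LabCtx W} {b c : Bdl} {T U : BTy W} :
      BdlTy Q b T → BdlTy R c U → BdlTy (Q ++ R) (.pair b c) (.tensor T U)

theorem BdlTy.map_snd {W : Type w} {Q : LabCtx W} {b : Bdl} {T : BTy W} (h : BdlTy Q b T) :
    Q.map Prod.snd = T.toTy.sharp := by
  induction h with
  | unit => rfl
  | lab l a => rfl
  | pair _ _ ih1 ih2 => simp [BTy.toTy, Ty.sharp, ih1, ih2]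

variable {W : Type w} {M : Type u} [StrictSymmPremonoidal.{v} M] (ob : W → M)

mutual

/-- Values (variables are de Bruijn indices). -/
inductive Val : Type (max v w)
  | var (i : ℕ)
  | lab (l : ℕ)
  | unit
  | nat (n : ℕ)
  | lam (A : Ty W) (N : Tm)
  | lift (N : Tm)
  | boxed (b : Bdl) (D : Circuit ob) (c : Bdl)
  | pair (V V' : Val)

/-- Terms.  `dest V N` is `let ⟨x, y⟩ = V in N`, where `y` is index `0` and `x` is index `1` of `N`;
`letin N N'` is `let x = N in N'`, where `x` is index `0` of `N'`. -/
inductive Tm : Type (max v w)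
  | app (V V' : Val)
  | force (V : Val)
  | box (T : BTy W) (V : Val)
  | apply (V V' : Val)
  | dest (V : Val) (N : Tm)
  | ifz (V : Val) (N N' : Tm)
  | ret (V : Val)
  | letin (N N' : Tm)

end

variable {ob}

/-- Wire bundles are values. -/
def Bdl.toVal : Bdl → Val ob
  | .unit => .unit
  | .lab l => .lab l
  | .pair b c => .pair b.toVal c.toVal

/-- Lift a renaming under a binder. -/
def liftRen (r : ℕ → ℕ) : ℕ → ℕ
  | 0 => 0
  | i + 1 => r i + 1

mutual

/-- Renaming of variables in values. -/
def Val.ren (r : ℕ → ℕ) : Val ob → Val ob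
  | .var i => .var (r i)
  | .lab l => .lab l
  | .unit => .unit
  | .nat n => .nat n
  | .lam A N => .lam A (N.ren (liftRen r))
  | .lift N => .lift (N.ren r)
  | .boxed b D c => .boxed b D c
  | .pair V V' => .pair (V.ren r) (V'.ren r)

/-- Renaming of variables in terms. -/
def Tm.ren (r : ℕ → ℕ) : Tm ob → Tm ob
  | .app V V' => .app (V.ren r) (V'.ren r)
  | .force V => .force (V.ren r)
  | .box T V => .box T (V.ren r)
  | .apply V V' => .apply (V.ren r) (V'.ren r)
  | .dest V N => .dest (V.ren r) (N.ren (liftRen (liftRen r)))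
  | .ifz V N N' => .ifz (V.ren r) (N.ren r) (N'.ren r)
  | .ret V => .ret (V.ren r)
  | .letin N N' => .letin (N.ren r) (N'.ren (liftRen r))

end

/-- Lift a substitution under a binder. -/
def liftSub (s : ℕ → Val ob) : ℕ → Val ob
  | 0 => .var 0
  | i + 1 => (s i).ren Nat.succ

mutual

/-- Capture-avoiding simultaneous substitution in values. -/
def Val.sub (s : ℕ → Val ob) : Val ob → Val ob
  | .var i => s i
  | .lab l => .lab l
  | .unit => .unit
  | .nat n => .nat n
  | .lam A N => .lam A (N.sub (liftSub s))
  | .lift N => .lift (N.sub s)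
  | .boxed b D c => .boxed b D c
  | .pair V V' => .pair (V.sub s) (V'.sub s)

/-- Capture-avoiding simultaneous substitution in terms. -/
def Tm.sub (s : ℕ → Val ob) : Tm ob → Tm ob
  | .app V V' => .app (V.sub s) (V'.sub s)
  | .force V => .force (V.sub s)
  | .box T V => .box T (V.sub s)
  | .apply V V' => .apply (V.sub s) (V'.sub s)
  | .dest V N => .dest (V.sub s) (N.sub (liftSub (liftSub s)))
  | .ifz V N N' => .ifz (V.sub s) (N.sub s) (N'.sub s)
  | .ret V => .ret (V.sub s)
  | .letin N N' => .letin (N.sub s) (N'.sub (liftSub s))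

end

/-- The substitution of `V` for the variable `0`. -/
def single (V : Val ob) : ℕ → Val ob
  | 0 => V
  | i + 1 => .var i

/-- The substitution of `V` for the variable `1` and of `V'` for the variable `0`. -/
def double (V V' : Val ob) : ℕ → Val ob
  | 0 => V'
  | 1 => V
  | i + 2 => .var i

end Grammar

/-! ### Typing -/

section Typing

variable {W : Type w} {M : Type u} [StrictSymmPremonoidal.{v} M] {ob : W → M}

mutual

/-- Derivations of the value judgment `Γ ⊢ V : A`. -/
inductive VTy : Ctx W → Val ob → Ty W → Type (max v w)
  | unit {Φ : Ctx W} (hΦ : Ctx.IsParam Φ) : VTy Φ .unit .unit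
  | nat {Φ : Ctx W} (hΦ : Ctx.IsParam Φ) (n : ℕ) : VTy Φ (.nat n) .nat
  | lab {Φ : Ctx W} (hΦ : Ctx.IsParam Φ) (l : ℕ) (a : W) :
      VTy (Φ ++ [.lab l a]) (.lab l) (.wire a)
  | var {Φ : Ctx W} (hΦ : Ctx.IsParam Φ) (i : ℕ) (A : Ty W) :
      VTy (Φ ++ [.var i A]) (.var i) A
  | abs {Γ : Ctx W} {A B : Ty W} {N : Tm ob} :
      CTy (Ctx.shift 1 Γ ++ [.var 0 A]) N B → VTy Γ (.lam A N) (.arrow A B (Ctx.sharp Γ))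
  | lift {Φ : Ctx W} (hΦ : Ctx.IsParam Φ) {A : Ty W} {N : Tm ob} :
      CTy Φ N A → VTy Φ (.lift N) (.bang A)
  | circ {Φ : Ctx W} (hΦ : Ctx.IsParam Φ) {b c : Bdl} {D : Circuit ob} {T U : BTy W}
      {Q L : LabCtx W} (hdom : D.dom.Valid) (hcod : D.cod.Valid)
      (hb : BdlTy Q b T) (hc : BdlTy L c U)
      (p : labObj ob Q ⟶ labObj ob D.dom) (hp : IsPerm ob p)
      (q : labObj ob D.cod ⟶ labObj ob L) (hq : IsPerm ob q) :
      VTy Φ (.boxed b D c) (.circ T U)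
  | pair {Φ Γ₁ Γ₂ : Ctx W} (hΦ : Ctx.IsParam Φ) {V V' : Val ob} {A B : Ty W} :
      VTy (Φ ++ Γ₁) V A → VTy (Φ ++ Γ₂) V' B → VTy (Φ ++ Γ₁ ++ Γ₂) (.pair V V') (.tensor A B)

/-- Derivations of the computation judgment `Γ ⊢ N : A`. -/
inductive CTy : Ctx W → Tm ob → Ty W → Type (max v w)
  | app {Φ Γ₁ Γ₂ : Ctx W} (hΦ : Ctx.IsParam Φ) {V V' : Val ob} {A B : Ty W} {T : List W} :
      VTy (Φ ++ Γ₁) V (.arrow A B T) → VTy (Φ ++ Γ₂) V' A → CTy (Φ ++ Γ₁ ++ Γ₂) (.app V V') B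
  | force {Φ : Ctx W} (hΦ : Ctx.IsParam Φ) {V : Val ob} {A : Ty W} :
      VTy Φ V (.bang A) → CTy Φ (.force V) A
  | box {Φ : Ctx W} (hΦ : Ctx.IsParam Φ) {V : Val ob} {T U : BTy W} :
      VTy Φ V (.arrow T.toTy U.toTy []) → CTy Φ (.box T V) (.circ T U)
  | apply {Φ Γ₁ Γ₂ : Ctx W} (hΦ : Ctx.IsParam Φ) {V V' : Val ob} {T U : BTy W} :
      VTy (Φ ++ Γ₁) V (.circ T U) → VTy (Φ ++ Γ₂) V' T.toTy →
      CTy (Φ ++ Γ₁ ++ Γ₂) (.apply V V') U.toTy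
  | dest {Φ Γ₁ Γ₂ : Ctx W} (hΦ : Ctx.IsParam Φ) {V : Val ob} {N : Tm ob} {A B C : Ty W} :
      VTy (Φ ++ Γ₁) V (.tensor A B) →
      CTy (Ctx.shift 2 (Φ ++ Γ₂) ++ [.var 1 A, .var 0 B]) N C →
      CTy (Φ ++ Γ₂ ++ Γ₁) (.dest V N) C
  | ifz {Φ Γ : Ctx W} (hΦ : Ctx.IsParam Φ) {V : Val ob} {N N' : Tm ob} {A : Ty W} :
      VTy Φ V .nat → CTy (Φ ++ Γ) N A → CTy (Φ ++ Γ) N' A → CTy (Φ ++ Γ) (.ifz V N N') A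
  | ret {Γ : Ctx W} {V : Val ob} {A : Ty W} : VTy Γ V A → CTy Γ (.ret V) A
  | letin {Φ Γ₁ Γ₂ : Ctx W} (hΦ : Ctx.IsParam Φ) {N N' : Tm ob} {A B : Ty W} :
      CTy (Φ ++ Γ₁) N A → CTy (Ctx.shift 1 (Φ ++ Γ₂) ++ [.var 0 A]) N' B →
      CTy (Φ ++ Γ₂ ++ Γ₁) (.letin N N') B
  | ex {Γ₁ Γ₂ : Ctx W} {a b : Entry W} {N : Tm ob} {C : Ty W} :
      CTy (Γ₁ ++ a :: b :: Γ₂) N C → CTy (Γ₁ ++ b :: a :: Γ₂) N C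

end

/-- The circuit parts of the context and of the type of a value agree. -/
theorem VTy.sharp_eq : {Γ : Ctx W} → {V : Val ob} → {A : Ty W} → VTy Γ V A →
    Ctx.sharp Γ = A.sharp
  | _, _, _, .unit hΦ => hΦ.sharp_eq
  | _, _, _, .nat hΦ _ => hΦ.sharp_eq
  | _, _, _, .lab hΦ _ _ => by rw [Ctx.sharp_append, hΦ.sharp_eq]; rfl
  | _, _, _, .var hΦ _ _ => by rw [Ctx.sharp_append, hΦ.sharp_eq]; simp [Ctx.sharp, Entry.ty]
  | _, _, _, .abs _ => rfl
  | _, _, _, .lift hΦ _ => hΦ.sharp_eq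
  | _, _, _, .circ hΦ _ _ _ _ _ _ _ _ => hΦ.sharp_eq
  | _, _, _, .pair hΦ d d' => by
      have h := VTy.sharp_eq d
      have h' := VTy.sharp_eq d'
      rw [Ctx.sharp_append, hΦ.sharp_eq, List.nil_append] at h h'
      rw [Ctx.sharp_append, Ctx.sharp_append, hΦ.sharp_eq, List.nil_append, h, h']
      rfl

end Typing

/-! ### Evaluation -/

section Evaluation

variable {W : Type w} {M : Type u} [StrictSymmPremonoidal.{v} M] {ob : W → M}

theorem BdlTy.labObj_eq (ob : W → M) {Q : LabCtx W} {b : Bdl} {T : BTy W} (h : BdlTy Q b T) :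
    labObj ob Q = obj ob T.toTy.sharp := by
  rw [labObj, h.map_snd]

/-- The morphism `⟦T⟧ ⟶ ⟦U⟧` denoted by a boxed circuit `(b, D, c)`, where `b : T` and `c : U` are
wire bundles listing the inputs and the outputs of `D`, and `p`, `q` are the permutation isomorphisms
from the order of the labels in `b` to that in `D.dom`, and from `D.cod` to that in `c`. -/
def boxHom {Q L : LabCtx W} {b c : Bdl} {D : Circuit ob} {T U : BTy W}
    (hb : BdlTy Q b T) (hc : BdlTy L c U)
    (p : labObj ob Q ⟶ labObj ob D.dom) (q : labObj ob D.cod ⟶ labObj ob L) :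
    obj ob T.toTy.sharp ⟶ obj ob U.toTy.sharp :=
  eqToHom (hb.labObj_eq ob).symm ≫ p ≫ D.hom ≫ q ≫ eqToHom (hc.labObj_eq ob)

/-- Append to `C : Q → L` a morphism `E : ⟦T⟧ ⟶ ⟦U⟧` on the wires listed by the bundle `t : T`,
leaving the remaining wires `R` untouched; the new wires are listed by the bundle `k : U`.
Here `s` rearranges `L` into `Qt, R`, and `s'` rearranges `Qk, R` into `L'`. -/
def append {Q L L' Qt Qk R : LabCtx W} {t k : Bdl} {T U : BTy W}
    (ht : BdlTy Qt t T) (hk : BdlTy Qk k U)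
    (C : labObj ob Q ⟶ labObj ob L) (s : labObj ob L ⟶ labObj ob (Qt ++ R))
    (E : obj ob T.toTy.sharp ⟶ obj ob U.toTy.sharp)
    (s' : labObj ob (Qk ++ R) ⟶ labObj ob L') : labObj ob Q ⟶ labObj ob L' :=
  C ≫ s ≫ eqToHom (by rw [labObj_append, ht.labObj_eq ob]) ≫ rwhisk E (labObj ob R) ≫
    eqToHom (by rw [labObj_append, hk.labObj_eq ob]) ≫ s'

/-- Big-step evaluation `(C, N) ⇓ (C', V)`, where `C : Q → L` and `C' : Q → L'`. -/
inductive Eval : {Q L L' : LabCtx W} → (labObj ob Q ⟶ labObj ob L) → Tm ob →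
    (labObj ob Q ⟶ labObj ob L') → Val ob → Prop
  | app {Q L L' : LabCtx W} {C : labObj ob Q ⟶ labObj ob L} {C' : labObj ob Q ⟶ labObj ob L'}
      {A : Ty W} {N : Tm ob} {V X : Val ob} :
      Eval C (N.sub (single V)) C' X → Eval C (.app (.lam A N) V) C' X
  | dest {Q L L' : LabCtx W} {C : labObj ob Q ⟶ labObj ob L} {C' : labObj ob Q ⟶ labObj ob L'}
      {N : Tm ob} {V V' X : Val ob} :
      Eval C (N.sub (double V V')) C' X → Eval C (.dest (.pair V V') N) C' X
  | force {Q L L' : LabCtx W} {C : labObj ob Q ⟶ labObj ob L} {C' : labObj ob Q ⟶ labObj ob L'}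
      {N : Tm ob} {X : Val ob} :
      Eval C N C' X → Eval C (.force (.lift N)) C' X
  | ifz_zero {Q L L' : LabCtx W} {C : labObj ob Q ⟶ labObj ob L}
      {C' : labObj ob Q ⟶ labObj ob L'} {N N' : Tm ob} {X : Val ob} :
      Eval C N C' X → Eval C (.ifz (.nat 0) N N') C' X
  | ifz_succ {Q L L' : LabCtx W} {C : labObj ob Q ⟶ labObj ob L}
      {C' : labObj ob Q ⟶ labObj ob L'} {n : ℕ} {N N' : Tm ob} {X : Val ob} :
      Eval C N' C' X → Eval C (.ifz (.nat (n + 1)) N N') C' X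
  | ret {Q L : LabCtx W} {C : labObj ob Q ⟶ labObj ob L} {V : Val ob} : Eval C (.ret V) C V
  | letin {Q L L' L'' : LabCtx W} {C : labObj ob Q ⟶ labObj ob L}
      {C' : labObj ob Q ⟶ labObj ob L'} {C'' : labObj ob Q ⟶ labObj ob L''}
      {N N' : Tm ob} {V X : Val ob} :
      Eval C N C' V → Eval C' (N'.sub (single V)) C'' X → Eval C (.letin N N') C'' X
  | box {Q L K K' : LabCtx W} {C : labObj ob Q ⟶ labObj ob L} {T : BTy W} {V : Val ob}
      {b c : Bdl} {D : labObj ob K ⟶ labObj ob K'} :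
      K.Valid → BdlTy K b T → Eval (𝟙 (labObj ob K)) (.app V b.toVal) D c.toVal →
      Eval C (.box T V) C (.boxed b ⟨K, K', D⟩ c)
  | apply {Q L L' Qb Qc Qt Qk R : LabCtx W} {C : labObj ob Q ⟶ labObj ob L}
      {b c t k : Bdl} {D : Circuit ob} {T U : BTy W}
      (hb : BdlTy Qb b T) (hc : BdlTy Qc c U) (ht : BdlTy Qt t T) (hk : BdlTy Qk k U)
      {p : labObj ob Qb ⟶ labObj ob D.dom} {q : labObj ob D.cod ⟶ labObj ob Qc}
      {s : labObj ob L ⟶ labObj ob (Qt ++ R)} {s' : labObj ob (Qk ++ R) ⟶ labObj ob L'} :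
      IsPerm ob p → IsPerm ob q → IsPerm ob s → IsPerm ob s' → L'.Valid →
      Eval C (.apply (.boxed b D c) t.toVal) (append ht hk C s (boxHom hb hc p q) s') k.toVal

/-- Derivations of `Q ⊢ (C, N) : A; Q'` for a configuration with `C : Q → L₀`: up to a permutation of
its outputs, `C` goes from `Q` to `L, Q'` for a label context `L` such that `L ⊢ N : A`. -/
structure ConfigTy {Q L₀ : LabCtx W} (C : labObj ob Q ⟶ labObj ob L₀) (N : Tm ob) (A : Ty W)
    (Q' : LabCtx W) where
  valid_dom : Q.Valid
  valid_cod : L₀.Valid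
  L : LabCtx W
  perm : labObj ob L₀ ⟶ labObj ob (L ++ Q')
  isPerm : IsPerm ob perm
  typing : CTy L.toCtx N A

/-- Derivations of `Q ⊢ (C, V) : A; Q'` for a configuration whose second component is a value. -/
structure ValConfigTy {Q L₀ : LabCtx W} (C : labObj ob Q ⟶ labObj ob L₀) (V : Val ob) (A : Ty W)
    (Q' : LabCtx W) where
  valid_dom : Q.Valid
  valid_cod : L₀.Valid
  L : LabCtx W
  perm : labObj ob L₀ ⟶ labObj ob (L ++ Q')
  isPerm : IsPerm ob perm
  typing : VTy L.toCtx V A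

end Evaluation

/-! ### Interpretation -/

section Interpretation

variable {W : Type w} {M : Type u} [StrictSymmPremonoidal.{v} M] (ob : W → M)

/-- The parameter part `♭⟦A⟧` of a type.  The circuit part `♯⟦A⟧` is `obj ob A.sharp`. -/
def flat : Ty W → Type v
  | .unit => PUnit
  | .nat => ULift ℕ
  | .wire _ => PUnit
  | .tensor A B => flat A × flat B
  | .bang A => PUnit.{v + 1} → Circ 1 (obj ob A.sharp) (flat A)
  | .circ T U => (obj ob T.toTy.sharp ⟶ obj ob U.toTy.sharp)
  | .arrow A B T => flat A → Circ (obj ob T * obj ob A.sharp) (obj ob B.sharp) (flat B)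

/-- The unique element of the parameter part of a bundle type. -/
def BTy.pt : (T : BTy W) → flat ob T.toTy
  | .unit => PUnit.unit
  | .wire _ => PUnit.unit
  | .tensor T U => (BTy.pt T, BTy.pt U)

/-- The parameter part `♭⟦Γ⟧` of a context: the product of the parameter parts of its entries. -/
def flatCtx : Ctx W → Type v
  | [] => PUnit
  | e :: Γ => flat ob e.ty × flatCtx Γ

variable {ob}

/-- `♭⟦Γ⟧ × ♭⟦Δ⟧ → ♭⟦Γ, Δ⟧`. -/
def join : {Γ Δ : Ctx W} → flatCtx ob Γ → flatCtx ob Δ → flatCtx ob (Γ ++ Δ)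
  | [], _, _, y => y
  | _ :: _, _, x, y => (x.1, join x.2 y)

/-- `♭⟦Γ, Δ⟧ → ♭⟦Γ⟧ × ♭⟦Δ⟧`. -/
def split : {Γ Δ : Ctx W} → flatCtx ob (Γ ++ Δ) → flatCtx ob Γ × flatCtx ob Δ
  | [], _, x => (PUnit.unit, x)
  | _ :: _, _, x => ((x.1, (split x.2).1), (split x.2).2)

/-- Shifting variables does not change the parameter part of a context. -/
def shiftEnv (k : ℕ) : {Γ : Ctx W} → flatCtx ob Γ → flatCtx ob (Ctx.shift k Γ)
  | [], _ => PUnit.unit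
  | .lab _ _ :: _, x => (x.1, shiftEnv k x.2)
  | .var _ _ :: _, x => (x.1, shiftEnv k x.2)

/-- The unique element of the parameter part of a label context. -/
def labEnv : (Q : LabCtx W) → flatCtx ob Q.toCtx
  | [] => PUnit.unit
  | _ :: Q => (PUnit.unit, labEnv Q)

/-- The isomorphism `♭⟦T ⊸_I U⟧ ≅ M(⟦T⟧, ⟦U⟧)`, from left to right. -/
def boxMap {T U : BTy W} (f : flat ob (.arrow T.toTy U.toTy [])) : flat ob (.circ T U) :=
  eqToHom (one_mul _).symm ≫ (f (BTy.pt ob T)).2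

mutual

/-- The function `♭⟦Γ⟧ → ♭⟦A⟧` that is the `Set` component of the interpretation of a value. -/
def VTy.fn : {Γ : Ctx W} → {V : Val ob} → {A : Ty W} → VTy Γ V A → flatCtx ob Γ → flat ob A
  | _, _, _, .unit _ => fun _ => PUnit.unit
  | _, _, _, .nat _ n => fun _ => ULift.up n
  | _, _, _, .lab _ _ _ => fun _ => PUnit.unit
  | _, _, _, .var (Φ := Φ) _ i A => fun x => (split (Γ := Φ) (Δ := [.var i A]) x).2.1
  | _, _, _, .abs (Γ := Γ) (A := A) d => fun x a =>
      Circ.pre (eqToHom (by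
          change obj ob (Ctx.sharp Γ) * obj ob A.sharp =
            obj ob (Ctx.sharp (Ctx.shift 1 Γ ++ [.var 0 A]))
          rw [Ctx.sharp_append, Ctx.sharp_shift, obj_append]
          simp [Ctx.sharp, Entry.ty]))
        (d.sem (join (Δ := [.var 0 A]) (shiftEnv 1 x) (a, PUnit.unit)))
  | _, _, _, .lift hΦ d => fun x _ => Circ.pre (eqToHom (by simp [hΦ.sharp_eq, obj])) (d.sem x)
  | _, _, _, .circ _ _ _ hb hc p _ q _ => fun _ => boxHom hb hc p q
  | _, _, _, .pair (Φ := Φ) (Γ₁ := Γ₁) (Γ₂ := Γ₂) _ d d' => fun x =>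
      let y := split (Γ := Φ ++ Γ₁) (Δ := Γ₂) x
      let z := split (Γ := Φ) (Δ := Γ₁) y.1
      (d.fn y.1, d'.fn (join z.1 y.2))

/-- The interpretation of a computation judgment, a morphism
`(♭⟦Γ⟧, ♯⟦Γ⟧) ⟶ (♭⟦A⟧, ♯⟦A⟧)` of the Kleisli category of the circuit monad. -/
def CTy.sem : {Γ : Ctx W} → {N : Tm ob} → {A : Ty W} → CTy Γ N A →
    ((⟨flatCtx ob Γ, obj ob (Ctx.sharp Γ)⟩ : Kl.{v, u} M) ⟶ ⟨flat ob A, obj ob A.sharp⟩)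
  | _, _, _, .app (Φ := Φ) (Γ₁ := Γ₁) (Γ₂ := Γ₂) hΦ d d' => fun x =>
      let y := split (Γ := Φ ++ Γ₁) (Δ := Γ₂) x
      let z := split (Γ := Φ) (Δ := Γ₁) y.1
      Circ.pre (eqToHom (by
          have h := d.sharp_eq
          have h' := d'.sharp_eq
          rw [Ctx.sharp_append, hΦ.sharp_eq, List.nil_append] at h'
          rw [Ctx.sharp_append, h, h', obj_append]
          rfl))
        (d.fn y.1 (d'.fn (join z.1 y.2)))
  | _, _, _, .force hΦ d => fun x =>
      Circ.pre (eqToHom (by simp [hΦ.sharp_eq, obj])) (d.fn x PUnit.unit)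
  | _, _, _, .box hΦ d => fun x =>
      Circ.pre (eqToHom (by simp [hΦ.sharp_eq, Ty.sharp])) (Circ.eta _ (boxMap (d.fn x)))
  | _, _, _, .apply (Φ := Φ) (Γ₁ := Γ₁) (Γ₂ := Γ₂) (U := U) hΦ d d' => fun x =>
      let y := split (Γ := Φ ++ Γ₁) (Δ := Γ₂) x
      (BTy.pt ob U, eqToHom (by
          have h := d.sharp_eq
          have h' := d'.sharp_eq
          rw [Ctx.sharp_append, hΦ.sharp_eq, List.nil_append] at h'
          rw [Ctx.sharp_append, h, h']
          rfl) ≫ d.fn y.1)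
  | _, _, _, .dest (Φ := Φ) (Γ₁ := Γ₁) (Γ₂ := Γ₂) (A := A) (B := B) hΦ d d' => fun x =>
      let y := split (Γ := Φ ++ Γ₂) (Δ := Γ₁) x
      let z := split (Γ := Φ) (Δ := Γ₂) y.1
      let a := d.fn (join z.1 y.2)
      Circ.pre (eqToHom (by
          have h := d.sharp_eq
          rw [Ctx.sharp_append, hΦ.sharp_eq, List.nil_append] at h
          change obj ob (Ctx.sharp (Φ ++ Γ₂ ++ Γ₁)) =
            obj ob (Ctx.sharp (Ctx.shift 2 (Φ ++ Γ₂) ++ [.var 1 A, .var 0 B]))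
          rw [Ctx.sharp_append (Φ ++ Γ₂), h, Ctx.sharp_append (Ctx.shift 2 _), Ctx.sharp_shift]
          simp [Ctx.sharp, Entry.ty, Ty.sharp]))
        (d'.sem (join (Δ := [.var 1 A, .var 0 B]) (shiftEnv 2 y.1) (a.1, a.2, PUnit.unit)))
  | _, _, _, .ifz (Φ := Φ) (Γ := Γ) _ d d₁ d₂ => fun x =>
      match (d.fn (split (Γ := Φ) (Δ := Γ) x).1).down with
      | 0 => d₁.sem x
      | _ + 1 => d₂.sem x
  | _, _, _, .ret d => fun x => Circ.pre (eqToHom (by rw [d.sharp_eq])) (Circ.eta _ (d.fn x))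
  | _, _, _, .letin (Φ := Φ) (Γ₁ := Γ₁) (Γ₂ := Γ₂) (A := A) hΦ d d' => fun x =>
      let y := split (Γ := Φ ++ Γ₂) (Δ := Γ₁) x
      let z := split (Γ := Φ) (Δ := Γ₂) y.1
      Circ.pre (eqToHom (by simp [Ctx.sharp_append, hΦ.sharp_eq, obj_append]))
        (Circ.bind (Circ.liftL (obj ob (Ctx.sharp Γ₂)) (d.sem (join z.1 y.2))) fun a =>
          Circ.pre (eqToHom (by
              rw [Ctx.sharp_append, Ctx.sharp_shift, Ctx.sharp_append, hΦ.sharp_eq,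
                List.nil_append, obj_append]
              simp [Ctx.sharp, Entry.ty]))
            (d'.sem (join (Δ := [.var 0 A]) (shiftEnv 1 y.1) (a, PUnit.unit))))
  | _, _, _, .ex (Γ₁ := Γ₁) (Γ₂ := Γ₂) (a := a) (b := b) d => fun x =>
      let y := split (Γ := Γ₁) (Δ := b :: a :: Γ₂) x
      Circ.pre
        (eqToHom (by simp [Ctx.sharp, obj_append, mul_assoc]) ≫
          lwhisk (obj ob (Ctx.sharp Γ₁))
            (rwhisk (braid (obj ob b.ty.sharp) (obj ob a.ty.sharp)) (obj ob (Ctx.sharp Γ₂))) ≫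
          eqToHom (by simp [Ctx.sharp, obj_append, mul_assoc]))
        (d.sem (join (Δ := a :: b :: Γ₂) y.1 (y.2.2.1, y.2.1, y.2.2.2)))

end

/-- The interpretation of a value judgment, a morphism `(♭⟦Γ⟧, ♯⟦Γ⟧) ⟶ (♭⟦A⟧, ♯⟦A⟧)` of
`Set × disc(Ob M)`. -/
def VTy.sem {Γ : Ctx W} {V : Val ob} {A : Ty W} (d : VTy Γ V A) :
    ((flatCtx ob Γ, ⟨obj ob (Ctx.sharp Γ)⟩) : Type v × Discrete M) ⟶
      (flat ob A, ⟨obj ob A.sharp⟩) :=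
  (TypeCat.ofHom d.fn, Discrete.eqToHom (by rw [d.sharp_eq]))

/-- The morphism `(1, ⟦Q⟧) ⟶ (♭⟦L⟧, ♯⟦L⟧ ⊗ ⟦Q'⟧)` of `Set × M` given by a circuit
`Q → L, Q'`. -/
def circuitMap {Q L Q' : LabCtx W} (C : labObj ob Q ⟶ labObj ob (L ++ Q')) :
    ((PUnit.{v + 1}, labObj ob Q) : Type v × M) ⟶
      (flatCtx ob L.toCtx, obj ob (Ctx.sharp L.toCtx) * labObj ob Q') :=
  (TypeCat.ofHom fun _ => labEnv L,
    C ≫ eqToHom (by rw [labObj_append, LabCtx.sharp_toCtx]; rfl))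

/-- `⟦(C, N)⟧ = J(1, C; perm); (⟦N⟧ ⋉ ⟦Q'⟧)`, a morphism of the Kleisli category. -/
def ConfigTy.sem {Q L₀ Q' : LabCtx W} {C : labObj ob Q ⟶ labObj ob L₀} {N : Tm ob} {A : Ty W}
    (d : ConfigTy C N A Q') :
    J.obj (PUnit.{v + 1}, labObj ob Q) ⟶ J.obj (flat ob A, obj ob A.sharp * labObj ob Q') :=
  J.map (circuitMap (C ≫ d.perm)) ≫ liftR d.typing.sem (labObj ob Q')

/-- `⟦(C, V)⟧ = (1, C; perm); (⟦V⟧ ⋉ ⟦Q'⟧)`, a morphism of `Set × M`. -/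
def ValConfigTy.sem {Q L₀ Q' : LabCtx W} {C : labObj ob Q ⟶ labObj ob L₀} {V : Val ob}
    {A : Ty W} (d : ValConfigTy C V A Q') :
    ((PUnit.{v + 1}, labObj ob Q) : Type v × M) ⟶ (flat ob A, obj ob A.sharp * labObj ob Q') :=
  circuitMap (C ≫ d.perm) ≫
    ((valIncl.map d.typing.sem).1, rwhisk (valIncl.map d.typing.sem).2 (labObj ob Q'))

end Interpretation

end ProtoQuipperC

/-!
A permutation isomorphism is built from symmetries, and no interchange law is at hand, so all that
is used of it is coherence: between duplicate-free lists of labels it is determined by its source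
and target, and it is central because each symmetry is.

The heart of the proof is the substitution lemma: the meaning of `N[V/x]` is the meaning of `N` in
which the environment supplies the meaning of `V` for `x`. Values typed under a binder sit in an
enlarged context, so the lemma is proved for any class of typed values closed under weakening by
parameters and under going below a binder. Applied to variables it yields renaming, which shows that
arbitrary values form such a class. As exchange may end any derivation of a computation, the
derivations to be inverted are first brought into a form in which, in a context of labels, all these
exchanges are collected into one permutation of the wires.

Soundness follows by induction on evaluation, for an arbitrary frame `Q'` of idle wires: in
`let x = N in N'`, the wires of `N'` join the frame while `N` is evaluated.
-/

namespace ProtoQuipperC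

open StrictSymmPremonoidal

/-! ### Symmetries and permutation isomorphisms -/

section Premonoidal

variable {M : Type u} [StrictSymmPremonoidal.{v} M]

@[simp] theorem lwhisk_eqToHom (X : M) {Y Z : M} (h : Y = Z) :
    lwhisk X (eqToHom h) = eqToHom (by rw [h]) := by
  subst h; simp [lwhisk_id]

@[simp] theorem rwhisk_eqToHom (X : M) {Y Z : M} (h : Y = Z) :
    rwhisk (eqToHom h) X = eqToHom (by rw [h]) := by
  subst h; simp [rwhisk_id]

theorem one_lwhisk_eq {Y Z : M} (f : Y ⟶ Z) :
    lwhisk 1 f = eqToHom (one_mul Y) ≫ f ≫ eqToHom (one_mul Z).symm :=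
  (conj_eqToHom_iff_heq _ _ _ (one_mul Z)).2 (one_lwhisk f)

theorem rwhisk_one_eq {Y Z : M} (f : Y ⟶ Z) :
    rwhisk f 1 = eqToHom (mul_one Y) ≫ f ≫ eqToHom (mul_one Z).symm :=
  (conj_eqToHom_iff_heq _ _ _ (mul_one Z)).2 (rwhisk_one f)

theorem mul_lwhisk_eq (X X' : M) {Y Z : M} (f : Y ⟶ Z) :
    lwhisk (X * X') f =
      eqToHom (mul_assoc X X' Y) ≫ lwhisk X (lwhisk X' f) ≫ eqToHom (mul_assoc X X' Z).symm :=
  (conj_eqToHom_iff_heq _ _ _ (mul_assoc X X' Z)).2 (mul_lwhisk X X' f)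

theorem rwhisk_mul_eq (X X' : M) {Y Z : M} (f : Y ⟶ Z) :
    rwhisk f (X * X') =
      eqToHom (mul_assoc Y X X').symm ≫ rwhisk (rwhisk f X) X' ≫ eqToHom (mul_assoc Z X X') :=
  (conj_eqToHom_iff_heq _ _ _ (mul_assoc Z X X').symm).2 (rwhisk_mul X X' f)

theorem rwhisk_lwhisk_eq (X X' : M) {Y Z : M} (f : Y ⟶ Z) :
    rwhisk (lwhisk X f) X' =
      eqToHom (mul_assoc X Y X') ≫ lwhisk X (rwhisk f X') ≫ eqToHom (mul_assoc X Z X').symm :=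
  (conj_eqToHom_iff_heq _ _ _ (mul_assoc X Z X')).2 (lwhisk_rwhisk X X' f)

theorem lwhisk_congr {X X' : M} (h : X = X') {Y Z : M} (f : Y ⟶ Z) :
    lwhisk X f = eqToHom (by rw [h]) ≫ lwhisk X' f ≫ eqToHom (by rw [h]) := by
  subst h; simp

/-- The symmetry of two adjacent wires `X`, `Y` in front of `Z`. -/
def sw (X Y Z : M) : X * (Y * Z) ⟶ Y * (X * Z) :=
  eqToHom (mul_assoc X Y Z).symm ≫ rwhisk (braid X Y) Z ≫ eqToHom (mul_assoc Y X Z)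

theorem sw_congr {X X' Y Y' Z Z' : M} (h : X = X') (h' : Y = Y') (h'' : Z = Z') :
    sw X Y Z = eqToHom (by rw [h, h', h'']) ≫ sw X' Y' Z' ≫ eqToHom (by rw [h, h', h'']) := by
  subst h h' h''; simp

theorem sw_sw (X Y Z : M) : sw X Y Z ≫ sw Y X Z = 𝟙 _ := by
  have h := congrArg (fun f => rwhisk f Z) (braid_braid X Y)
  simp only [rwhisk_comp, rwhisk_id] at h
  simp [sw, reassoc_of% h]

theorem sw_sw_assoc (X Y Z : M) {R : M} (f : X * (Y * Z) ⟶ R) :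
    sw X Y Z ≫ sw Y X Z ≫ f = f := by
  rw [← Category.assoc, sw_sw, Category.id_comp]

theorem sw_natural (X Y : M) {Z Z' : M} (f : Z ⟶ Z') :
    lwhisk X (lwhisk Y f) ≫ sw X Y Z' = sw X Y Z ≫ lwhisk Y (lwhisk X f) := by
  have h := braid_central_left X Y f
  rw [mul_lwhisk_eq, mul_lwhisk_eq] at h
  have h' := congrArg (fun g => eqToHom (mul_assoc X Y Z).symm ≫ g ≫ eqToHom (mul_assoc Y X Z')) h
  simp only [Category.assoc, eqToHom_trans, eqToHom_refl, Category.comp_id,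
    eqToHom_trans_assoc, Category.id_comp] at h'
  simp only [sw, Category.assoc]
  exact h'.symm

theorem sw_natural_left {X X' : M} (f : X ⟶ X') (Y Z : M) :
    rwhisk f (Y * Z) ≫ sw X' Y Z = sw X Y Z ≫ lwhisk Y (rwhisk f Z) := by
  have h := congrArg (fun g => rwhisk g Z) (braid_naturality f Y)
  simp only [rwhisk_comp, rwhisk_lwhisk_eq] at h
  simp only [sw, rwhisk_mul_eq, Category.assoc, eqToHom_trans_assoc, eqToHom_refl,
    Category.id_comp]
  rw [reassoc_of% h]
  simp

theorem sw_natural_right {Y Y' : M} (f : Y ⟶ Y') (X Z : M) :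
    lwhisk X (rwhisk f Z) ≫ sw X Y' Z = sw X Y Z ≫ rwhisk f (X * Z) := by
  have h := congrArg (fun g => sw X Y Z ≫ g ≫ sw X Y' Z) (sw_natural_left f X Z)
  simp only [Category.assoc, sw_sw, sw_sw_assoc, Category.comp_id] at h
  exact h.symm

theorem sw_mul_right (X Y Y' Z : M) :
    sw X (Y * Y') Z = eqToHom (by simp only [mul_assoc]) ≫ sw X Y (Y' * Z) ≫
      lwhisk Y (sw X Y' Z) ≫ eqToHom (by simp only [mul_assoc]) := by
  simp only [sw, hexagon, rwhisk_comp, lwhisk_comp, rwhisk_eqToHom, lwhisk_eqToHom,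
    rwhisk_mul_eq, rwhisk_lwhisk_eq, Category.assoc, eqToHom_trans, eqToHom_trans_assoc]

theorem sw_mul_left (X X' Y Z : M) :
    sw (X * X') Y Z = eqToHom (by simp only [mul_assoc]) ≫ lwhisk X (sw X' Y Z) ≫
      sw X Y (X' * Z) ≫ eqToHom (by simp only [mul_assoc]) := by
  have h := sw_mul_right Y X X' Z
  have h1 : sw (X * X') Y Z ≫ sw Y (X * X') Z ≫ eqToHom (by simp only [mul_assoc]) ≫
      lwhisk X (sw X' Y Z) ≫ sw X Y (X' * Z) =
        sw (X * X') Y Z ≫ eqToHom (by simp only [mul_assoc]) := by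
    rw [h]
    have h2 := congrArg (lwhisk X) (sw_sw Y X' Z)
    rw [lwhisk_comp, lwhisk_id] at h2
    simp [reassoc_of% h2, sw_sw]
  rw [sw_sw_assoc] at h1
  calc _ = (sw (X * X') Y Z ≫ eqToHom (by simp only [mul_assoc] : _ = Y * (X * (X' * Z)))) ≫
        eqToHom (by simp only [mul_assoc]) := by simp
    _ = _ := by rw [← h1]; simp

theorem rwhisk_braid_eq (X Y Z : M) :
    rwhisk (braid X Y) Z =
      eqToHom (mul_assoc X Y Z) ≫ sw X Y Z ≫ eqToHom (mul_assoc Y X Z).symm := by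
  simp [sw]

theorem yang_baxter (X Y Z R : M) :
    sw X Y (Z * R) ≫ lwhisk Y (sw X Z R) ≫ sw Y Z (X * R) =
      lwhisk X (sw Y Z R) ≫ sw X Z (Y * R) ≫ lwhisk Z (sw X Y R) := by
  have h := sw_natural_right (braid Y Z) X R
  rw [sw_mul_right, sw_mul_right, rwhisk_braid_eq, rwhisk_braid_eq] at h
  simp only [lwhisk_comp, Category.assoc, eqToHom_trans_assoc, lwhisk_eqToHom,
    eqToHom_comp_iff, eqToHom_refl, Category.id_comp] at h
  simp only [← Category.assoc, cancel_mono] at h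
  simpa using h.symm

theorem sw_one_right (X Z : M) : sw X 1 Z = eqToHom (by simp only [one_mul]) := by
  -- The hexagon law makes `sw X 1 Z` idempotent, and it is invertible by `sw_sw`.
  have h := sw_mul_right X 1 1 Z
  rw [sw_congr rfl (one_mul (1 : M)) rfl, sw_congr (X := X) (Z := 1 * Z) rfl rfl (one_mul Z),
    one_lwhisk_eq] at h
  have h1 : sw X 1 Z ≫ 𝟙 _ = sw X 1 Z ≫ eqToHom (by simp only [one_mul]) ≫ sw X 1 Z ≫
      eqToHom (by simp only [one_mul]) := by
    simp only [Category.assoc, eqToHom_trans_assoc, eqToHom_comp_iff, eqToHom_refl,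
      Category.id_comp] at h
    rw [comp_eqToHom_iff] at h
    rw [Category.comp_id]
    refine h.trans ?_
    simp
  have h2 := congrArg (fun f => sw 1 X Z ≫ f) h1
  simp only [sw_sw_assoc] at h2
  rw [eq_comm, eqToHom_comp_iff, comp_eqToHom_iff] at h2
  simpa using h2

theorem sw_one_left (Y Z : M) : sw 1 Y Z = eqToHom (by simp only [one_mul]) := by
  have h := sw_sw Y 1 Z
  rw [sw_one_right] at h
  simpa [eqToHom_comp_iff] using h

theorem extract_square_cons (A : M) {B Z Z' Z₀ Z₀' : M} {p : Z ⟶ Z'} {e : Z ⟶ B * Z₀}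
    {e' : Z' ⟶ B * Z₀'} {p' : Z₀ ⟶ Z₀'} (h : p ≫ e' = e ≫ lwhisk B p') :
    lwhisk A p ≫ lwhisk A e' ≫ sw A B Z₀' =
      (lwhisk A e ≫ sw A B Z₀) ≫ lwhisk B (lwhisk A p') := by
  rw [Category.assoc, ← sw_natural, ← Category.assoc, ← lwhisk_comp, h, lwhisk_comp, Category.assoc]

theorem extract_square_swap_here (X Y Z : M) :
    sw X Y Z ≫ lwhisk Y (𝟙 (X * Z)) ≫ sw Y X Z = 𝟙 _ ≫ lwhisk X (𝟙 (Y * Z)) := by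
  simp [lwhisk_id, sw_sw]

theorem extract_square_swap_there_here (X Y Z : M) :
    sw X Y Z ≫ 𝟙 _ = (lwhisk X (𝟙 (Y * Z)) ≫ sw X Y Z) ≫ lwhisk Y (𝟙 (X * Z)) := by
  simp [lwhisk_id]

theorem extract_square_swap_there_there (X Y : M) {B Z Z₀ : M} (e : Z ⟶ B * Z₀) :
    sw X Y Z ≫ lwhisk Y (lwhisk X e ≫ sw X B Z₀) ≫ sw Y B (X * Z₀) =
      (lwhisk X (lwhisk Y e ≫ sw Y B Z₀) ≫ sw X B (Y * Z₀)) ≫ lwhisk B (sw X Y Z₀) := by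
  simp only [lwhisk_comp, Category.assoc]
  rw [← yang_baxter, ← Category.assoc, ← sw_natural, Category.assoc]

/-- A morphism is central when it interchanges with every morphism on its left. -/
def Central {X Y : M} (p : X ⟶ Y) : Prop :=
  ∀ ⦃A B : M⦄ (f : A ⟶ B), lwhisk A p ≫ rwhisk f Y = rwhisk f X ≫ lwhisk B p

theorem Central.id (X : M) : Central (𝟙 X) := fun A B f => by simp [lwhisk_id]

theorem Central.comp {X Y Z : M} {p : X ⟶ Y} {q : Y ⟶ Z} (hp : Central p) (hq : Central q) :
    Central (p ≫ q) := fun A B f => by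
  rw [lwhisk_comp, Category.assoc, hq, ← Category.assoc, hp, Category.assoc, lwhisk_comp]

theorem Central.eqToHom {X Y : M} (h : X = Y) : Central (eqToHom h) := by
  subst h; exact .id X

theorem Central.braid (X Y : M) : Central (braid X Y) := fun A _ f =>
  braid_central_right X Y (A := A) f

theorem Central.lwhisk {X Y : M} {p : X ⟶ Y} (hp : Central p) (Z : M) :
    Central (lwhisk Z p) := fun A B f => by
  have h := hp (rwhisk f Z)
  rw [mul_lwhisk_eq, mul_lwhisk_eq] at h
  rw [rwhisk_mul_eq, rwhisk_mul_eq]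
  simp only [Category.assoc, eqToHom_comp_iff] at h
  rw [← cancel_mono (CategoryTheory.eqToHom (mul_assoc B Z Y).symm)]
  simp only [Category.assoc, eqToHom_trans, eqToHom_refl, Category.comp_id]
  rw [h]

theorem Central.rwhisk {X Y : M} {p : X ⟶ Y} (hp : Central p) (Z : M) :
    Central (rwhisk p Z) := fun A B f => by
  have h := congrArg (fun g => StrictSymmPremonoidal.rwhisk g Z) (hp f)
  simp only [rwhisk_comp, rwhisk_lwhisk_eq, Category.assoc, eqToHom_comp_iff] at h
  rw [rwhisk_mul_eq, rwhisk_mul_eq]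
  rw [← cancel_mono (CategoryTheory.eqToHom (mul_assoc B Y Z).symm)]
  simp only [Category.assoc, eqToHom_trans, eqToHom_refl, Category.comp_id]
  rw [h]

theorem Central.sw (X Y Z : M) : Central (sw X Y Z) :=
  (Central.eqToHom _).comp (((Central.braid X Y).rwhisk Z).comp (.eqToHom _))

end Premonoidal

section Permutations

variable {W : Type w} {M : Type u} [StrictSymmPremonoidal.{v} M] {ob : W → M}

theorem IsPerm.refl : (Q : LabCtx W) → IsPerm ob (𝟙 (labObj ob Q))
  | [] => .nil
  | a :: Q => by
      have h := IsPerm.cons a (IsPerm.refl Q)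
      exact (lwhisk_id (ob a.2) (labObj ob Q)) ▸ h

theorem IsPerm.eqToHom {Q Q' : LabCtx W} (h : Q = Q') :
    IsPerm ob (eqToHom (by rw [h]) : labObj ob Q ⟶ labObj ob Q') := by
  subst h; exact .refl Q

theorem IsPerm.listPerm {Q Q' : LabCtx W} {p : labObj ob Q ⟶ labObj ob Q'} (h : IsPerm ob p) :
    Q.Perm Q' := by
  induction h with
  | nil => exact .nil
  | cons a _ ih => exact ih.cons a
  | swap a b Q => exact .swap b a Q
  | trans _ _ ih1 ih2 => exact ih1.trans ih2

variable (ob) in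
theorem exists_isPerm {Q Q' : LabCtx W} (h : Q.Perm Q') :
    ∃ p : labObj ob Q ⟶ labObj ob Q', IsPerm ob p := by
  induction h with
  | nil => exact ⟨_, .nil⟩
  | cons a _ ih => exact ⟨_, ih.choose_spec.cons a⟩
  | swap a b Q => exact ⟨_, .swap b a Q⟩
  | trans _ _ ih1 ih2 => exact ⟨_, ih1.choose_spec.trans ih2.choose_spec⟩

theorem IsPerm.exists_inv {Q Q' : LabCtx W} {p : labObj ob Q ⟶ labObj ob Q'} (h : IsPerm ob p) :
    ∃ q : labObj ob Q' ⟶ labObj ob Q, IsPerm ob q ∧ p ≫ q = 𝟙 _ := by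
  induction h with
  | nil => exact ⟨_, .nil, by simp⟩
  | cons a _ ih =>
    obtain ⟨q, hq, e⟩ := ih
    exact ⟨_, hq.cons a,
      (lwhisk_comp _ _ _).symm.trans ((congrArg _ e).trans (lwhisk_id _ _))⟩
  | swap a b Q => exact ⟨_, .swap b a Q, sw_sw _ _ _⟩
  | trans _ _ ih1 ih2 =>
    obtain ⟨q1, hq1, e1⟩ := ih1
    obtain ⟨q2, hq2, e2⟩ := ih2
    exact ⟨_, hq2.trans hq1, by rw [Category.assoc, reassoc_of% e2, e1]⟩

/-- `Extract b Q Q₀ e` says that `Q₀` is `Q` without one occurrence of `b`, and that `e` moves the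
wire of this occurrence to the front. -/
inductive Extract (ob : W → M) (b : ℕ × W) :
    (Q Q₀ : LabCtx W) → (labObj ob Q ⟶ ob b.2 * labObj ob Q₀) → Prop
  | here (Q : LabCtx W) : Extract ob b (b :: Q) Q (𝟙 _)
  | there (a : ℕ × W) {Q Q₀ : LabCtx W} {e : labObj ob Q ⟶ ob b.2 * labObj ob Q₀} :
      Extract ob b Q Q₀ e →
      Extract ob b (a :: Q) (a :: Q₀) (lwhisk (ob a.2) e ≫ sw (ob a.2) (ob b.2) (labObj ob Q₀))

theorem Extract.mem {b : ℕ × W} {Q Q₀ : LabCtx W} {e : labObj ob Q ⟶ ob b.2 * labObj ob Q₀}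
    (h : Extract ob b Q Q₀ e) : b ∈ Q := by
  induction h with
  | here => simp
  | there a _ ih => simp [ih]

theorem Extract.exists_of_mem {b : ℕ × W} : {Q : LabCtx W} → b ∈ Q →
    ∃ (Q₀ : LabCtx W) (e : labObj ob Q ⟶ ob b.2 * labObj ob Q₀), Extract ob b Q Q₀ e
  | a :: Q, h => by
      rcases List.mem_cons.1 h with rfl | h
      · exact ⟨_, _, .here Q⟩
      · obtain ⟨Q₀, e, he⟩ := Extract.exists_of_mem h
        exact ⟨_, _, .there a he⟩

theorem IsPerm.extract {Q Q' : LabCtx W} {p : labObj ob Q ⟶ labObj ob Q'} (h : IsPerm ob p)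
    {b : ℕ × W} {Q₀ : LabCtx W} {e : labObj ob Q ⟶ ob b.2 * labObj ob Q₀}
    (he : Extract ob b Q Q₀ e) :
    ∃ (Q₀' : LabCtx W) (e' : labObj ob Q' ⟶ ob b.2 * labObj ob Q₀')
      (p' : labObj ob Q₀ ⟶ labObj ob Q₀'),
      Extract ob b Q' Q₀' e' ∧ IsPerm ob p' ∧ p ≫ e' = e ≫ lwhisk (ob b.2) p' := by
  induction h generalizing Q₀ with
  | nil => cases he
  | cons a hp ih =>
    cases he with
    | here Q => exact ⟨_, _, _, .here _, hp,
        (Category.comp_id _).trans (Category.id_comp _).symm⟩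
    | there _ he =>
      obtain ⟨Q₀', e', p', he', hp', h⟩ := ih he
      exact ⟨_, _, _, .there a he', hp'.cons a, extract_square_cons _ h⟩
  | swap a c Q =>
    cases he with
    | here => exact ⟨_, _, _, .there c (.here Q), .refl _, extract_square_swap_here _ _ _⟩
    | there _ he =>
      cases he with
      | here => exact ⟨_, _, _, .here _, .refl _, extract_square_swap_there_here _ _ _⟩
      | there _ he =>
        exact ⟨_, _, _, .there c (.there a he), .swap a c _, extract_square_swap_there_there _ _ _⟩
  | trans _ _ ih1 ih2 =>
    obtain ⟨Q₁, e₁, p₁, he₁, hp₁, h₁⟩ := ih1 he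
    obtain ⟨Q₂, e₂, p₂, he₂, hp₂, h₂⟩ := ih2 he₁
    exact ⟨_, _, _, he₂, hp₁.trans hp₂, by
      rw [Category.assoc, h₂, reassoc_of% h₁, lwhisk_comp]⟩

theorem IsPerm.eq_id_of_nil {Q Q' : LabCtx W} {p : labObj ob Q ⟶ labObj ob Q'} (hp : IsPerm ob p)
    (hQ : Q = []) (hQ' : Q' = []) : p = CategoryTheory.eqToHom (by rw [hQ, hQ']) := by
  induction hp with
  | nil => rfl
  | cons => cases hQ
  | swap => cases hQ
  | trans h _ ih1 ih2 =>
    subst hQ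
    rw [ih1 rfl h.listPerm.nil_eq.symm, ih2 h.listPerm.nil_eq.symm hQ', eqToHom_trans]

theorem IsPerm.unique_of_nodup {Q Q' : LabCtx W} (hQ : Q'.Nodup) {p q : labObj ob Q ⟶ labObj ob Q'}
    (hp : IsPerm ob p) (hq : IsPerm ob q) : p = q := by
  induction Q' generalizing Q with
  | nil =>
    obtain rfl := hp.listPerm.eq_nil
    rw [hp.eq_id_of_nil rfl rfl, hq.eq_id_of_nil rfl rfl]
  | cons b R ih =>
    have hb : b ∈ Q := hp.listPerm.mem_iff.2 (by simp)
    obtain ⟨Q₀, e, he⟩ := Extract.exists_of_mem (ob := ob) hb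
    rw [List.nodup_cons] at hQ
    obtain ⟨_, _, p', he₁, hp', h₁⟩ := hp.extract he
    obtain ⟨_, _, q', he₂, hq', h₂⟩ := hq.extract he
    cases he₁ with
    | there _ h => exact absurd h.mem hQ.1
    | here =>
    cases he₂ with
    | there _ h => exact absurd h.mem hQ.1
    | here =>
    rw [ih hQ.2 hp' hq', ← h₂] at h₁
    exact (Category.comp_id p).symm.trans (h₁.trans (Category.comp_id q))

theorem LabCtx.Valid.nodup {Q : LabCtx W} (h : Q.Valid) : Q.Nodup := List.Nodup.of_map _ h

theorem LabCtx.Valid.perm {Q Q' : LabCtx W} (h : Q.Valid) (h' : Q.Perm Q') : Q'.Valid :=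
  (h'.map Prod.fst).nodup_iff.1 h

theorem IsPerm.unique {Q Q' : LabCtx W} (hQ : Q.Valid) {p q : labObj ob Q ⟶ labObj ob Q'}
    (hp : IsPerm ob p) (hq : IsPerm ob q) : p = q :=
  hp.unique_of_nodup (hQ.perm hp.listPerm).nodup hq

theorem IsPerm.central {Q Q' : LabCtx W} {p : labObj ob Q ⟶ labObj ob Q'} (hp : IsPerm ob p) :
    Central p := by
  induction hp with
  | nil => exact .id _
  | cons a _ ih => exact ih.lwhisk _
  | swap a b Q => exact .sw _ _ _
  | trans _ _ ih1 ih2 => exact ih1.comp ih2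

end Permutations

section Blocks

variable {M : Type u} [StrictSymmPremonoidal.{v} M]

theorem lwhisk_conj_lwhisk (A X : M) {Z Z' U U' : M} (p : Z ⟶ Z')
    (h : U = X * Z) (h' : X * Z' = U') :
    lwhisk A (eqToHom h ≫ lwhisk X p ≫ eqToHom h') =
      eqToHom (by rw [h, mul_assoc]) ≫ lwhisk (A * X) p ≫ eqToHom (by rw [← h', mul_assoc]) := by
  subst h h'; simp [mul_lwhisk_eq]

theorem lwhisk_conj_rwhisk (A X : M) {Z Z' U U' : M} (p : Z ⟶ Z')
    (h : U = Z * X) (h' : Z' * X = U') :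
    lwhisk A (eqToHom h ≫ rwhisk p X ≫ eqToHom h') =
      eqToHom (by rw [h, mul_assoc]) ≫ rwhisk (lwhisk A p) X ≫
        eqToHom (by rw [← h', mul_assoc]) := by
  subst h h'; simp [rwhisk_lwhisk_eq]

theorem rwhisk_sw (X Y Z R : M) {U : M} (h : U = Z * R) :
    eqToHom (by simp only [h, mul_assoc]) ≫ rwhisk (sw X Y Z) R ≫
      eqToHom (by simp only [h, mul_assoc]) = sw X Y U := by
  subst h; simp [sw, rwhisk_comp, rwhisk_mul_eq]

theorem sw_block_cons_right (A B X Z : M) {U U' : M} (h : U = X * Z) (h' : X * (A * Z) = U') :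
    sw A B U ≫ lwhisk B (eqToHom (by rw [h]) ≫ sw A X Z ≫ eqToHom h') =
      eqToHom (by rw [h, mul_assoc]) ≫ sw A (B * X) Z ≫ eqToHom (by rw [← h', mul_assoc]) := by
  subst h h'; simp [sw_mul_right]

theorem sw_block_cons_left (A X Y Z : M) {U V R T : M} (h : U = X * (Y * Z)) (h' : V = X * Z)
    (h'' : Y * (X * Z) = R) (h3 : R = Y * V) (h4 : Y * (A * V) = T) :
    lwhisk A (eqToHom h ≫ sw X Y Z ≫ eqToHom h'') ≫
        eqToHom (congrArg (A * ·) h3) ≫ sw A Y V ≫ eqToHom h4 =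
      eqToHom (by rw [h, mul_assoc]) ≫ sw (A * X) Y Z ≫ eqToHom (by rw [← h4, h', mul_assoc]) := by
  subst h h' h'' h4; simp [sw_mul_left]

theorem conj_one_lwhisk {X Z Z' : M} (hX : X = 1) (p : Z ⟶ Z') (h : Z = X * Z) (h' : X * Z' = Z') :
    eqToHom h ≫ lwhisk X p ≫ eqToHom h' = p := by
  subst hX; simp [one_lwhisk_eq]

theorem conj_sw_one_right {X Y Z U : M} (hY : Y = 1) (h : U = X * (Y * Z))
    (h' : Y * (X * Z) = U) : eqToHom h ≫ sw X Y Z ≫ eqToHom h' = 𝟙 U := by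
  subst hY; simp [sw_one_right]

theorem conj_sw_one_left {X Y Z U : M} (hX : X = 1) (h : U = X * (Y * Z))
    (h' : Y * (X * Z) = U) : eqToHom h ≫ sw X Y Z ≫ eqToHom h' = 𝟙 U := by
  subst hX; simp [sw_one_left]

theorem conj_comp {X Y Z X' Y' Z' : M} (f : X ⟶ Y) (g : Y ⟶ Z) (h : X' = X) (h' : Y = Y')
    (h'' : Z = Z') :
    (eqToHom h ≫ f ≫ eqToHom h') ≫ eqToHom h'.symm ≫ g ≫ eqToHom h'' =
      eqToHom h ≫ (f ≫ g) ≫ eqToHom h'' := by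
  subst h h' h''; simp

variable {W : Type w} {ob : W → M}

theorem IsPerm.of_eq {Q Q' : LabCtx W} {p q : labObj ob Q ⟶ labObj ob Q'} (hp : IsPerm ob p)
    (h : p = q) : IsPerm ob q := h ▸ hp

theorem IsPerm.lwhisk_block {Q Q' : LabCtx W} {p : labObj ob Q ⟶ labObj ob Q'}
    (hp : IsPerm ob p) : (R : LabCtx W) →
    IsPerm ob (Q := R ++ Q) (Q' := R ++ Q') (CategoryTheory.eqToHom (labObj_append ob R Q) ≫
      lwhisk (labObj ob R) p ≫ CategoryTheory.eqToHom (labObj_append ob R Q').symm)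
  | [] => hp.of_eq (conj_one_lwhisk rfl p _ _).symm
  | a :: R => ((hp.lwhisk_block R).cons a).of_eq (lwhisk_conj_lwhisk _ _ _ _ _)

theorem IsPerm.rwhisk_block {Q Q' : LabCtx W} {p : labObj ob Q ⟶ labObj ob Q'}
    (hp : IsPerm ob p) (R : LabCtx W) :
    IsPerm ob (Q := Q ++ R) (Q' := Q' ++ R) (CategoryTheory.eqToHom (labObj_append ob Q R) ≫
      rwhisk p (labObj ob R) ≫ CategoryTheory.eqToHom (labObj_append ob Q' R).symm) := by
  induction hp with
  | nil => exact (IsPerm.refl ([] ++ R)).of_eq (by simp [rwhisk_id])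
  | cons a _ ih => exact (ih.cons a).of_eq (lwhisk_conj_rwhisk _ _ _ _ _)
  | swap a b Q =>
    exact (IsPerm.swap a b (Q ++ R)).of_eq (rwhisk_sw _ _ _ _ (labObj_append ob Q R)).symm
  | trans _ _ ih1 ih2 =>
    exact (ih1.trans ih2).of_eq ((conj_comp _ _ _ _ _).trans (by rw [rwhisk_comp]))

theorem IsPerm.swap_block_one (a : ℕ × W) (R : LabCtx W) : (H : LabCtx W) →
    IsPerm ob (Q := a :: (H ++ R)) (Q' := H ++ a :: R)
      (CategoryTheory.eqToHom (congrArg (ob a.2 * ·) (labObj_append ob H R)) ≫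
        sw (ob a.2) (labObj ob H) (labObj ob R) ≫
        CategoryTheory.eqToHom (labObj_append ob H (a :: R)).symm)
  | [] => (IsPerm.refl _).of_eq (conj_sw_one_right (Y := labObj ob []) rfl _ _).symm
  | b :: H => ((IsPerm.swap a b (H ++ R)).trans ((IsPerm.swap_block_one a R H).cons b)).of_eq
      (sw_block_cons_right _ _ _ _ (labObj_append ob H R) (labObj_append ob H (a :: R)).symm)

theorem IsPerm.swap_block (H R : LabCtx W) : (G : LabCtx W) →
    IsPerm ob (Q := G ++ (H ++ R)) (Q' := H ++ (G ++ R))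
      (CategoryTheory.eqToHom (by simp only [labObj_append]) ≫
        sw (labObj ob G) (labObj ob H) (labObj ob R) ≫
        CategoryTheory.eqToHom (by simp only [labObj_append]))
  | [] => (IsPerm.refl _).of_eq (conj_sw_one_left (X := labObj ob []) rfl _ _).symm
  | a :: G => (((IsPerm.swap_block H R G).cons a).trans
      (IsPerm.swap_block_one a (G ++ R) H)).of_eq
      (sw_block_cons_left _ _ _ _ _ (labObj_append ob G R) _ (labObj_append ob H (G ++ R)) _)

end Blocks

/-! ### Environments -/

section Environments

variable {W : Type w} {M : Type u} [StrictSymmPremonoidal.{v} M] {ob : W → M}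

@[simp] theorem split_join : {Γ Δ : Ctx W} → (x : flatCtx ob Γ) → (y : flatCtx ob Δ) →
    split (join x y) = (x, y)
  | [], _, _, _ => rfl
  | _ :: _, _, x, y =>
      have ih := split_join x.2 y
      Prod.ext (Prod.ext rfl (congrArg (fun z => z.1) ih)) ((congrArg (fun z => z.2) ih :))

@[simp] theorem join_split : {Γ Δ : Ctx W} → (x : flatCtx ob (Γ ++ Δ)) →
    join (split x).1 (split x).2 = x
  | [], _, _ => rfl
  | _ :: Γ, _, x => Prod.ext rfl (join_split (Γ := Γ) x.2)

theorem exists_join {Γ Δ : Ctx W} (x : flatCtx ob (Γ ++ Δ)) :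
    ∃ (y : flatCtx ob Γ) (z : flatCtx ob Δ), x = join y z :=
  ⟨_, _, (join_split x).symm⟩

/-- Transport of environments along an equality of contexts. -/
def castEnv {Γ Δ : Ctx W} (h : Γ = Δ) (x : flatCtx ob Γ) : flatCtx ob Δ := h ▸ x

@[simp] theorem castEnv_rfl {Γ : Ctx W} (x : flatCtx ob Γ) : castEnv rfl x = x := rfl

theorem castEnv_castEnv {Γ Δ Θ : Ctx W} (h : Γ = Δ) (h' : Δ = Θ) (x : flatCtx ob Γ) :
    castEnv h' (castEnv h x) = castEnv (h.trans h') x := by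
  subst h h'; rfl

theorem castEnv_cons {e : Entry W} {Γ Δ : Ctx W} (h : Γ = Δ) (x : flatCtx ob (e :: Γ)) :
    castEnv (congrArg (e :: ·) h) x = (x.1, castEnv h x.2) := by
  subst h; rfl

theorem castEnv_join_join : {Γ Δ Θ : Ctx W} → (x : flatCtx ob Γ) → (y : flatCtx ob Δ) →
    (z : flatCtx ob Θ) →
    castEnv (List.append_assoc Γ Δ Θ).symm (join x (join y z)) = join (join x y) z
  | [], _, _, _, _, _ => rfl
  | e :: Γ, Δ, Θ, x, y, z =>
      (castEnv_cons (e := e) (List.append_assoc Γ Δ Θ).symm (join x (join y z))).trans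
        (congrArg (Prod.mk x.1) (castEnv_join_join (Γ := Γ) x.2 y z))

theorem castEnv_join_join' {Γ Δ Θ : Ctx W} (x : flatCtx ob Γ) (y : flatCtx ob Δ)
    (z : flatCtx ob Θ) :
    castEnv (List.append_assoc Γ Δ Θ) (join (join x y) z) = join x (join y z) := by
  rw [← castEnv_join_join, castEnv_castEnv, castEnv_rfl]

theorem castEnv_append_nil : {Γ : Ctx W} → (x : flatCtx ob Γ) →
    castEnv (List.append_nil Γ).symm x = join (Δ := []) x PUnit.unit
  | [], _ => rfl
  | _ :: Γ, x => (castEnv_cons (List.append_nil Γ).symm x).trans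
      (congrArg (Prod.mk x.1) (castEnv_append_nil (Γ := Γ) x.2))

theorem of_castEnv {α : Type*} {R : (Γ : Ctx W) → (flatCtx ob Γ → α) → Prop} {Γ Δ : Ctx W}
    {f : flatCtx ob Γ → α} {g : flatCtx ob Δ → α} (hR : R Γ f) (h : Γ = Δ)
    (hg : ∀ x, g (castEnv h x) = f x) : R Δ g := by
  subst h; obtain rfl : g = f := funext hg; exact hR

/-- The projection `♭⟦Φ, Γ₁, Γ₂⟧ → ♭⟦Φ, Γ₂⟧`, by which the second premise of a typing rule with two
premises reads its environment. -/
def dropMid {Φ Γ₁ Γ₂ : Ctx W} (x : flatCtx ob (Φ ++ Γ₁ ++ Γ₂)) : flatCtx ob (Φ ++ Γ₂) :=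
  join (split (split x).1).1 (split x).2

@[simp] theorem dropMid_join {Φ Γ₁ Γ₂ : Ctx W} (x : flatCtx ob Φ) (y : flatCtx ob Γ₁)
    (z : flatCtx ob Γ₂) : dropMid (join (join x y) z) = join x z := by
  simp [dropMid]

/-- The map of environments that acts separately on two parts of a context. -/
def joinMap {Γ₁ Γ₂ Δ₁ Δ₂ : Ctx W} (f : flatCtx ob Δ₁ → flatCtx ob Γ₁)
    (g : flatCtx ob Δ₂ → flatCtx ob Γ₂) (x : flatCtx ob (Δ₁ ++ Δ₂)) : flatCtx ob (Γ₁ ++ Γ₂) :=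
  join (f (split x).1) (g (split x).2)

section JoinMap

variable {Γ₁ Γ₂ Γ₃ Δ₁ Δ₂ Δ₃ : Ctx W} (f₁ : flatCtx ob Δ₁ → flatCtx ob Γ₁)
  (f₂ : flatCtx ob Δ₂ → flatCtx ob Γ₂) (f₃ : flatCtx ob Δ₃ → flatCtx ob Γ₃)

@[simp] theorem joinMap_join (x : flatCtx ob Δ₁) (y : flatCtx ob Δ₂) :
    joinMap f₁ f₂ (join x y) = join (f₁ x) (f₂ y) := by
  simp [joinMap]

@[simp] theorem split_joinMap (x : flatCtx ob (Δ₁ ++ Δ₂)) :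
    split (joinMap f₁ f₂ x) = (f₁ (split x).1, f₂ (split x).2) := split_join _ _

theorem dropMid_joinMap (x : flatCtx ob (Δ₁ ++ Δ₂ ++ Δ₃)) :
    dropMid (joinMap (joinMap f₁ f₂) f₃ x) = joinMap f₁ f₃ (dropMid x) := by
  simp [dropMid]

end JoinMap

theorem joinMap_joinMap_castEnv {e : Entry W} {Γ₂ Γ₃ Δ₁ Δ₂ Δ₃ : Ctx W}
    (f₁ : flatCtx ob Δ₁ → flatCtx ob [e]) (f₂ : flatCtx ob Δ₂ → flatCtx ob Γ₂)
    (f₃ : flatCtx ob Δ₃ → flatCtx ob Γ₃) (x : flatCtx ob (Δ₁ ++ (Δ₂ ++ Δ₃))) :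
    joinMap (joinMap f₁ f₂) f₃ (castEnv (List.append_assoc Δ₁ Δ₂ Δ₃).symm x) =
      joinMap f₁ (joinMap f₂ f₃) x := by
  obtain ⟨x, y, rfl⟩ := exists_join x
  obtain ⟨y, z, rfl⟩ := exists_join y
  rw [castEnv_join_join]
  simp only [joinMap_join]
  rfl

theorem joinMap_castEnv_append_nil {e : Entry W} {Δ : Ctx W} (f : flatCtx ob Δ → flatCtx ob [e])
    (x : flatCtx ob Δ) : joinMap (Γ₂ := []) (Δ₂ := []) f (fun _ => PUnit.unit)
      (castEnv (List.append_nil Δ).symm x) = f x := by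
  rw [castEnv_append_nil]
  exact joinMap_join (Γ₂ := []) (Δ₂ := []) f _ x PUnit.unit

theorem Ctx.shift_append (k : ℕ) (Γ Δ : Ctx W) :
    Ctx.shift k (Γ ++ Δ) = Ctx.shift k Γ ++ Ctx.shift k Δ := List.map_append

theorem castEnv_shiftEnv_join (k : ℕ) {Δ : Ctx W} : {Γ : Ctx W} → (x : flatCtx ob Γ) →
    (y : flatCtx ob Δ) →
    castEnv (Ctx.shift_append k Γ Δ) (shiftEnv k (join x y)) = join (shiftEnv k x) (shiftEnv k y)
  | [], _, _ => rfl
  | .lab _ _ :: Γ, x, y => (castEnv_cons (Ctx.shift_append k Γ Δ) _).trans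
      (congrArg (Prod.mk x.1) (castEnv_shiftEnv_join k (Γ := Γ) x.2 y))
  | .var _ _ :: Γ, x, y => (castEnv_cons (Ctx.shift_append k Γ Δ) _).trans
      (congrArg (Prod.mk x.1) (castEnv_shiftEnv_join k (Γ := Γ) x.2 y))

/-- The inverse of `shiftEnv`. -/
def unshiftEnv (k : ℕ) : {Γ : Ctx W} → flatCtx ob (Ctx.shift k Γ) → flatCtx ob Γ
  | [], _ => PUnit.unit
  | .lab _ _ :: _, x => (x.1, unshiftEnv k x.2)
  | .var _ _ :: _, x => (x.1, unshiftEnv k x.2)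

@[simp] theorem unshiftEnv_shiftEnv (k : ℕ) : {Γ : Ctx W} → (x : flatCtx ob Γ) →
    unshiftEnv k (shiftEnv k x) = x
  | [], _ => rfl
  | .lab _ _ :: Γ, x => congrArg (Prod.mk x.1) (unshiftEnv_shiftEnv k (Γ := Γ) x.2)
  | .var _ _ :: Γ, x => congrArg (Prod.mk x.1) (unshiftEnv_shiftEnv k (Γ := Γ) x.2)

@[simp] theorem shiftEnv_unshiftEnv (k : ℕ) : {Γ : Ctx W} → (x : flatCtx ob (Ctx.shift k Γ)) →
    shiftEnv k (unshiftEnv k x) = x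
  | [], _ => rfl
  | .lab _ _ :: Γ, x => congrArg (Prod.mk x.1) (shiftEnv_unshiftEnv k (Γ := Γ) x.2)
  | .var _ _ :: Γ, x => congrArg (Prod.mk x.1) (shiftEnv_unshiftEnv k (Γ := Γ) x.2)

/-- The map of environments of shifted contexts that corresponds to `f`. -/
def shiftMap (k : ℕ) {Γ Δ : Ctx W} (f : flatCtx ob Δ → flatCtx ob Γ)
    (x : flatCtx ob (Ctx.shift k Δ)) : flatCtx ob (Ctx.shift k Γ) := shiftEnv k (f (unshiftEnv k x))

@[simp] theorem shiftMap_shiftEnv (k : ℕ) {Γ Δ : Ctx W} (f : flatCtx ob Δ → flatCtx ob Γ)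
    (x : flatCtx ob Δ) : shiftMap k f (shiftEnv k x) = shiftEnv k (f x) := by
  simp [shiftMap]

theorem shiftMap_joinMap_castEnv (k : ℕ) {Γ₁ Γ₂ Δ₁ Δ₂ : Ctx W} (f₁ : flatCtx ob Δ₁ → flatCtx ob Γ₁)
    (f₂ : flatCtx ob Δ₂ → flatCtx ob Γ₂) (x : flatCtx ob (Ctx.shift k Δ₁ ++ Ctx.shift k Δ₂)) :
    castEnv (Ctx.shift_append k Γ₁ Γ₂)
        (shiftMap k (joinMap f₁ f₂) (castEnv (Ctx.shift_append k Δ₁ Δ₂).symm x)) =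
      joinMap (shiftMap k f₁) (shiftMap k f₂) x := by
  obtain ⟨x, y, rfl⟩ := exists_join x
  obtain ⟨x, rfl⟩ : ∃ x', x = shiftEnv k x' := ⟨_, (shiftEnv_unshiftEnv k x).symm⟩
  obtain ⟨y, rfl⟩ : ∃ y', y = shiftEnv k y' := ⟨_, (shiftEnv_unshiftEnv k y).symm⟩
  rw [← castEnv_shiftEnv_join, castEnv_castEnv]
  simp [castEnv_shiftEnv_join]

/-- The environment with one variable. -/
def varEnv (i : ℕ) (A : Ty W) (a : flat ob A) : flatCtx ob [.var i A] := (a, PUnit.unit)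

/-- The environment with two variables. -/
def varEnv₂ (i : ℕ) (A : Ty W) (j : ℕ) (B : Ty W) (a : flat ob A) (b : flat ob B) :
    flatCtx ob [.var i A, .var j B] := (a, b, PUnit.unit)

end Environments

section Exchange

variable {W : Type w} {M : Type u} [StrictSymmPremonoidal.{v} M] {ob : W → M}

namespace Circ

variable {S T U V : M} {X Y : Type v}

@[simp] theorem pre_id (m : Circ T U X) : pre (𝟙 T) m = m := by simp [pre]

@[simp] theorem pre_pre (f : S ⟶ T) (g : T ⟶ U) (m : Circ U V X) :
    pre f (pre g m) = pre (f ≫ g) m := by simp [pre]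

end Circ

theorem obj_sharp_append (Γ Δ : Ctx W) :
    obj ob (Ctx.sharp (Γ ++ Δ)) = obj ob (Ctx.sharp Γ) * obj ob (Ctx.sharp Δ) := by
  rw [Ctx.sharp_append, obj_append]

theorem obj_sharp_cons (e : Entry W) (Γ : Ctx W) :
    obj ob (Ctx.sharp (e :: Γ)) = obj ob e.ty.sharp * obj ob (Ctx.sharp Γ) :=
  obj_append ob e.ty.sharp (Ctx.sharp Γ)

/-- `CTy.sem` as a plain function, so that no morphism of the Kleisli category intervenes. -/
def CTy.run {Γ : Ctx W} {N : Tm ob} {A : Ty W} (d : CTy Γ N A) (x : flatCtx ob Γ) :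
    Circ (obj ob (Ctx.sharp Γ)) (obj ob A.sharp) (flat ob A) := d.sem x

theorem CTy.exists_cast {Γ Δ : Ctx W} (h : Γ = Δ) {N : Tm ob} {A : Ty W} (d : CTy Γ N A) :
    ∃ d' : CTy Δ N A, ∀ x, d'.run (castEnv h x) = Circ.pre (eqToHom (by rw [h])) (d.run x) := by
  subst h; exact ⟨d, fun x => by simp⟩

/-- `Exch Γ Γ' f p` says that the final part `Γ'` of the context of any computation can be
rearranged into `Γ`, which precomposes its interpretation with `f` and `p`. -/
def Exch (Γ Γ' : Ctx W) (f : flatCtx ob Γ → flatCtx ob Γ')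
    (p : obj ob (Ctx.sharp Γ) ⟶ obj ob (Ctx.sharp Γ')) : Prop :=
  ∀ ⦃Θ : Ctx W⦄ ⦃N : Tm ob⦄ ⦃A : Ty W⦄ (d : CTy (Θ ++ Γ') N A), ∃ d' : CTy (Θ ++ Γ) N A,
    ∀ (x : flatCtx ob Θ) (y : flatCtx ob Γ), d'.run (join x y) =
      Circ.pre (eqToHom (obj_sharp_append Θ Γ) ≫ lwhisk (obj ob (Ctx.sharp Θ)) p ≫
        eqToHom (obj_sharp_append Θ Γ').symm) (d.run (join x (f y)))

namespace Exch

theorem of_eq {Γ Γ' : Ctx W} {f f' : flatCtx ob Γ → flatCtx ob Γ'}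
    {p p' : obj ob (Ctx.sharp Γ) ⟶ obj ob (Ctx.sharp Γ')} (h : Exch Γ Γ' f p)
    (hf : ∀ x, f x = f' x) (hp : p = p') : Exch Γ Γ' f' p' := by
  obtain rfl := funext hf; exact hp ▸ h

theorem refl (Γ : Ctx W) : Exch (ob := ob) Γ Γ (fun x => x) (𝟙 _) := fun Θ N A d =>
  ⟨d, fun x y => by simp [lwhisk_id]⟩

theorem trans {Γ Γ' Γ'' : Ctx W} {f : flatCtx ob Γ → flatCtx ob Γ'}
    {f' : flatCtx ob Γ' → flatCtx ob Γ''} {p : obj ob (Ctx.sharp Γ) ⟶ obj ob (Ctx.sharp Γ')}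
    {p' : obj ob (Ctx.sharp Γ') ⟶ obj ob (Ctx.sharp Γ'')} (h : Exch Γ Γ' f p)
    (h' : Exch Γ' Γ'' f' p') : Exch Γ Γ'' (fun x => f' (f x)) (p ≫ p') := fun Θ N A d => by
  obtain ⟨d', e'⟩ := h' d
  obtain ⟨d'', e''⟩ := h d'
  exact ⟨d'', fun x y => by rw [e'', e']; simp [lwhisk_comp]⟩

theorem cons (e : Entry W) {Γ Γ' : Ctx W} {f : flatCtx ob Γ → flatCtx ob Γ'}
    {p : obj ob (Ctx.sharp Γ) ⟶ obj ob (Ctx.sharp Γ')} (h : Exch Γ Γ' f p) :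
    Exch (e :: Γ) (e :: Γ') (fun x => (x.1, f x.2))
      (eqToHom (obj_sharp_cons e Γ) ≫ lwhisk (obj ob e.ty.sharp) p ≫
        eqToHom (obj_sharp_cons e Γ').symm) := fun Θ N A d => by
  obtain ⟨d₁, e₁⟩ := d.exists_cast (List.append_assoc Θ [e] Γ').symm
  obtain ⟨d₂, e₂⟩ := h d₁
  obtain ⟨d₃, e₃⟩ := d₂.exists_cast (List.append_assoc Θ [e] Γ)
  refine ⟨d₃, fun x y => ?_⟩
  let z : flatCtx ob (Θ ++ [e]) := join x (Δ := [e]) (y.1, PUnit.unit)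
  have h₁ : d₁.run (join z (f y.2)) = _ := (congrArg d₁.run
    (castEnv_join_join x (Δ := [e]) (y.1, PUnit.unit) (f y.2))).symm.trans (e₁ _)
  have h₃ : d₃.run (join x y) = _ := (congrArg d₃.run
    (castEnv_join_join' x (Δ := [e]) (y.1, PUnit.unit) y.2)).symm.trans (e₃ (join z y.2))
  rw [h₃, e₂, h₁]
  have hO : obj ob (Ctx.sharp (Θ ++ [e])) = obj ob (Ctx.sharp Θ) * obj ob e.ty.sharp := by
    rw [obj_sharp_append]; simp [Ctx.sharp]
  simp only [List.cons_append, List.nil_append, lwhisk_congr hO, mul_lwhisk_eq, Category.assoc,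
    eqToHom_trans, eqToHom_trans_assoc, Circ.pre_pre, lwhisk_comp, lwhisk_eqToHom]
  rfl

theorem swap (a b : Entry W) (Γ : Ctx W) :
    Exch (ob := ob) (b :: a :: Γ) (a :: b :: Γ) (fun x => (x.2.1, x.1, x.2.2))
      (eqToHom (by rw [obj_sharp_cons, obj_sharp_cons]) ≫
        sw (obj ob b.ty.sharp) (obj ob a.ty.sharp) (obj ob (Ctx.sharp Γ)) ≫
        eqToHom (by rw [obj_sharp_cons, obj_sharp_cons])) := fun Θ N A d => by
  refine ⟨.ex d, fun x y => ?_⟩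
  rw [CTy.run, CTy.run, CTy.sem]
  simp [sw, lwhisk_comp]

theorem swap_block_one (b : Entry W) (Γ : Ctx W) : (G : Ctx W) →
    Exch (ob := ob) (b :: (G ++ Γ)) (G ++ b :: Γ)
      (fun x => join (split x.2).1 (Δ := b :: Γ) (x.1, (split x.2).2))
      (eqToHom (by rw [obj_sharp_cons, obj_sharp_append]) ≫
        sw (obj ob b.ty.sharp) (obj ob (Ctx.sharp G)) (obj ob (Ctx.sharp Γ)) ≫
        eqToHom (by rw [obj_sharp_append, obj_sharp_cons]))
  | [] => (refl (b :: Γ)).of_eq (fun _ => rfl)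
      (conj_sw_one_right (Y := obj ob (Ctx.sharp [])) rfl _ _).symm
  | c :: G => ((swap c b (G ++ Γ)).trans ((swap_block_one b Γ G).cons c)).of_eq (fun _ => rfl) (by
      simp [sw_congr rfl (obj_sharp_cons c G) rfl, sw_mul_right, lwhisk_comp,
        sw_congr rfl rfl (obj_sharp_append G Γ)])

theorem swap_block (G Γ : Ctx W) : (H : Ctx W) →
    Exch (ob := ob) (H ++ (G ++ Γ)) (G ++ (H ++ Γ))
      (fun x => join (split (split x).2).1 (join (split x).1 (split (split x).2).2))
      (eqToHom (by simp only [obj_sharp_append]) ≫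
        sw (obj ob (Ctx.sharp H)) (obj ob (Ctx.sharp G)) (obj ob (Ctx.sharp Γ)) ≫
        eqToHom (by simp only [obj_sharp_append]))
  | [] => (refl (G ++ Γ)).of_eq (fun x => (join_split x).symm)
      (conj_sw_one_left (X := obj ob (Ctx.sharp [])) rfl _ _).symm
  | b :: H => (((swap_block G Γ H).cons b).trans (swap_block_one b (H ++ Γ) G)).of_eq
      (fun x => by simp only [split_join]; rfl) (by
      simp [sw_congr (obj_sharp_cons b H) rfl rfl, sw_mul_left, lwhisk_comp,
        sw_congr rfl rfl (obj_sharp_append H Γ)])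

end Exch

end Exchange

section Denotation

variable {W : Type w} {M : Type u} [StrictSymmPremonoidal.{v} M] {ob : W → M}

/-- The elements of the parameter part of an arrow type, as functions. -/
def arrowFn {A B : Ty W} {T : List W} (f : flat ob (.arrow A B T)) (a : flat ob A) :
    Circ (obj ob T * obj ob A.sharp) (obj ob B.sharp) (flat ob B) := f a

/-- The elements of the parameter part of `!A`, as suspended computations. -/
def bangFn {A : Ty W} (f : flat ob (.bang A)) : Circ 1 (obj ob A.sharp) (flat ob A) := f PUnit.unit

/-- The elements of the parameter part of a circuit type, as morphisms. -/
def circFn {T U : BTy W} (f : flat ob (.circ T U)) :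
    obj ob T.toTy.sharp ⟶ obj ob U.toTy.sharp := f

/-- The elements of the parameter part of a tensor type, as pairs. -/
def pairFn {A B : Ty W} (a : flat ob (.tensor A B)) : flat ob A × flat ob B := a

/-- The elements of the parameter part of `Nat`, as numbers. -/
def natFn (n : flat ob (.nat : Ty W)) : ℕ := (show ULift.{v} ℕ from n).down

theorem arrow_ext {A B : Ty W} {T : List W} {f g : flat ob (.arrow A B T)}
    (h : ∀ a, arrowFn f a = arrowFn g a) : f = g := funext h

theorem bang_ext {A : Ty W} {f g : flat ob (.bang A)} (h : bangFn f = bangFn g) : f = g :=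
  funext fun _ => h

namespace VTy

theorem fn_var {Φ : Ctx W} (hΦ : Ctx.IsParam Φ) (i : ℕ) {A : Ty W}
    (x : flatCtx ob (Φ ++ [.var i A])) : (VTy.var hΦ i A).fn x = (split x).2.1 := rfl

theorem arrowFn_fn_abs {Γ : Ctx W} {A B : Ty W} {N : Tm ob}
    (d : CTy (Ctx.shift 1 Γ ++ [.var 0 A]) N B)
    (e : obj ob (Ctx.sharp Γ) * obj ob A.sharp = obj ob (Ctx.sharp (Ctx.shift 1 Γ ++ [.var 0 A])))
    (x : flatCtx ob Γ) (a : flat ob A) :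
    arrowFn ((VTy.abs d).fn x) a =
      Circ.pre (eqToHom e) (d.run (join (shiftEnv 1 x) (varEnv 0 A a))) := rfl

theorem bangFn_fn_lift {Φ : Ctx W} (hΦ : Ctx.IsParam Φ) {A : Ty W} {N : Tm ob} (d : CTy Φ N A)
    (e : (1 : M) = obj ob (Ctx.sharp Φ)) (x : flatCtx ob Φ) :
    bangFn ((VTy.lift hΦ d).fn x) = Circ.pre (eqToHom e) (d.run x) := rfl

theorem pairFn_fn_pair {Φ Γ₁ Γ₂ : Ctx W} (hΦ : Ctx.IsParam Φ) {V V' : Val ob} {A B : Ty W}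
    (d₁ : VTy (Φ ++ Γ₁) V A) (d₂ : VTy (Φ ++ Γ₂) V' B) (x : flatCtx ob (Φ ++ Γ₁ ++ Γ₂)) :
    pairFn ((VTy.pair hΦ d₁ d₂).fn x) = (d₁.fn (split x).1, d₂.fn (dropMid x)) := rfl

theorem exists_abs {Γ : Ctx W} {A B : Ty W} {T : List W} {N : Tm ob} (h : T = Ctx.sharp Γ)
    (d : CTy (Ctx.shift 1 Γ ++ [.var 0 A]) N B)
    (e : obj ob T * obj ob A.sharp = obj ob (Ctx.sharp (Ctx.shift 1 Γ ++ [.var 0 A]))) :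
    ∃ d' : VTy Γ (.lam A N) (.arrow A B T), ∀ x a, arrowFn (d'.fn x) a =
      Circ.pre (eqToHom e) (d.run (join (shiftEnv 1 x) (varEnv 0 A a))) := by
  subst h; exact ⟨.abs d, fun _ _ => rfl⟩

end VTy

namespace CTy

theorem run_app {Φ Γ₁ Γ₂ : Ctx W} (hΦ : Ctx.IsParam Φ) {V V' : Val ob} {A B : Ty W} {T : List W}
    (d₁ : VTy (Φ ++ Γ₁) V (.arrow A B T)) (d₂ : VTy (Φ ++ Γ₂) V' A)
    (e : obj ob (Ctx.sharp (Φ ++ Γ₁ ++ Γ₂)) = obj ob T * obj ob A.sharp)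
    (x : flatCtx ob (Φ ++ Γ₁ ++ Γ₂)) :
    (CTy.app hΦ d₁ d₂).run x =
      Circ.pre (eqToHom e) (arrowFn (d₁.fn (split x).1) (d₂.fn (dropMid x))) := rfl

theorem run_force {Φ : Ctx W} (hΦ : Ctx.IsParam Φ) {V : Val ob} {A : Ty W} (d : VTy Φ V (.bang A))
    (e : obj ob (Ctx.sharp Φ) = 1) (x : flatCtx ob Φ) :
    (CTy.force hΦ d).run x = Circ.pre (eqToHom e) (bangFn (d.fn x)) := rfl

theorem run_box {Φ : Ctx W} (hΦ : Ctx.IsParam Φ) {V : Val ob} {T U : BTy W}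
    (d : VTy Φ V (.arrow T.toTy U.toTy []))
    (e : obj ob (Ctx.sharp Φ) = obj ob (Ty.circ T U).sharp) (x : flatCtx ob Φ) :
    (CTy.box hΦ d).run x = (boxMap (d.fn x), eqToHom e) :=
  Prod.ext rfl (Category.comp_id _)

theorem run_apply {Φ Γ₁ Γ₂ : Ctx W} (hΦ : Ctx.IsParam Φ) {V V' : Val ob} {T U : BTy W}
    (d₁ : VTy (Φ ++ Γ₁) V (.circ T U)) (d₂ : VTy (Φ ++ Γ₂) V' T.toTy)
    (e : obj ob (Ctx.sharp (Φ ++ Γ₁ ++ Γ₂)) = obj ob T.toTy.sharp)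
    (x : flatCtx ob (Φ ++ Γ₁ ++ Γ₂)) :
    (CTy.apply hΦ d₁ d₂).run x = (BTy.pt ob U, eqToHom e ≫ circFn (d₁.fn (split x).1)) := rfl

theorem run_dest {Φ Γ₁ Γ₂ : Ctx W} (hΦ : Ctx.IsParam Φ) {V : Val ob} {N : Tm ob} {A B C : Ty W}
    (d₁ : VTy (Φ ++ Γ₁) V (.tensor A B))
    (d₂ : CTy (Ctx.shift 2 (Φ ++ Γ₂) ++ [.var 1 A, .var 0 B]) N C)
    (e : obj ob (Ctx.sharp (Φ ++ Γ₂ ++ Γ₁)) =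
      obj ob (Ctx.sharp (Ctx.shift 2 (Φ ++ Γ₂) ++ [.var 1 A, .var 0 B])))
    (x : flatCtx ob (Φ ++ Γ₂ ++ Γ₁)) :
    (CTy.dest hΦ d₁ d₂).run x = Circ.pre (eqToHom e)
      (d₂.run (join (shiftEnv 2 (split x).1) (varEnv₂ 1 A 0 B (pairFn (d₁.fn (dropMid x))).1
        (pairFn (d₁.fn (dropMid x))).2))) := rfl

theorem run_ifz {Φ Γ : Ctx W} (hΦ : Ctx.IsParam Φ) {V : Val ob} {N N' : Tm ob} {A : Ty W}
    (d : VTy Φ V .nat) (d₁ : CTy (Φ ++ Γ) N A) (d₂ : CTy (Φ ++ Γ) N' A)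
    (x : flatCtx ob (Φ ++ Γ)) :
    (CTy.ifz hΦ d d₁ d₂).run x =
      match natFn (d.fn (split x).1) with
      | 0 => d₁.run x
      | _ + 1 => d₂.run x := rfl

theorem run_ret {Γ : Ctx W} {V : Val ob} {A : Ty W} (d : VTy Γ V A)
    (e : obj ob (Ctx.sharp Γ) = obj ob A.sharp) (x : flatCtx ob Γ) :
    (CTy.ret d).run x = (d.fn x, eqToHom e) :=
  Prod.ext rfl (Category.comp_id _)

theorem run_letin {Φ Γ₁ Γ₂ : Ctx W} (hΦ : Ctx.IsParam Φ) {N N' : Tm ob} {A B : Ty W}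
    (d₁ : CTy (Φ ++ Γ₁) N A) (d₂ : CTy (Ctx.shift 1 (Φ ++ Γ₂) ++ [.var 0 A]) N' B)
    (e : obj ob (Ctx.sharp (Φ ++ Γ₂ ++ Γ₁)) =
      obj ob (Ctx.sharp Γ₂) * obj ob (Ctx.sharp (Φ ++ Γ₁)))
    (e' : obj ob (Ctx.sharp Γ₂) * obj ob A.sharp =
      obj ob (Ctx.sharp (Ctx.shift 1 (Φ ++ Γ₂) ++ [.var 0 A])))
    (x : flatCtx ob (Φ ++ Γ₂ ++ Γ₁)) :
    (CTy.letin hΦ d₁ d₂).run x =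
      Circ.pre (eqToHom e ≫ lwhisk (obj ob (Ctx.sharp Γ₂)) (d₁.run (dropMid x)).2 ≫ eqToHom e')
        (d₂.run (join (shiftEnv 1 (split x).1) (varEnv 0 A (d₁.run (dropMid x)).1))) := by
  have h : (CTy.letin hΦ d₁ d₂).run x = Circ.pre (eqToHom e)
      (Circ.bind (Circ.liftL (obj ob (Ctx.sharp Γ₂)) (d₁.run (dropMid x))) fun a =>
        Circ.pre (eqToHom e') (d₂.run (join (shiftEnv 1 (split x).1) (varEnv 0 A a)))) := rfl
  rw [h]
  simp [Circ.pre, Circ.bind, Circ.mu, Circ.map, Circ.liftL]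

theorem run_ex {Γ₁ Γ₂ : Ctx W} {a b : Entry W} {N : Tm ob} {A : Ty W}
    (d : CTy (Γ₁ ++ a :: b :: Γ₂) N A) (x : flatCtx ob (Γ₁ ++ b :: a :: Γ₂)) :
    (CTy.ex d).run x = Circ.pre
      (eqToHom (by rw [obj_sharp_append, obj_sharp_cons, obj_sharp_cons]) ≫
        lwhisk (obj ob (Ctx.sharp Γ₁))
          (sw (obj ob b.ty.sharp) (obj ob a.ty.sharp) (obj ob (Ctx.sharp Γ₂))) ≫
        eqToHom (by rw [obj_sharp_append, obj_sharp_cons, obj_sharp_cons]))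
      (d.run (join (split x).1 (Δ := a :: b :: Γ₂)
        ((split x).2.2.1, (split x).2.1, (split x).2.2.2))) := by
  rw [CTy.run, CTy.sem]
  simp only [sw, lwhisk_comp, lwhisk_eqToHom, Category.assoc, eqToHom_trans, eqToHom_trans_assoc]
  rfl

end CTy

end Denotation

/-! ### Substitution -/

section ContextSubstitution

variable {W : Type w} {M : Type u} [StrictSymmPremonoidal.{v} M] {ob : W → M}

theorem VTy.isParam : {Γ : Ctx W} → {V : Val ob} → {A : Ty W} → VTy Γ V A → A.IsParam →
    Ctx.IsParam Γ
  | _, _, _, .unit hΦ, _ => hΦ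
  | _, _, _, .nat hΦ _, _ => hΦ
  | _, _, _, .lab _ _ _, h => h.elim
  | _, _, _, .var hΦ _ _, h => fun e he => by
      rcases List.mem_append.1 he with he | he
      · exact hΦ e he
      · obtain rfl := List.mem_singleton.1 he; exact h
  | _, _, _, .abs _, h => h.elim
  | _, _, _, .lift hΦ _, _ => hΦ
  | _, _, _, .circ hΦ _ _ _ _ _ _ _ _, _ => hΦ
  | _, _, _, .pair _ d d', h => fun e he => by
      rcases List.mem_append.1 he with he | he
      · exact d.isParam h.1 e he
      · exact d'.isParam h.2 e (List.mem_append_right _ he)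

theorem Ctx.IsParam.nil : Ctx.IsParam ([] : Ctx W) := fun _ he => absurd he List.not_mem_nil

theorem Ctx.IsParam.append {Γ Δ : Ctx W} (h : Ctx.IsParam Γ) (h' : Ctx.IsParam Δ) :
    Ctx.IsParam (Γ ++ Δ) := fun e he => (List.mem_append.1 he).elim (h e) (h' e)

theorem Entry.isParam_shift {k : ℕ} {e : Entry W} (h : e.ty.IsParam) :
    (e.shift k).ty.IsParam := by cases e <;> exact h

/-- A class of typed values together with their interpretations. -/
abbrev ValClass (ob : W → M) : Type (max w v) :=
  (G : Ctx W) → Val ob → (A : Ty W) → (flatCtx ob G → flat ob A) → Prop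

/-- The closure conditions under which the values of a class may be substituted for variables.
Variables and, once renamings are available, all values satisfy them. -/
structure ValClass.Closed (P : ValClass ob) : Prop where
  weaken {G : Ctx W} {V : Val ob} {A : Ty W} {g : flatCtx ob G → flat ob A} : P G V A g →
    ∀ {Φ : Ctx W}, Ctx.IsParam Φ → ∃ d : VTy (Φ ++ G) V A, ∀ x, d.fn x = g (split x).2
  shift_one {G : Ctx W} {V : Val ob} {A : Ty W} {g : flatCtx ob G → flat ob A} : P G V A g →
    P (Ctx.shift 1 G) (V.ren Nat.succ) A fun x => g (unshiftEnv 1 x)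
  shift_two {G : Ctx W} {V : Val ob} {A : Ty W} {g : flatCtx ob G → flat ob A} : P G V A g →
    P (Ctx.shift 2 G) ((V.ren Nat.succ).ren Nat.succ) A fun x => g (unshiftEnv 2 x)
  var (i : ℕ) (A : Ty W) : P [.var i A] (.var i) A fun x => x.1

variable (P : ValClass ob) (s s' : ℕ → Val ob)

/-- `EntrySub P s e G f`: the context `G` types what `s` substitutes for the entry `e`, and `f` is
its interpretation. -/
inductive EntrySub : (e : Entry W) → (G : Ctx W) → (flatCtx ob G → flatCtx ob [e]) → Prop
  | lab (l : ℕ) (a : W) : EntrySub (.lab l a) [.lab l a] fun x => x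
  | var (i : ℕ) {A : Ty W} {G : Ctx W} {g : flatCtx ob G → flat ob A} :
      P G (s i) A g → EntrySub (.var i A) G fun x => varEnv i A (g x)

/-- `CtxSub P s Γ Δ f`: the context `Δ` types the substitution of `s` for the entries of `Γ`,
and `f` is its interpretation. -/
inductive CtxSub : (Γ Δ : Ctx W) → (flatCtx ob Δ → flatCtx ob Γ) → Prop
  | nil : CtxSub [] [] fun _ => PUnit.unit
  | cons {e : Entry W} {G Γ Δ : Ctx W} {g : flatCtx ob G → flatCtx ob [e]}
      {f : flatCtx ob Δ → flatCtx ob Γ} : EntrySub P s e G g → CtxSub Γ Δ f →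
      CtxSub (e :: Γ) (G ++ Δ) (joinMap (Γ₁ := [e]) g f)

/-- `CtxSub` up to additional parameters in front of the context. -/
inductive WkCtxSub (Γ : Ctx W) : (Δ : Ctx W) → (flatCtx ob Δ → flatCtx ob Γ) → Prop
  | strict {Δ : Ctx W} {f : flatCtx ob Δ → flatCtx ob Γ} : CtxSub P s Γ Δ f → WkCtxSub Γ Δ f
  | weaken {Δ : Ctx W} {f : flatCtx ob Δ → flatCtx ob Γ} (e : Entry W) : e.ty.IsParam →
      WkCtxSub Γ Δ f → WkCtxSub Γ (e :: Δ) fun x => f x.2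

/-- The maps of environments that act separately on two parts of a context, by maps which satisfy
`R₁` and `R₂`. -/
inductive Joined {Γ₁ Γ₂ : Ctx W} (R₁ : (Δ : Ctx W) → (flatCtx ob Δ → flatCtx ob Γ₁) → Prop)
    (R₂ : (Δ : Ctx W) → (flatCtx ob Δ → flatCtx ob Γ₂) → Prop) :
    (Δ : Ctx W) → (flatCtx ob Δ → flatCtx ob (Γ₁ ++ Γ₂)) → Prop
  | mk {Δ₁ Δ₂ : Ctx W} {f₁ : flatCtx ob Δ₁ → flatCtx ob Γ₁} {f₂ : flatCtx ob Δ₂ → flatCtx ob Γ₂} :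
      R₁ Δ₁ f₁ → R₂ Δ₂ f₂ → Joined R₁ R₂ (Δ₁ ++ Δ₂) (joinMap f₁ f₂)

variable {P s s'}

namespace EntrySub

variable {e : Entry W} {G : Ctx W} {f : flatCtx ob G → flatCtx ob [e]}

theorem ctxSub (h : EntrySub P s e G f) : CtxSub P s [e] G f :=
  of_castEnv (R := CtxSub P s [e]) (.cons h .nil) (List.append_nil G) fun x => by
    rw [← joinMap_castEnv_append_nil f, castEnv_castEnv]; rfl

theorem shift {k : ℕ}
    (hs : ∀ {G : Ctx W} {i : ℕ} {A : Ty W} {g : flatCtx ob G → flat ob A}, P G (s i) A g →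
      P (Ctx.shift k G) (s' (i + k)) A fun x => g (unshiftEnv k x))
    (h : EntrySub P s e G f) :
    EntrySub P s' (e.shift k) (Ctx.shift k G) (shiftMap (Γ := [e]) k f) := by
  cases h with
  | lab l a => exact .lab l a
  | var i h => exact .var (i + k) (hs h)

theorem sharp_eq (hP : P.Closed) (h : EntrySub P s e G f) : Ctx.sharp G = e.ty.sharp := by
  cases h with
  | lab l a => rfl
  | var i h =>
    obtain ⟨d, -⟩ := hP.weaken h .nil
    exact d.sharp_eq

theorem isParam (hP : P.Closed) (h : EntrySub P s e G f) (he : e.ty.IsParam) :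
    Ctx.IsParam G := by
  cases h with
  | lab l a => exact he.elim
  | var i h =>
    obtain ⟨d, -⟩ := hP.weaken h .nil
    exact d.isParam he

end EntrySub

namespace CtxSub

variable {Γ Δ : Ctx W} {f : flatCtx ob Δ → flatCtx ob Γ}

theorem entrySub {e : Entry W} {f : flatCtx ob Δ → flatCtx ob [e]} (h : CtxSub P s [e] Δ f) :
    EntrySub P s e Δ f := by
  cases h with
  | cons he h =>
    cases h with
    | nil => exact of_castEnv he (List.append_nil _).symm (joinMap_castEnv_append_nil _)

theorem append {Γ₂ Δ₂ : Ctx W} {f₂ : flatCtx ob Δ₂ → flatCtx ob Γ₂} (h : CtxSub P s Γ Δ f)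
    (h₂ : CtxSub P s Γ₂ Δ₂ f₂) : CtxSub P s (Γ ++ Γ₂) (Δ ++ Δ₂) (joinMap f f₂) := by
  induction h with
  | nil => exact h₂
  | @cons e G Γ Δ g f he _ ih =>
    exact of_castEnv (R := CtxSub P s (e :: Γ ++ Γ₂)) (.cons he ih) (List.append_assoc G Δ Δ₂).symm
      (joinMap_joinMap_castEnv g f f₂)

theorem joined {Γ₂ : Ctx W} : (Γ₁ : Ctx W) → {Δ : Ctx W} →
    {f : flatCtx ob Δ → flatCtx ob (Γ₁ ++ Γ₂)} → CtxSub P s (Γ₁ ++ Γ₂) Δ f →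
    Joined (CtxSub P s Γ₁) (CtxSub P s Γ₂) Δ f
  | [], _, _, h => Joined.mk (R₁ := CtxSub P s []) (R₂ := CtxSub P s Γ₂) .nil h
  | e :: Γ₁, _, _, .cons (G := G) (g := g) he h => by
      obtain ⟨h₁, h₂⟩ := CtxSub.joined Γ₁ h
      exact of_castEnv (R := Joined (CtxSub P s (e :: Γ₁)) (CtxSub P s Γ₂)) (.mk (.cons he h₁) h₂)
        (List.append_assoc _ _ _) fun x => by
          rw [← joinMap_joinMap_castEnv, castEnv_castEnv]; rfl

theorem shift {k : ℕ}
    (hs : ∀ {G : Ctx W} {i : ℕ} {A : Ty W} {g : flatCtx ob G → flat ob A}, P G (s i) A g →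
      P (Ctx.shift k G) (s' (i + k)) A fun x => g (unshiftEnv k x))
    (h : CtxSub P s Γ Δ f) : CtxSub P s' (Ctx.shift k Γ) (Ctx.shift k Δ) (shiftMap k f) := by
  induction h with
  | nil => exact .nil
  | @cons e G Γ Δ g f he _ ih =>
    exact of_castEnv (R := CtxSub P s' (Ctx.shift k (e :: Γ))) (.cons (he.shift hs) ih)
      (Ctx.shift_append k G Δ).symm (shiftMap_joinMap_castEnv (Γ₁ := [e]) k g f)

theorem sharp_eq (hP : P.Closed) (h : CtxSub P s Γ Δ f) : Ctx.sharp Δ = Ctx.sharp Γ := by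
  induction h with
  | nil => rfl
  | cons he _ ih => rw [Ctx.sharp_append, ih, he.sharp_eq hP]; rfl

theorem isParam (hP : P.Closed) (h : CtxSub P s Γ Δ f) (hΓ : Ctx.IsParam Γ) : Ctx.IsParam Δ := by
  induction h with
  | nil => exact hΓ
  | cons he _ ih =>
    exact (he.isParam hP (hΓ _ List.mem_cons_self)).append
      (ih fun e h => hΓ e (List.mem_cons_of_mem _ h))

theorem weaken (h : CtxSub P s Γ Δ f) : {Φ : Ctx W} → Ctx.IsParam Φ →
    WkCtxSub P s Γ (Φ ++ Δ) fun x => f (split x).2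
  | [], _ => .strict h
  | e :: Φ, hΦ => .weaken e (hΦ e List.mem_cons_self)
      (h.weaken (Φ := Φ) fun e he => hΦ e (List.mem_cons_of_mem _ he))

end CtxSub

namespace WkCtxSub

variable {Γ Δ : Ctx W} {f : flatCtx ob Δ → flatCtx ob Γ}

theorem append {Γ₂ Δ₂ : Ctx W} {f₂ : flatCtx ob Δ₂ → flatCtx ob Γ₂} (h : WkCtxSub P s Γ Δ f)
    (h₂ : CtxSub P s Γ₂ Δ₂ f₂) : WkCtxSub P s (Γ ++ Γ₂) (Δ ++ Δ₂) (joinMap f f₂) := by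
  induction h with
  | strict h => exact .strict (h.append h₂)
  | weaken e he _ ih => exact .weaken e he ih

theorem joined {Γ₁ Γ₂ : Ctx W} {f : flatCtx ob Δ → flatCtx ob (Γ₁ ++ Γ₂)}
    (h : WkCtxSub P s (Γ₁ ++ Γ₂) Δ f) : Joined (WkCtxSub P s Γ₁) (CtxSub P s Γ₂) Δ f := by
  induction h with
  | strict h =>
    obtain ⟨h₁, h₂⟩ := h.joined
    exact .mk (.strict h₁) h₂
  | weaken e he _ ih =>
    obtain ⟨h₁, h₂⟩ := ih
    exact .mk (WkCtxSub.weaken e he h₁) h₂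

theorem shift {k : ℕ}
    (hs : ∀ {G : Ctx W} {i : ℕ} {A : Ty W} {g : flatCtx ob G → flat ob A}, P G (s i) A g →
      P (Ctx.shift k G) (s' (i + k)) A fun x => g (unshiftEnv k x))
    (h : WkCtxSub P s Γ Δ f) : WkCtxSub P s' (Ctx.shift k Γ) (Ctx.shift k Δ) (shiftMap k f) := by
  induction h with
  | strict h => exact .strict (h.shift hs)
  | weaken e he _ ih =>
    have h := WkCtxSub.weaken (e.shift k) (Entry.isParam_shift he) ih
    cases e <;> exact h

theorem sharp_eq (hP : P.Closed) (h : WkCtxSub P s Γ Δ f) : Ctx.sharp Δ = Ctx.sharp Γ := by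
  induction h with
  | strict h => exact h.sharp_eq hP
  | weaken e he _ ih =>
    rw [← ih]; exact (congrArg (· ++ _) he.sharp_eq).trans (List.nil_append _)

theorem obj_eq (hP : P.Closed) (h : WkCtxSub P s Γ Δ f) :
    obj ob (Ctx.sharp Δ) = obj ob (Ctx.sharp Γ) := by
  rw [h.sharp_eq hP]

theorem isParam (hP : P.Closed) (h : WkCtxSub P s Γ Δ f) (hΓ : Ctx.IsParam Γ) :
    Ctx.IsParam Δ := by
  induction h with
  | strict h => exact h.isParam hP hΓ
  | weaken e he _ ih =>
    exact fun e' he' => (List.mem_cons.1 he').elim (fun h => h ▸ he) (ih e')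

theorem bind_one (hP : P.Closed) (A : Ty W) (h : WkCtxSub P s Γ Δ f) :
    WkCtxSub P (liftSub s) (Ctx.shift 1 Γ ++ [.var 0 A]) (Ctx.shift 1 Δ ++ [.var 0 A])
      (joinMap (shiftMap 1 f) fun x => x) :=
  (h.shift (s' := liftSub s) hP.shift_one).append
    (EntrySub.var (s := liftSub s) 0 (hP.var 0 A)).ctxSub

theorem bind_two (hP : P.Closed) (A B : Ty W) (h : WkCtxSub P s Γ Δ f) :
    WkCtxSub P (liftSub (liftSub s)) (Ctx.shift 2 Γ ++ [.var 1 A, .var 0 B])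
      (Ctx.shift 2 Δ ++ [.var 1 A, .var 0 B]) (joinMap (shiftMap 2 f) fun x => x) :=
  (h.shift (s' := liftSub (liftSub s)) hP.shift_two).append <|
    .cons (EntrySub.var (s := liftSub (liftSub s)) 1 (hP.var 1 A))
      (EntrySub.var (s := liftSub (liftSub s)) 0 (hP.var 0 B)).ctxSub

end WkCtxSub

end ContextSubstitution

section SubstitutionLemma

variable {W : Type w} {M : Type u} [StrictSymmPremonoidal.{v} M] {ob : W → M} {P : ValClass ob}

theorem obj_sharp_param {Φ : Ctx W} (hΦ : Ctx.IsParam Φ) : obj ob (Ctx.sharp Φ) = 1 := by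
  rw [hΦ.sharp_eq]; rfl

theorem sharp_param_append {Φ : Ctx W} (hΦ : Ctx.IsParam Φ) (Γ : Ctx W) :
    Ctx.sharp (Φ ++ Γ) = Ctx.sharp Γ := by
  rw [Ctx.sharp_append, hΦ.sharp_eq, List.nil_append]

theorem obj_sharp_var (i : ℕ) (A : Ty W) :
    obj ob (Ctx.sharp [.var i A]) = obj ob A.sharp := by
  simp [Ctx.sharp, Entry.ty]

theorem obj_sharp_of_app {Φ Γ₁ Γ₂ : Ctx W} (hΦ : Ctx.IsParam Φ) {V V' : Val ob} {A B : Ty W}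
    {T : List W} (d₁ : VTy (Φ ++ Γ₁) V (.arrow A B T)) (d₂ : VTy (Φ ++ Γ₂) V' A) :
    obj ob (Ctx.sharp (Φ ++ Γ₁ ++ Γ₂)) = obj ob T * obj ob A.sharp := by
  rw [obj_sharp_append, d₁.sharp_eq, ← sharp_param_append hΦ Γ₂, d₂.sharp_eq]
  rfl

theorem obj_sharp_of_apply {Φ Γ₁ Γ₂ : Ctx W} (hΦ : Ctx.IsParam Φ) {V V' : Val ob} {T U : BTy W}
    (d₁ : VTy (Φ ++ Γ₁) V (.circ T U)) (d₂ : VTy (Φ ++ Γ₂) V' T.toTy) :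
    obj ob (Ctx.sharp (Φ ++ Γ₁ ++ Γ₂)) = obj ob T.toTy.sharp := by
  rw [obj_sharp_append, d₁.sharp_eq, ← sharp_param_append hΦ Γ₂, d₂.sharp_eq]
  exact one_mul _

theorem obj_sharp_of_dest {Φ Γ₁ : Ctx W} (hΦ : Ctx.IsParam Φ) {V : Val ob} {A B : Ty W}
    (d : VTy (Φ ++ Γ₁) V (.tensor A B)) (Γ₂ : Ctx W) :
    obj ob (Ctx.sharp (Φ ++ Γ₂ ++ Γ₁)) =
      obj ob (Ctx.sharp (Ctx.shift 2 (Φ ++ Γ₂) ++ [.var 1 A, .var 0 B])) := by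
  rw [obj_sharp_append, ← sharp_param_append hΦ Γ₁, d.sharp_eq, obj_sharp_append (Ctx.shift 2 _),
    Ctx.sharp_shift, obj_sharp_cons, obj_sharp_var, Ty.sharp, obj_append]
  rfl

theorem obj_sharp_letin {Φ : Ctx W} (hΦ : Ctx.IsParam Φ) (Γ₁ Γ₂ : Ctx W) :
    obj ob (Ctx.sharp (Φ ++ Γ₂ ++ Γ₁)) =
      obj ob (Ctx.sharp Γ₂) * obj ob (Ctx.sharp (Φ ++ Γ₁)) := by
  rw [obj_sharp_append, sharp_param_append hΦ, sharp_param_append hΦ]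

theorem obj_sharp_letin' {Φ : Ctx W} (hΦ : Ctx.IsParam Φ) (Γ₂ : Ctx W) (A : Ty W) :
    obj ob (Ctx.sharp Γ₂) * obj ob A.sharp =
      obj ob (Ctx.sharp (Ctx.shift 1 (Φ ++ Γ₂) ++ [.var 0 A])) := by
  rw [obj_sharp_append, Ctx.sharp_shift, sharp_param_append hΦ, obj_sharp_var]

/-- The substitution lemma for a value derivation `d`: substitution preserves the type, and the
interpretation of the result is obtained by precomposition. -/
def VTy.RespectsSub (P : ValClass ob) {Γ : Ctx W} {V : Val ob} {A : Ty W} (d : VTy Γ V A) : Prop :=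
  ∀ ⦃s : ℕ → Val ob⦄ ⦃Δ : Ctx W⦄ ⦃f : flatCtx ob Δ → flatCtx ob Γ⦄, WkCtxSub P s Γ Δ f →
    ∃ d' : VTy Δ (V.sub s) A, ∀ x, d'.fn x = d.fn (f x)

/-- The substitution lemma for a computation derivation `d`. -/
def CTy.RespectsSub (P : ValClass ob) {Γ : Ctx W} {N : Tm ob} {A : Ty W} (d : CTy Γ N A) : Prop :=
  ∀ ⦃s : ℕ → Val ob⦄ ⦃Δ : Ctx W⦄ ⦃f : flatCtx ob Δ → flatCtx ob Γ⦄, WkCtxSub P s Γ Δ f →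
    ∀ e : obj ob (Ctx.sharp Δ) = obj ob (Ctx.sharp Γ),
      ∃ d' : CTy Δ (N.sub s) A, ∀ x, d'.run x = Circ.pre (eqToHom e) (d.run (f x))

namespace VTy

theorem respectsSub_unit (hP : P.Closed) {Φ : Ctx W} (hΦ : Ctx.IsParam Φ) :
    (VTy.unit hΦ : VTy Φ (.unit : Val ob) .unit).RespectsSub P := fun s Δ f h => by
  rw [Val.sub]
  exact ⟨.unit (h.isParam hP hΦ), fun _ => rfl⟩

theorem respectsSub_nat (hP : P.Closed) {Φ : Ctx W} (hΦ : Ctx.IsParam Φ) (n : ℕ) :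
    (VTy.nat hΦ n : VTy Φ (.nat n : Val ob) .nat).RespectsSub P := fun s Δ f h => by
  rw [Val.sub]
  exact ⟨.nat (h.isParam hP hΦ) n, fun _ => rfl⟩

theorem respectsSub_lab (hP : P.Closed) {Φ : Ctx W} (hΦ : Ctx.IsParam Φ) (l : ℕ) (a : W) :
    (VTy.lab hΦ l a : VTy _ (.lab l : Val ob) _).RespectsSub P := fun s Δ f h => by
  rw [Val.sub]
  obtain ⟨hφ, h'⟩ := h.joined
  cases h'.entrySub
  exact ⟨.lab (hφ.isParam hP hΦ) l a, fun _ => rfl⟩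

theorem respectsSub_var (hP : P.Closed) {Φ : Ctx W} (hΦ : Ctx.IsParam Φ) (i : ℕ) (A : Ty W) :
    (VTy.var hΦ i A : VTy _ (.var i : Val ob) _).RespectsSub P := fun s Δ f h => by
  rw [Val.sub]
  obtain ⟨hφ, h'⟩ := h.joined
  cases h'.entrySub with
  | var _ hg =>
    obtain ⟨d, hd⟩ := hP.weaken hg (hφ.isParam hP hΦ)
    refine ⟨d, fun x => ?_⟩
    rw [hd, fn_var, split_joinMap]
    rfl

theorem respectsSub_abs (hP : P.Closed) {Γ : Ctx W} {A B : Ty W} {N : Tm ob}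
    {d : CTy (Ctx.shift 1 Γ ++ [.var 0 A]) N B} (hd : d.RespectsSub P) :
    (VTy.abs d).RespectsSub P := fun s Δ f h => by
  have e (Θ : Ctx W) : obj ob (Ctx.sharp Θ) * obj ob A.sharp =
      obj ob (Ctx.sharp (Ctx.shift 1 Θ ++ [.var 0 A])) := by
    rw [obj_sharp_append, Ctx.sharp_shift, obj_sharp_var]
  have hΔ : Ctx.sharp Δ = Ctx.sharp Γ := h.sharp_eq hP
  obtain ⟨d₁, hd₁⟩ := hd (h.bind_one hP A) ((h.bind_one hP A).obj_eq hP)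
  obtain ⟨d', hd'⟩ := VTy.exists_abs hΔ.symm d₁ (by rw [← hΔ, e Δ])
  rw [Val.sub]
  refine ⟨d', fun x => arrow_ext fun a => ?_⟩
  rw [hd', arrowFn_fn_abs d (e Γ), hd₁, Circ.pre_pre, eqToHom_trans, joinMap_join,
    shiftMap_shiftEnv]

theorem respectsSub_lift (hP : P.Closed) {Φ : Ctx W} (hΦ : Ctx.IsParam Φ) {A : Ty W} {N : Tm ob}
    {d : CTy Φ N A} (hd : d.RespectsSub P) : (VTy.lift hΦ d).RespectsSub P := fun s Δ f h => by
  have hΔ := h.isParam hP hΦ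
  obtain ⟨d', hd'⟩ := hd h (h.obj_eq hP)
  rw [Val.sub]
  refine ⟨.lift hΔ d', fun x => bang_ext ?_⟩
  rw [bangFn_fn_lift _ _ (obj_sharp_param hΔ).symm,
    bangFn_fn_lift _ _ (obj_sharp_param hΦ).symm, hd', Circ.pre_pre, eqToHom_trans]

theorem respectsSub_pair (hP : P.Closed) {Φ Γ₁ Γ₂ : Ctx W} (hΦ : Ctx.IsParam Φ) {V V' : Val ob}
    {A B : Ty W} {d₁ : VTy (Φ ++ Γ₁) V A} {d₂ : VTy (Φ ++ Γ₂) V' B} (hd₁ : d₁.RespectsSub P)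
    (hd₂ : d₂.RespectsSub P) : (VTy.pair hΦ d₁ d₂).RespectsSub P := fun s Δ f h => by
  obtain ⟨h', h₂⟩ := h.joined
  obtain ⟨hφ, h₁⟩ := h'.joined
  obtain ⟨d₁', hd₁'⟩ := hd₁ (hφ.append h₁)
  obtain ⟨d₂', hd₂'⟩ := hd₂ (hφ.append h₂)
  rw [Val.sub]
  refine ⟨.pair (hφ.isParam hP hΦ) d₁' d₂', fun x => ?_⟩
  refine (pairFn_fn_pair _ d₁' d₂' x).trans (Eq.trans ?_ (pairFn_fn_pair hΦ d₁ d₂ _).symm)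
  rw [hd₁', hd₂', split_joinMap, dropMid_joinMap]

end VTy

namespace CTy

theorem respectsSub_app (hP : P.Closed) {Φ Γ₁ Γ₂ : Ctx W} (hΦ : Ctx.IsParam Φ) {V V' : Val ob}
    {A B : Ty W} {T : List W} {d₁ : VTy (Φ ++ Γ₁) V (.arrow A B T)} {d₂ : VTy (Φ ++ Γ₂) V' A}
    (hd₁ : d₁.RespectsSub P) (hd₂ : d₂.RespectsSub P) :
    (CTy.app hΦ d₁ d₂).RespectsSub P := fun s Δ f h hΔ => by
  have e := obj_sharp_of_app hΦ d₁ d₂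
  obtain ⟨h', h₂⟩ := h.joined
  obtain ⟨hφ, h₁⟩ := h'.joined
  obtain ⟨d₁', hd₁'⟩ := hd₁ (hφ.append h₁)
  obtain ⟨d₂', hd₂'⟩ := hd₂ (hφ.append h₂)
  rw [Tm.sub]
  refine ⟨.app (hφ.isParam hP hΦ) d₁' d₂', fun x => ?_⟩
  rw [run_app _ d₁' d₂' (hΔ.trans e), run_app hΦ d₁ d₂ e, hd₁', hd₂', split_joinMap,
    dropMid_joinMap, Circ.pre_pre, eqToHom_trans]

theorem respectsSub_force (hP : P.Closed) {Φ : Ctx W} (hΦ : Ctx.IsParam Φ) {V : Val ob} {A : Ty W}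
    {d : VTy Φ V (.bang A)} (hd : d.RespectsSub P) :
    (CTy.force hΦ d).RespectsSub P := fun s Δ f h hΔ => by
  have e : obj ob (Ctx.sharp Φ) = 1 := obj_sharp_param hΦ
  obtain ⟨d', hd'⟩ := hd h
  rw [Tm.sub]
  refine ⟨.force (h.isParam hP hΦ) d', fun x => ?_⟩
  rw [run_force _ _ (hΔ.trans e), run_force _ _ e, hd', Circ.pre_pre, eqToHom_trans]

theorem respectsSub_box (hP : P.Closed) {Φ : Ctx W} (hΦ : Ctx.IsParam Φ) {V : Val ob} {T U : BTy W}
    {d : VTy Φ V (.arrow T.toTy U.toTy [])} (hd : d.RespectsSub P) :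
    (CTy.box hΦ d).RespectsSub P := fun s Δ f h hΔ => by
  have e : obj ob (Ctx.sharp Φ) = obj ob (Ty.circ T U).sharp := congrArg (obj ob) hΦ.sharp_eq
  obtain ⟨d', hd'⟩ := hd h
  rw [Tm.sub]
  refine ⟨.box (h.isParam hP hΦ) d', fun x => ?_⟩
  rw [run_box _ _ (hΔ.trans e), run_box _ _ e, hd', Circ.pre, eqToHom_trans]

theorem respectsSub_apply (hP : P.Closed) {Φ Γ₁ Γ₂ : Ctx W} (hΦ : Ctx.IsParam Φ) {V V' : Val ob}
    {T U : BTy W} {d₁ : VTy (Φ ++ Γ₁) V (.circ T U)} {d₂ : VTy (Φ ++ Γ₂) V' T.toTy}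
    (hd₁ : d₁.RespectsSub P) (hd₂ : d₂.RespectsSub P) :
    (CTy.apply hΦ d₁ d₂).RespectsSub P := fun s Δ f h hΔ => by
  have e := obj_sharp_of_apply hΦ d₁ d₂
  obtain ⟨h', h₂⟩ := h.joined
  obtain ⟨hφ, h₁⟩ := h'.joined
  obtain ⟨d₁', hd₁'⟩ := hd₁ (hφ.append h₁)
  obtain ⟨d₂', -⟩ := hd₂ (hφ.append h₂)
  rw [Tm.sub]
  refine ⟨.apply (hφ.isParam hP hΦ) d₁' d₂', fun x => ?_⟩
  rw [run_apply _ d₁' d₂' (hΔ.trans e), run_apply hΦ d₁ d₂ e, hd₁', split_joinMap, Circ.pre,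
    eqToHom_trans_assoc]

theorem respectsSub_dest (hP : P.Closed) {Φ Γ₁ Γ₂ : Ctx W} (hΦ : Ctx.IsParam Φ) {V : Val ob}
    {N : Tm ob} {A B C : Ty W} {d₁ : VTy (Φ ++ Γ₁) V (.tensor A B)}
    {d₂ : CTy (Ctx.shift 2 (Φ ++ Γ₂) ++ [.var 1 A, .var 0 B]) N C} (hd₁ : d₁.RespectsSub P)
    (hd₂ : d₂.RespectsSub P) : (CTy.dest hΦ d₁ d₂).RespectsSub P := fun s Δ f h hΔ => by
  obtain ⟨h', h₁⟩ := h.joined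
  obtain ⟨hφ, h₂⟩ := h'.joined
  have hΨ := hφ.isParam hP hΦ
  have hN := (hφ.append h₂).bind_two hP A B
  obtain ⟨d₁', hd₁'⟩ := hd₁ (hφ.append h₁)
  obtain ⟨d₂', hd₂'⟩ := hd₂ hN (hN.obj_eq hP)
  rw [Tm.sub]
  refine ⟨.dest hΨ d₁' d₂', fun x => ?_⟩
  rw [run_dest hΨ d₁' d₂' (obj_sharp_of_dest hΨ d₁' _),
    run_dest hΦ d₁ d₂ (obj_sharp_of_dest hΦ d₁ _), hd₁', hd₂', split_joinMap, dropMid_joinMap,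
    joinMap_join, shiftMap_shiftEnv, Circ.pre_pre, Circ.pre_pre, eqToHom_trans, eqToHom_trans]

theorem respectsSub_ifz (hP : P.Closed) {Φ Γ : Ctx W} (hΦ : Ctx.IsParam Φ) {V : Val ob}
    {N N' : Tm ob} {A : Ty W} {d : VTy Φ V .nat} {d₁ : CTy (Φ ++ Γ) N A} {d₂ : CTy (Φ ++ Γ) N' A}
    (hd : d.RespectsSub P) (hd₁ : d₁.RespectsSub P) (hd₂ : d₂.RespectsSub P) :
    (CTy.ifz hΦ d d₁ d₂).RespectsSub P := fun s Δ f h hΔ => by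
  obtain ⟨d₁', hd₁'⟩ := hd₁ h hΔ
  obtain ⟨d₂', hd₂'⟩ := hd₂ h hΔ
  obtain ⟨hφ, -⟩ := h.joined
  obtain ⟨d', hd'⟩ := hd hφ
  rw [Tm.sub]
  refine ⟨.ifz (hφ.isParam hP hΦ) d' d₁' d₂', fun x => ?_⟩
  simp only [run_ifz, hd', split_joinMap]
  split
  · exact hd₁' x
  · exact hd₂' x

theorem respectsSub_ret {Γ : Ctx W} {V : Val ob} {A : Ty W} {d : VTy Γ V A}
    (hd : d.RespectsSub P) : (CTy.ret d).RespectsSub P := fun s Δ f h hΔ => by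
  have e : obj ob (Ctx.sharp Γ) = obj ob A.sharp := congrArg (obj ob) d.sharp_eq
  obtain ⟨d', hd'⟩ := hd h
  rw [Tm.sub]
  refine ⟨.ret d', fun x => ?_⟩
  rw [run_ret _ (hΔ.trans e), run_ret _ e, hd', Circ.pre, eqToHom_trans]

theorem respectsSub_letin (hP : P.Closed) {Φ Γ₁ Γ₂ : Ctx W} (hΦ : Ctx.IsParam Φ) {N N' : Tm ob}
    {A B : Ty W} {d₁ : CTy (Φ ++ Γ₁) N A} {d₂ : CTy (Ctx.shift 1 (Φ ++ Γ₂) ++ [.var 0 A]) N' B}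
    (hd₁ : d₁.RespectsSub P) (hd₂ : d₂.RespectsSub P) :
    (CTy.letin hΦ d₁ d₂).RespectsSub P := fun s Δ f h hΔ => by
  obtain ⟨h', h₁⟩ := h.joined
  obtain ⟨hφ, h₂⟩ := h'.joined
  have hΨ := hφ.isParam hP hΦ
  have hN := hφ.append h₁
  have hN' := (hφ.append h₂).bind_one hP A
  obtain ⟨d₁', hd₁'⟩ := hd₁ hN (hN.obj_eq hP)
  obtain ⟨d₂', hd₂'⟩ := hd₂ hN' (hN'.obj_eq hP)
  rw [Tm.sub]
  refine ⟨.letin hΨ d₁' d₂', fun x => ?_⟩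
  rw [run_letin hΨ d₁' d₂' (obj_sharp_letin hΨ _ _) (obj_sharp_letin' hΨ _ _),
    run_letin hΦ d₁ d₂ (obj_sharp_letin hΦ _ _) (obj_sharp_letin' hΦ _ _)]
  simp only [hd₁', hd₂', split_joinMap, dropMid_joinMap, joinMap_join, shiftMap_shiftEnv, Circ.pre,
    lwhisk_comp, lwhisk_eqToHom, lwhisk_congr (congrArg (obj ob) (h₂.sharp_eq hP)),
    Category.assoc, eqToHom_trans_assoc]

theorem respectsSub_ex (hP : P.Closed) {Γ₁ Γ₂ : Ctx W} {a b : Entry W} {N : Tm ob} {A : Ty W}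
    {d : CTy (Γ₁ ++ a :: b :: Γ₂) N A} (hd : d.RespectsSub P) :
    (CTy.ex d).RespectsSub P := fun s Δ f h hΔ => by
  obtain ⟨h₁, h'⟩ := h.joined
  cases h' with
  | cons hb h' =>
    cases h' with
    | cons ha h₂ =>
      have H := h₁.append (.cons ha (.cons hb h₂))
      obtain ⟨d', hd'⟩ := hd H (H.obj_eq hP)
      obtain ⟨d'', hd''⟩ := Exch.swap_block _ _ _ d'
      refine ⟨d'', fun x => ?_⟩
      obtain ⟨x, y, rfl⟩ := exists_join x
      rw [hd'', hd', run_ex]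
      simp only [joinMap_join, split_join, Circ.pre_pre, lwhisk_comp, lwhisk_eqToHom,
        lwhisk_congr (congrArg (obj ob) (h₁.sharp_eq hP)),
        sw_congr (congrArg (obj ob) (hb.sharp_eq hP)) (congrArg (obj ob) (ha.sharp_eq hP))
          (congrArg (obj ob) (h₂.sharp_eq hP)),
        Category.assoc, eqToHom_trans, eqToHom_trans_assoc]
      rfl

end CTy

mutual

theorem VTy.respectsSub (hP : P.Closed) : {Γ : Ctx W} → {V : Val ob} → {A : Ty W} →
    (d : VTy Γ V A) → d.RespectsSub P
  | _, _, _, .unit hΦ => VTy.respectsSub_unit hP hΦ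
  | _, _, _, .nat hΦ n => VTy.respectsSub_nat hP hΦ n
  | _, _, _, .lab hΦ l a => VTy.respectsSub_lab hP hΦ l a
  | _, _, _, .var hΦ i A => VTy.respectsSub_var hP hΦ i A
  | _, _, _, .abs d => VTy.respectsSub_abs hP (d.respectsSub hP)
  | _, _, _, .lift hΦ d => VTy.respectsSub_lift hP hΦ (d.respectsSub hP)
  | _, _, _, .circ hΦ h₁ h₂ hb hc p hp q hq => fun s Δ f h => by
      rw [Val.sub]
      exact ⟨.circ (h.isParam hP hΦ) h₁ h₂ hb hc p hp q hq, fun _ => by rw [VTy.fn, VTy.fn]⟩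
  | _, _, _, .pair hΦ d₁ d₂ =>
      VTy.respectsSub_pair hP hΦ (d₁.respectsSub hP) (d₂.respectsSub hP)

theorem CTy.respectsSub (hP : P.Closed) : {Γ : Ctx W} → {N : Tm ob} → {A : Ty W} →
    (d : CTy Γ N A) → d.RespectsSub P
  | _, _, _, .app hΦ d₁ d₂ => CTy.respectsSub_app hP hΦ (d₁.respectsSub hP) (d₂.respectsSub hP)
  | _, _, _, .force hΦ d => CTy.respectsSub_force hP hΦ (d.respectsSub hP)
  | _, _, _, .box hΦ d => CTy.respectsSub_box hP hΦ (d.respectsSub hP)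
  | _, _, _, .apply hΦ d₁ d₂ =>
      CTy.respectsSub_apply hP hΦ (d₁.respectsSub hP) (d₂.respectsSub hP)
  | _, _, _, .dest hΦ d₁ d₂ => CTy.respectsSub_dest hP hΦ (d₁.respectsSub hP) (d₂.respectsSub hP)
  | _, _, _, .ifz hΦ d d₁ d₂ =>
      CTy.respectsSub_ifz hP hΦ (d.respectsSub hP) (d₁.respectsSub hP) (d₂.respectsSub hP)
  | _, _, _, .ret d => CTy.respectsSub_ret (d.respectsSub hP)
  | _, _, _, .letin hΦ d₁ d₂ =>
      CTy.respectsSub_letin hP hΦ (d₁.respectsSub hP) (d₂.respectsSub hP)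
  | _, _, _, .ex d => CTy.respectsSub_ex hP (d.respectsSub hP)

end

end SubstitutionLemma

section Renaming

variable {W : Type w} {M : Type u} [StrictSymmPremonoidal.{v} M] {ob : W → M}

theorem liftSub_var (r : ℕ → ℕ) :
    liftSub (fun i => (.var (r i) : Val ob)) = fun i => .var (liftRen r i) := by
  funext i
  cases i with
  | zero => rfl
  | succ i => simp only [liftSub, liftRen, Val.ren]

theorem liftRen_comp (r r' : ℕ → ℕ) :
    (fun i => liftRen r' (liftRen r i)) = liftRen fun i => r' (r i) := by
  funext i; cases i <;> rfl

theorem liftRen_id : liftRen (fun i => i) = fun i => i := by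
  funext i; cases i <;> rfl

mutual

theorem Val.sub_var : (V : Val ob) → (r : ℕ → ℕ) → V.sub (fun i => .var (r i)) = V.ren r
  | .var _, _ => by rw [Val.sub, Val.ren]
  | .lab _, _ => by rw [Val.sub, Val.ren]
  | .unit, _ => by rw [Val.sub, Val.ren]
  | .nat _, _ => by rw [Val.sub, Val.ren]
  | .lam _ N, r => by rw [Val.sub, Val.ren, liftSub_var, N.sub_var]
  | .lift N, r => by rw [Val.sub, Val.ren, N.sub_var]
  | .boxed _ _ _, _ => by rw [Val.sub, Val.ren]
  | .pair V V', r => by rw [Val.sub, Val.ren, V.sub_var, V'.sub_var]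

theorem Tm.sub_var : (N : Tm ob) → (r : ℕ → ℕ) → N.sub (fun i => .var (r i)) = N.ren r
  | .app V V', r => by rw [Tm.sub, Tm.ren, V.sub_var, V'.sub_var]
  | .force V, r => by rw [Tm.sub, Tm.ren, V.sub_var]
  | .box T V, r => by rw [Tm.sub, Tm.ren, V.sub_var]
  | .apply V V', r => by rw [Tm.sub, Tm.ren, V.sub_var, V'.sub_var]
  | .dest V N, r => by rw [Tm.sub, Tm.ren, V.sub_var, liftSub_var, liftSub_var, N.sub_var]
  | .ifz V N N', r => by rw [Tm.sub, Tm.ren, V.sub_var, N.sub_var, N'.sub_var]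
  | .ret V, r => by rw [Tm.sub, Tm.ren, V.sub_var]
  | .letin N N', r => by rw [Tm.sub, Tm.ren, N.sub_var, liftSub_var, N'.sub_var]

end

mutual

theorem Val.ren_ren : (V : Val ob) → (r r' : ℕ → ℕ) →
    (V.ren r).ren r' = V.ren fun i => r' (r i)
  | .var _, _, _ => by simp only [Val.ren]
  | .lab _, _, _ => by simp only [Val.ren]
  | .unit, _, _ => by simp only [Val.ren]
  | .nat _, _, _ => by simp only [Val.ren]
  | .lam _ N, r, r' => by simp only [Val.ren, N.ren_ren, liftRen_comp]
  | .lift N, r, r' => by simp only [Val.ren, N.ren_ren]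
  | .boxed _ _ _, _, _ => by simp only [Val.ren]
  | .pair V V', r, r' => by simp only [Val.ren, V.ren_ren, V'.ren_ren]

theorem Tm.ren_ren : (N : Tm ob) → (r r' : ℕ → ℕ) → (N.ren r).ren r' = N.ren fun i => r' (r i)
  | .app V V', r, r' => by simp only [Tm.ren, V.ren_ren, V'.ren_ren]
  | .force V, r, r' => by simp only [Tm.ren, V.ren_ren]
  | .box T V, r, r' => by simp only [Tm.ren, V.ren_ren]
  | .apply V V', r, r' => by simp only [Tm.ren, V.ren_ren, V'.ren_ren]
  | .dest V N, r, r' => by simp only [Tm.ren, V.ren_ren, N.ren_ren, liftRen_comp]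
  | .ifz V N N', r, r' => by simp only [Tm.ren, V.ren_ren, N.ren_ren, N'.ren_ren]
  | .ret V, r, r' => by simp only [Tm.ren, V.ren_ren]
  | .letin N N', r, r' => by simp only [Tm.ren, N.ren_ren, N'.ren_ren, liftRen_comp]

end

mutual

theorem Val.ren_id : (V : Val ob) → V.ren (fun i => i) = V
  | .var _ => by rw [Val.ren]
  | .lab _ => by rw [Val.ren]
  | .unit => by rw [Val.ren]
  | .nat _ => by rw [Val.ren]
  | .lam _ N => by rw [Val.ren, liftRen_id, N.ren_id]
  | .lift N => by rw [Val.ren, N.ren_id]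
  | .boxed _ _ _ => by rw [Val.ren]
  | .pair V V' => by rw [Val.ren, V.ren_id, V'.ren_id]

theorem Tm.ren_id : (N : Tm ob) → N.ren (fun i => i) = N
  | .app V V' => by rw [Tm.ren, V.ren_id, V'.ren_id]
  | .force V => by rw [Tm.ren, V.ren_id]
  | .box T V => by rw [Tm.ren, V.ren_id]
  | .apply V V' => by rw [Tm.ren, V.ren_id, V'.ren_id]
  | .dest V N => by rw [Tm.ren, V.ren_id, liftRen_id, liftRen_id, N.ren_id]
  | .ifz V N N' => by rw [Tm.ren, V.ren_id, N.ren_id, N'.ren_id]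
  | .ret V => by rw [Tm.ren, V.ren_id]
  | .letin N N' => by rw [Tm.ren, N.ren_id, liftRen_id, N'.ren_id]

end
/-- The class of variables, with which substitutions are renamings. -/
inductive VarClass : ValClass ob
  | mk (i : ℕ) (A : Ty W) : VarClass [.var i A] (.var i) A fun x => x.1

theorem VarClass.closed : ValClass.Closed (VarClass (ob := ob)) where
  weaken := by
    rintro _ _ _ _ ⟨i, _⟩ Φ hΦ
    exact ⟨.var hΦ i _, fun _ => rfl⟩
  shift_one := by
    rintro _ _ _ _ ⟨i, _⟩
    rw [Val.ren]
    exact .mk (i + 1) _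
  shift_two := by
    rintro _ _ _ _ ⟨i, _⟩
    rw [Val.ren, Val.ren]
    exact .mk (i + 2) _
  var i A := .mk i A

theorem CtxSub.ren (k : ℕ) : (Γ : Ctx W) →
    CtxSub (VarClass (ob := ob)) (fun i => .var (i + k)) Γ (Ctx.shift k Γ) (unshiftEnv k)
  | [] => .nil
  | .lab l a :: Γ => .cons (.lab l a) (CtxSub.ren k Γ)
  | .var i A :: Γ => .cons (.var i (.mk (i + k) A)) (CtxSub.ren k Γ)

theorem CtxSub.id : (Γ : Ctx W) → CtxSub (VarClass (ob := ob)) (fun i => .var i) Γ Γ fun x => x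
  | [] => .nil
  | .lab l a :: Γ => .cons (.lab l a) (CtxSub.id Γ)
  | .var i A :: Γ => .cons (.var i (.mk i A)) (CtxSub.id Γ)

theorem VTy.weaken {Γ : Ctx W} {V : Val ob} {A : Ty W} (d : VTy Γ V A) {Φ : Ctx W}
    (hΦ : Ctx.IsParam Φ) : ∃ d' : VTy (Φ ++ Γ) V A, ∀ x, d'.fn x = d.fn (split x).2 := by
  have h := d.respectsSub VarClass.closed ((CtxSub.id Γ).weaken hΦ)
  rwa [Val.sub_var V fun i => i, Val.ren_id] at h

theorem VTy.shift {Γ : Ctx W} {V : Val ob} {A : Ty W} (d : VTy Γ V A) (k : ℕ) :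
    ∃ d' : VTy (Ctx.shift k Γ) (V.ren fun i => i + k) A, ∀ x, d'.fn x = d.fn (unshiftEnv k x) := by
  have h := d.respectsSub VarClass.closed (.strict (CtxSub.ren k Γ))
  rwa [Val.sub_var V fun i => i + k] at h

/-- The class of all typed values. -/
def TypedClass : ValClass ob := fun G V A g => ∃ d : VTy G V A, ∀ x, d.fn x = g x

theorem TypedClass.closed : ValClass.Closed (TypedClass (ob := ob)) where
  weaken := by
    rintro _ _ _ _ ⟨d, hd⟩ Φ hΦ
    obtain ⟨d', hd'⟩ := d.weaken hΦ
    exact ⟨d', fun x => (hd' x).trans (hd _)⟩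
  shift_one := by
    rintro _ _ _ _ ⟨d, hd⟩
    obtain ⟨d', hd'⟩ := d.shift 1
    exact ⟨d', fun x => (hd' x).trans (hd _)⟩
  shift_two := by
    rintro _ _ _ _ ⟨d, hd⟩
    obtain ⟨d', hd'⟩ := d.shift 2
    rw [Val.ren_ren]
    exact ⟨d', fun x => (hd' x).trans (hd _)⟩
  var i A := ⟨.var Ctx.IsParam.nil i A, fun _ => rfl⟩

end Renaming

section LabelContexts

variable {W : Type w} {M : Type u} [StrictSymmPremonoidal.{v} M] {ob : W → M}

theorem LabCtx.toCtx_append (Q R : LabCtx W) : (Q ++ R).toCtx = Q.toCtx ++ R.toCtx :=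
  List.map_append

theorem eq_labEnv : (Q : LabCtx W) → (x : flatCtx ob Q.toCtx) → x = labEnv Q
  | [], _ => rfl
  | _ :: Q, x => congrArg (Prod.mk PUnit.unit) (eq_labEnv Q x.2)

theorem CtxSub.labels (P : ValClass ob) (s : ℕ → Val ob) (k : ℕ) : (Q : LabCtx W) →
    CtxSub P s (Ctx.shift k Q.toCtx) Q.toCtx (shiftEnv k)
  | [] => .nil
  | (l, a) :: Q => .cons (.lab l a) (CtxSub.labels P s k Q)

theorem CTy.subst_one {L K : LabCtx W} {N : Tm ob} {V : Val ob} {A B : Ty W}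
    (d : CTy (Ctx.shift 1 L.toCtx ++ [.var 0 A]) N B) (dV : VTy K.toCtx V A) :
    ∃ (d' : CTy (L ++ K).toCtx (N.sub (single V)) B)
      (e : obj ob (Ctx.sharp (L ++ K).toCtx) =
        obj ob (Ctx.sharp (Ctx.shift 1 L.toCtx ++ [.var 0 A]))),
      d'.run (labEnv (L ++ K)) = Circ.pre (eqToHom e)
        (d.run (join (shiftEnv 1 (labEnv L)) (varEnv 0 A (dV.fn (labEnv K))))) := by
  have hV : EntrySub TypedClass (single V) (.var 0 A) K.toCtx fun x => varEnv 0 A (dV.fn x) :=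
    .var 0 ⟨dV, fun _ => rfl⟩
  have h := (CtxSub.labels TypedClass (single V) 1 L).append hV.ctxSub
  obtain ⟨d', hd'⟩ := d.respectsSub TypedClass.closed (.strict h)
    (congrArg (obj ob) (h.sharp_eq TypedClass.closed))
  obtain ⟨d'', hd''⟩ := d'.exists_cast (LabCtx.toCtx_append L K).symm
  have key := hd'' (join (labEnv L) (labEnv K))
  rw [eq_labEnv (L ++ K) (castEnv _ _), hd', joinMap_join, Circ.pre_pre, eqToHom_trans] at key
  exact ⟨d'', _, key⟩

theorem CTy.subst_two {L K K' : LabCtx W} {N : Tm ob} {V V' : Val ob} {A B C : Ty W}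
    (d : CTy (Ctx.shift 2 L.toCtx ++ [.var 1 A, .var 0 B]) N C) (dV : VTy K.toCtx V A)
    (dV' : VTy K'.toCtx V' B) :
    ∃ (d' : CTy (L ++ (K ++ K')).toCtx (N.sub (double V V')) C)
      (e : obj ob (Ctx.sharp (L ++ (K ++ K')).toCtx) =
        obj ob (Ctx.sharp (Ctx.shift 2 L.toCtx ++ [.var 1 A, .var 0 B]))),
      d'.run (labEnv (L ++ (K ++ K'))) = Circ.pre (eqToHom e)
        (d.run (join (shiftEnv 2 (labEnv L))
          (varEnv₂ 1 A 0 B (dV.fn (labEnv K)) (dV'.fn (labEnv K'))))) := by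
  have hV : EntrySub TypedClass (double V V') (.var 1 A) K.toCtx
      fun x => varEnv 1 A (dV.fn x) := .var 1 ⟨dV, fun _ => rfl⟩
  have hV' : EntrySub TypedClass (double V V') (.var 0 B) K'.toCtx
      fun x => varEnv 0 B (dV'.fn x) := .var 0 ⟨dV', fun _ => rfl⟩
  have h := (CtxSub.labels TypedClass (double V V') 2 L).append (.cons hV hV'.ctxSub)
  obtain ⟨d', hd'⟩ := d.respectsSub TypedClass.closed (.strict h)
    (congrArg (obj ob) (h.sharp_eq TypedClass.closed))
  have hK : L.toCtx ++ (K.toCtx ++ K'.toCtx) = (L ++ (K ++ K')).toCtx := by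
    rw [LabCtx.toCtx_append, LabCtx.toCtx_append]
  obtain ⟨d'', hd''⟩ := d'.exists_cast hK
  have key := hd'' (join (labEnv L) (join (labEnv K) (labEnv K')))
  rw [eq_labEnv (L ++ (K ++ K')) (castEnv _ _), hd', joinMap_join, joinMap_join, Circ.pre_pre,
    eqToHom_trans] at key
  exact ⟨d'', _, key⟩

end LabelContexts

/-! ### Computations in label contexts -/

section Bundles

variable {W : Type w} {M : Type u} [StrictSymmPremonoidal.{v} M] {ob : W → M}

theorem labObj_eq_obj_sharp (L : LabCtx W) : labObj ob L = obj ob (Ctx.sharp L.toCtx) :=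
  congrArg (obj ob) L.sharp_toCtx.symm

theorem labObj_eq_of_toCtx_eq {L : LabCtx W} {Γ : Ctx W} (h : L.toCtx = Γ) :
    labObj ob L = obj ob (Ctx.sharp Γ) :=
  h ▸ labObj_eq_obj_sharp L

theorem VTy.labObj_eq {L : LabCtx W} {V : Val ob} {A : Ty W} (d : VTy L.toCtx V A) :
    labObj ob L = obj ob A.sharp :=
  (labObj_eq_obj_sharp L).trans (congrArg (obj ob) d.sharp_eq)

theorem eq_of_labels {L : LabCtx W} {Γ : Ctx W} (h : L.toCtx = Γ) (x y : flatCtx ob Γ) : x = y := by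
  subst h; rw [eq_labEnv L x, eq_labEnv L y]

theorem LabCtx.eq_nil_of_isParam {L : LabCtx W} (h : Ctx.IsParam L.toCtx) : L = [] := by
  cases L with
  | nil => rfl
  | cons a L => exact (h (.lab a.1 a.2) (by simp [LabCtx.toCtx])).elim

theorem LabCtx.eq_nil_of_sharp {L : LabCtx W} {Γ : Ctx W} (h : L.toCtx = Γ)
    (hΓ : Ctx.sharp Γ = []) : L = [] ∧ Γ = [] := by
  subst h
  rw [LabCtx.sharp_toCtx] at hΓ
  obtain rfl := List.map_eq_nil_iff.1 hΓ
  exact ⟨rfl, rfl⟩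

theorem LabCtx.exists_of_append {L : LabCtx W} {Γ Δ : Ctx W} (h : L.toCtx = Γ ++ Δ) :
    ∃ L₁ L₂ : LabCtx W, L = L₁ ++ L₂ ∧ L₁.toCtx = Γ ∧ L₂.toCtx = Δ :=
  List.map_eq_append_iff.1 h

theorem LabCtx.toCtx_eq_of_param_append {L : LabCtx W} {Φ Γ : Ctx W} (hΦ : Ctx.IsParam Φ)
    (h : L.toCtx = Φ ++ Γ) : Φ = [] ∧ L.toCtx = Γ := by
  obtain ⟨K, L, rfl, rfl, rfl⟩ := LabCtx.exists_of_append h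
  obtain rfl := LabCtx.eq_nil_of_isParam hΦ
  exact ⟨rfl, rfl⟩

theorem LabCtx.exists_of_append_append {L : LabCtx W} {Φ Γ Δ : Ctx W} (hΦ : Ctx.IsParam Φ)
    (h : L.toCtx = Φ ++ Γ ++ Δ) :
    ∃ L₁ L₂ : LabCtx W, Φ = [] ∧ L = L₁ ++ L₂ ∧ L₁.toCtx = Γ ∧ L₂.toCtx = Δ := by
  obtain ⟨L₁, L₂, rfl, h₁, rfl⟩ := LabCtx.exists_of_append h
  obtain ⟨rfl, rfl⟩ := LabCtx.toCtx_eq_of_param_append hΦ h₁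
  exact ⟨L₁, L₂, rfl, rfl, rfl, rfl⟩

theorem LabCtx.exists_of_append_cons_cons {L : LabCtx W} {Γ Δ : Ctx W} {a b : Entry W}
    (h : L.toCtx = Γ ++ a :: b :: Δ) :
    ∃ (L₁ L₂ : LabCtx W) (p q : ℕ × W), L = L₁ ++ p :: q :: L₂ ∧ L₁.toCtx = Γ ∧ L₂.toCtx = Δ ∧
      a = .lab p.1 p.2 ∧ b = .lab q.1 q.2 := by
  obtain ⟨L₁, L₂, rfl, rfl, h₂⟩ := LabCtx.exists_of_append h
  obtain ⟨p, L₃, rfl, rfl, h₃⟩ := List.map_eq_cons_iff.1 h₂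
  obtain ⟨q, L₄, rfl, rfl, rfl⟩ := List.map_eq_cons_iff.1 h₃
  exact ⟨L₁, L₄, p, q, rfl, rfl, rfl, rfl, rfl⟩

theorem BTy.eq_pt : (T : BTy W) → (x : flat ob T.toTy) → x = BTy.pt ob T
  | .unit, _ => rfl
  | .wire _, _ => rfl
  | .tensor T U, x => Prod.ext (BTy.eq_pt T x.1) (BTy.eq_pt U x.2)

theorem VTy.exists_of_pair {L : LabCtx W} {V V' : Val ob} {A B : Ty W}
    (d : VTy L.toCtx (.pair V V') (.tensor A B)) :
    ∃ (K K' : LabCtx W) (d₁ : VTy K.toCtx V A) (d₂ : VTy K'.toCtx V' B), L = K ++ K' ∧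
      ∀ x, pairFn (d.fn x) = (d₁.fn (labEnv K), d₂.fn (labEnv K')) := by
  generalize h : L.toCtx = Γ at d
  cases d with
  | pair hΦ d₁ d₂ =>
    obtain ⟨K, K', rfl, rfl, rfl, rfl⟩ := LabCtx.exists_of_append_append hΦ h
    exact ⟨K, K', d₁, d₂, rfl, fun x => (pairFn_fn_pair hΦ d₁ d₂ x).trans
      (Prod.ext (congrArg d₁.fn (eq_labEnv K _)) (congrArg d₂.fn (eq_labEnv K' _)))⟩

theorem VTy.bdlTy : {b : Bdl} → {T : BTy W} → {L : LabCtx W} →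
    VTy (ob := ob) L.toCtx b.toVal T.toTy → BdlTy L b T
  | .unit, T, L, d => by
      rw [Bdl.toVal] at d
      generalize h : L.toCtx = Γ at d
      generalize hT : T.toTy = A at d
      cases d with
      | unit hΦ =>
        subst h
        obtain rfl := LabCtx.eq_nil_of_isParam hΦ
        cases T <;> first | exact .unit | cases hT
  | .lab l, T, L, d => by
      rw [Bdl.toVal] at d
      generalize h : L.toCtx = Γ at d
      generalize hT : T.toTy = A at d
      cases d with
      | lab hΦ l a =>
        obtain ⟨rfl, h⟩ := LabCtx.toCtx_eq_of_param_append hΦ h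
        obtain ⟨p, L, rfl, h₁, h₂⟩ := List.map_eq_cons_iff.1 h
        obtain rfl := List.map_eq_nil_iff.1 h₂
        cases h₁
        cases T <;> cases hT
        exact .lab _ _
  | .pair b c, T, L, d => by
      rw [Bdl.toVal] at d
      cases T with
      | unit => generalize L.toCtx = Γ at d; cases d
      | wire a => generalize L.toCtx = Γ at d; cases d
      | tensor T U =>
        obtain ⟨K, K', d₁, d₂, rfl, -⟩ := VTy.exists_of_pair d
        exact .pair d₁.bdlTy d₂.bdlTy

theorem BdlTy.exists_vTy (ob : W → M) {Q : LabCtx W} {b : Bdl} {T : BTy W} (h : BdlTy Q b T) :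
    Nonempty (VTy (ob := ob) Q.toCtx b.toVal T.toTy) := by
  induction h with
  | unit => rw [Bdl.toVal]; exact ⟨.unit Ctx.IsParam.nil⟩
  | lab l a => rw [Bdl.toVal]; exact ⟨.lab (Φ := []) Ctx.IsParam.nil l a⟩
  | pair _ _ ih₁ ih₂ =>
    rw [Bdl.toVal, LabCtx.toCtx_append]
    exact ⟨.pair (Φ := []) Ctx.IsParam.nil ih₁.some ih₂.some⟩

theorem BdlTy.map_fst_eq {Q Q' : LabCtx W} {b : Bdl} {T T' : BTy W} (h : BdlTy Q b T)
    (h' : BdlTy Q' b T') : Q.map Prod.fst = Q'.map Prod.fst := by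
  induction h generalizing Q' T' with
  | unit => cases h'; rfl
  | lab l a => cases h'; rfl
  | pair _ _ ih₁ ih₂ =>
    cases h' with
    | pair h₁ h₂ => rw [List.map_append, List.map_append, ih₁ h₁, ih₂ h₂]

theorem BdlTy.ctx_unique {Q Q' : LabCtx W} {b : Bdl} {T : BTy W} (h : BdlTy Q b T)
    (h' : BdlTy Q' b T) : Q = Q' := by
  induction h generalizing Q' with
  | unit => cases h'; rfl
  | lab l a => cases h'; rfl
  | pair _ _ ih₁ ih₂ =>
    cases h' with
    | pair h₁ h₂ => rw [ih₁ h₁, ih₂ h₂]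

theorem BdlTy.ty_unique {Q : LabCtx W} {b : Bdl} {T T' : BTy W} (h : BdlTy Q b T)
    (h' : BdlTy Q b T') : T = T' := by
  induction h generalizing T' with
  | unit => generalize [] = Q' at h'; cases h'; rfl
  | lab l a =>
    generalize hQ : [_] = Q' at h'
    cases h'
    cases hQ
    rfl
  | pair h₁ _ ih₁ ih₂ =>
    generalize hQ : (_ ++ _ : LabCtx W) = Q' at h'
    cases h' with
    | pair h₁' h₂' =>
      have hl := congrArg List.length (h₁.map_fst_eq h₁')
      rw [List.length_map, List.length_map] at hl
      obtain ⟨rfl, rfl⟩ := List.append_inj hQ hl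
      rw [ih₁ h₁', ih₂ h₂']

theorem LabCtx.eq_of_perm : {Q Q' : LabCtx W} → Q.Valid → Q.Perm Q' →
    Q.map Prod.fst = Q'.map Prod.fst → Q = Q'
  | [], _, _, h, _ => h.nil_eq
  | (l, a) :: Q, Q', hQ, h, h' => by
      obtain ⟨⟨l', a'⟩, R, rfl, h₁, h₂⟩ := List.map_eq_cons_iff.1 h'.symm
      obtain rfl : l' = l := h₁
      have hQ' := hQ.perm h
      simp only [LabCtx.Valid, List.map_cons, List.nodup_cons] at hQ hQ'
      have hm : (l', a) ∈ (l', a') :: R := h.mem_iff.1 (by simp)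
      rcases List.mem_cons.1 hm with e | hm
      · obtain rfl : a = a' := congrArg Prod.snd e
        rw [LabCtx.eq_of_perm hQ.2 (List.perm_cons _ |>.1 h) h₂.symm]
      · exact (hQ'.1 (List.mem_map_of_mem hm)).elim

end Bundles

section ExchangeFree

variable {W : Type w} {M : Type u} [StrictSymmPremonoidal.{v} M] {ob : W → M}

/-- The environment of the empty context. -/
def nilEnv : flatCtx ob [] := PUnit.unit

/-- `ExchangeFree L N A m`: the judgment `L ⊢ N : A` is derived without a final exchange, and `m` is
its interpretation. -/
inductive ExchangeFree : (L : LabCtx W) → Tm ob → (A : Ty W) →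
    Circ (labObj ob L) (obj ob A.sharp) (flat ob A) → Prop
  | app {L₁ L₂ : LabCtx W} {V V' : Val ob} {A B : Ty W} {T : List W}
      (d₁ : VTy L₁.toCtx V (.arrow A B T)) (d₂ : VTy L₂.toCtx V' A)
      (e : labObj ob (L₁ ++ L₂) = obj ob T * obj ob A.sharp) :
      ExchangeFree (L₁ ++ L₂) (.app V V') B
        (Circ.pre (eqToHom e) (arrowFn (d₁.fn (labEnv L₁)) (d₂.fn (labEnv L₂))))
  | force {V : Val ob} {A : Ty W} (d : VTy [] V (.bang A)) (e : labObj ob [] = 1) :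
      ExchangeFree [] (.force V) A (Circ.pre (eqToHom e) (bangFn (d.fn nilEnv)))
  | box {V : Val ob} {T U : BTy W} (d : VTy [] V (.arrow T.toTy U.toTy []))
      (e : labObj ob [] = obj ob (Ty.circ T U).sharp) :
      ExchangeFree [] (.box T V) (.circ T U) (boxMap (d.fn nilEnv), eqToHom e)
  | apply {L : LabCtx W} {V V' : Val ob} {T U : BTy W} (d₁ : VTy [] V (.circ T U))
      (d₂ : VTy L.toCtx V' T.toTy) (e : labObj ob L = obj ob T.toTy.sharp) :
      ExchangeFree L (.apply V V') U.toTy (BTy.pt ob U, eqToHom e ≫ circFn (d₁.fn nilEnv))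
  | dest {L₁ L₂ : LabCtx W} {V : Val ob} {N : Tm ob} {A B C : Ty W}
      (d₁ : VTy L₁.toCtx V (.tensor A B))
      (d₂ : CTy (Ctx.shift 2 L₂.toCtx ++ [.var 1 A, .var 0 B]) N C)
      (e : labObj ob (L₂ ++ L₁) =
        obj ob (Ctx.sharp (Ctx.shift 2 L₂.toCtx ++ [.var 1 A, .var 0 B]))) :
      ExchangeFree (L₂ ++ L₁) (.dest V N) C (Circ.pre (eqToHom e)
        (d₂.run (join (shiftEnv 2 (labEnv L₂)) (varEnv₂ 1 A 0 B (pairFn (d₁.fn (labEnv L₁))).1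
          (pairFn (d₁.fn (labEnv L₁))).2))))
  | ifz {L : LabCtx W} {V : Val ob} {N N' : Tm ob} {A : Ty W} (d : VTy [] V .nat)
      (d₁ : CTy L.toCtx N A) (d₂ : CTy L.toCtx N' A)
      (e : labObj ob L = obj ob (Ctx.sharp L.toCtx)) :
      ExchangeFree L (.ifz V N N') A (Circ.pre (eqToHom e)
        (match natFn (d.fn nilEnv) with
          | 0 => d₁.run (labEnv L)
          | _ + 1 => d₂.run (labEnv L)))
  | ret {L : LabCtx W} {V : Val ob} {A : Ty W} (d : VTy L.toCtx V A)
      (e : labObj ob L = obj ob A.sharp) : ExchangeFree L (.ret V) A (d.fn (labEnv L), eqToHom e)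
  | letin {L₁ L₂ : LabCtx W} {N N' : Tm ob} {A B : Ty W} (d₁ : CTy L₁.toCtx N A)
      (d₂ : CTy (Ctx.shift 1 L₂.toCtx ++ [.var 0 A]) N' B)
      (e : labObj ob (L₂ ++ L₁) = obj ob (Ctx.sharp L₂.toCtx) * obj ob (Ctx.sharp L₁.toCtx))
      (e' : obj ob (Ctx.sharp L₂.toCtx) * obj ob A.sharp =
        obj ob (Ctx.sharp (Ctx.shift 1 L₂.toCtx ++ [.var 0 A]))) :
      ExchangeFree (L₂ ++ L₁) (.letin N N') B
        (Circ.pre (eqToHom e ≫ lwhisk (obj ob (Ctx.sharp L₂.toCtx)) (d₁.run (labEnv L₁)).2 ≫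
            eqToHom e')
          (d₂.run (join (shiftEnv 1 (labEnv L₂)) (varEnv 0 A (d₁.run (labEnv L₁)).1))))

/-- A derivation in a label context `L` is a derivation without a final exchange, up to a
permutation of the context. -/
def CTy.Normalizes {Γ : Ctx W} {N : Tm ob} {A : Ty W} (d : CTy Γ N A) (L : LabCtx W) : Prop :=
  ∃ (L' : LabCtx W) (p : labObj ob L ⟶ labObj ob L')
      (m : Circ (labObj ob L') (obj ob A.sharp) (flat ob A)), IsPerm ob p ∧ ExchangeFree L' N A m ∧
        ∀ x (e : obj ob (Ctx.sharp Γ) = labObj ob L), d.run x = Circ.pre (eqToHom e ≫ p) m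

theorem ExchangeFree.normalizes {L : LabCtx W} {Γ : Ctx W} (h : L.toCtx = Γ) {N : Tm ob} {A : Ty W}
    {m : Circ (labObj ob L) (obj ob A.sharp) (flat ob A)} (hm : ExchangeFree L N A m)
    {d : CTy Γ N A} (x : flatCtx ob Γ) (e : obj ob (Ctx.sharp Γ) = labObj ob L)
    (hd : d.run x = Circ.pre (eqToHom e) m) : d.Normalizes L :=
  ⟨L, 𝟙 _, m, .refl L, hm, fun y e => by rw [eq_of_labels h y x, hd, Category.comp_id]⟩

theorem obj_sharp_lab (l : ℕ) (a : W) : obj ob (Entry.lab l a).ty.sharp = ob a := mul_one _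

theorem conj_lwhisk_sw_congr {A A' X X' Y Y' Z Z' S T R R' U : M} (hA : A = A') (hX : X = X')
    (hY : Y = Y') (hZ : Z = Z') (h₁ : S = A * (X * (Y * Z))) (h₂ : A * (Y * (X * Z)) = T)
    (h₃ : T = R) (h₄ : S = R') (h₅ : R' = A' * (X' * (Y' * Z'))) (h₆ : A' * (Y' * (X' * Z')) = R)
    (r : R ⟶ U) :
    (eqToHom h₁ ≫ lwhisk A (sw X Y Z) ≫ eqToHom h₂) ≫ eqToHom h₃ ≫ r =
      eqToHom h₄ ≫ (eqToHom h₅ ≫ lwhisk A' (sw X' Y' Z') ≫ eqToHom h₆) ≫ r := by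
  subst hA hX hY hZ; simp

namespace CTy

variable {Φ Γ Γ₁ Γ₂ : Ctx W} {V V' : Val ob} {N N' : Tm ob} {A B C : Ty W} {T U : BTy W}
  {L : LabCtx W}

theorem normalizes_app {T : List W} (hΦ : Ctx.IsParam Φ) (d₁ : VTy (Φ ++ Γ₁) V (.arrow A B T))
    (d₂ : VTy (Φ ++ Γ₂) V' A) (h : L.toCtx = Φ ++ Γ₁ ++ Γ₂) : (CTy.app hΦ d₁ d₂).Normalizes L := by
  obtain ⟨L₁, L₂, rfl, rfl, rfl, rfl⟩ := LabCtx.exists_of_append_append hΦ h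
  have e := obj_sharp_of_app hΦ d₁ d₂
  have e' := labObj_eq_of_toCtx_eq (ob := ob) h
  refine (ExchangeFree.app (L₁ := L₁) (L₂ := L₂) d₁ d₂ (e'.trans e)).normalizes h
    (join (join nilEnv (labEnv L₁)) (labEnv L₂)) e'.symm ?_
  rw [run_app hΦ d₁ d₂ e, Circ.pre_pre, eqToHom_trans, split_join, dropMid_join]
  rfl

theorem normalizes_force (hΦ : Ctx.IsParam Φ) (d : VTy Φ V (.bang A)) (h : L.toCtx = Φ) :
    (CTy.force hΦ d).Normalizes L := by
  obtain ⟨rfl, rfl⟩ := LabCtx.eq_nil_of_sharp h hΦ.sharp_eq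
  have e : obj ob (Ctx.sharp []) = labObj ob [] := rfl
  have e' : labObj ob [] = 1 := rfl
  refine (ExchangeFree.force d e').normalizes h nilEnv e ?_
  rw [run_force hΦ d (e.trans e'), Circ.pre_pre, eqToHom_trans]

theorem normalizes_box (hΦ : Ctx.IsParam Φ) (d : VTy Φ V (.arrow T.toTy U.toTy []))
    (h : L.toCtx = Φ) : (CTy.box hΦ d).Normalizes L := by
  obtain ⟨rfl, rfl⟩ := LabCtx.eq_nil_of_sharp h hΦ.sharp_eq
  have e : obj ob (Ctx.sharp []) = labObj ob [] := rfl
  have e' : labObj ob [] = obj ob (Ty.circ T U).sharp := rfl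
  refine (ExchangeFree.box d e').normalizes h nilEnv e ?_
  rw [run_box hΦ d (e.trans e'), Circ.pre, eqToHom_trans]

theorem normalizes_apply (hΦ : Ctx.IsParam Φ) (d₁ : VTy (Φ ++ Γ₁) V (.circ T U))
    (d₂ : VTy (Φ ++ Γ₂) V' T.toTy) (h : L.toCtx = Φ ++ Γ₁ ++ Γ₂) :
    (CTy.apply hΦ d₁ d₂).Normalizes L := by
  obtain ⟨L₁, L₂, rfl, rfl, h₁, rfl⟩ := LabCtx.exists_of_append_append hΦ h
  obtain ⟨rfl, rfl⟩ := LabCtx.eq_nil_of_sharp h₁ d₁.sharp_eq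
  have e := obj_sharp_of_apply hΦ d₁ d₂
  have e' := labObj_eq_of_toCtx_eq (ob := ob) h
  refine (ExchangeFree.apply (L := L₂) d₁ d₂ (e'.trans e)).normalizes h
    (join (join nilEnv nilEnv) (labEnv L₂)) e'.symm ?_
  rw [run_apply hΦ d₁ d₂ e, Circ.pre, eqToHom_trans_assoc, split_join]
  rfl

theorem normalizes_dest (hΦ : Ctx.IsParam Φ) (d₁ : VTy (Φ ++ Γ₁) V (.tensor A B))
    (d₂ : CTy (Ctx.shift 2 (Φ ++ Γ₂) ++ [.var 1 A, .var 0 B]) N C)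
    (h : L.toCtx = Φ ++ Γ₂ ++ Γ₁) : (CTy.dest hΦ d₁ d₂).Normalizes L := by
  obtain ⟨L₂, L₁, rfl, rfl, rfl, rfl⟩ := LabCtx.exists_of_append_append hΦ h
  have e := obj_sharp_of_dest hΦ d₁ L₂.toCtx
  have e' := labObj_eq_of_toCtx_eq (ob := ob) h
  refine (ExchangeFree.dest (L₁ := L₁) (L₂ := L₂) d₁ d₂ (e'.trans e)).normalizes h
    (join (join nilEnv (labEnv L₂)) (labEnv L₁)) e'.symm ?_
  rw [run_dest hΦ d₁ d₂ e, Circ.pre_pre, eqToHom_trans, split_join, dropMid_join]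
  rfl

theorem normalizes_ifz (hΦ : Ctx.IsParam Φ) (d : VTy Φ V .nat) (d₁ : CTy (Φ ++ Γ) N A)
    (d₂ : CTy (Φ ++ Γ) N' A) (h : L.toCtx = Φ ++ Γ) : (CTy.ifz hΦ d d₁ d₂).Normalizes L := by
  obtain ⟨rfl, rfl⟩ := LabCtx.toCtx_eq_of_param_append hΦ h
  have e := labObj_eq_obj_sharp (ob := ob) L
  refine (ExchangeFree.ifz d d₁ d₂ e).normalizes h (join nilEnv (labEnv L)) e.symm ?_
  rw [run_ifz, Circ.pre_pre, eqToHom_trans, eqToHom_refl, split_join]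
  exact (Circ.pre_id _).symm

theorem normalizes_ret (d : VTy Γ V A) (h : L.toCtx = Γ) : (CTy.ret d).Normalizes L := by
  subst h
  refine (ExchangeFree.ret d d.labObj_eq).normalizes rfl (labEnv L) (labObj_eq_obj_sharp L).symm ?_
  rw [run_ret d (congrArg (obj ob) d.sharp_eq), Circ.pre, eqToHom_trans]

theorem normalizes_letin (hΦ : Ctx.IsParam Φ) (d₁ : CTy (Φ ++ Γ₁) N A)
    (d₂ : CTy (Ctx.shift 1 (Φ ++ Γ₂) ++ [.var 0 A]) N' B) (h : L.toCtx = Φ ++ Γ₂ ++ Γ₁) :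
    (CTy.letin hΦ d₁ d₂).Normalizes L := by
  obtain ⟨L₂, L₁, rfl, rfl, rfl, rfl⟩ := LabCtx.exists_of_append_append hΦ h
  have e := obj_sharp_letin (ob := ob) hΦ L₁.toCtx L₂.toCtx
  have e₁ := obj_sharp_letin' (ob := ob) hΦ L₂.toCtx A
  have e' := labObj_eq_of_toCtx_eq (ob := ob) h
  refine (ExchangeFree.letin (L₁ := L₁) (L₂ := L₂) d₁ d₂ (e'.trans e) e₁).normalizes h
    (join (join nilEnv (labEnv L₂)) (labEnv L₁)) e'.symm ?_
  rw [run_letin hΦ d₁ d₂ e e₁, Circ.pre_pre, eqToHom_trans_assoc, split_join, dropMid_join]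
  rfl

theorem normalizes_ex {a b : Entry W} (d : CTy (Γ₁ ++ a :: b :: Γ₂) N C)
    (ih : ∀ {L : LabCtx W}, L.toCtx = Γ₁ ++ a :: b :: Γ₂ → d.Normalizes L) {L : LabCtx W}
    (h : L.toCtx = Γ₁ ++ b :: a :: Γ₂) : (CTy.ex d).Normalizes L := by
  obtain ⟨L₁, L₂, p, q, rfl, rfl, rfl, rfl, rfl⟩ := LabCtx.exists_of_append_cons_cons h
  obtain ⟨L', r, m, hr, hm, hd⟩ := ih (L := L₁ ++ q :: p :: L₂) (List.map_append)
  refine ⟨L', _, m, ((IsPerm.swap p q L₂).lwhisk_block L₁).trans hr, hm, fun x e => ?_⟩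
  rw [run_ex, hd _ (by rw [labObj_eq_obj_sharp, LabCtx.toCtx_append]; rfl), Circ.pre_pre]
  exact congrArg (Prod.mk m.1) (congrArg (· ≫ m.2)
    (conj_lwhisk_sw_congr (labObj_eq_obj_sharp L₁).symm (obj_sharp_lab p.1 p.2)
      (obj_sharp_lab q.1 q.2) (labObj_eq_obj_sharp L₂).symm _ _ _ _ _ _ r))

theorem normalizes : {Γ : Ctx W} → {N : Tm ob} → {A : Ty W} → (d : CTy Γ N A) →
    {L : LabCtx W} → L.toCtx = Γ → d.Normalizes L
  | _, _, _, .app hΦ d₁ d₂, _, h => normalizes_app hΦ d₁ d₂ h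
  | _, _, _, .force hΦ d, _, h => normalizes_force hΦ d h
  | _, _, _, .box hΦ d, _, h => normalizes_box hΦ d h
  | _, _, _, .apply hΦ d₁ d₂, _, h => normalizes_apply hΦ d₁ d₂ h
  | _, _, _, .dest hΦ d₁ d₂, _, h => normalizes_dest hΦ d₁ d₂ h
  | _, _, _, .ifz hΦ d d₁ d₂, _, h => normalizes_ifz hΦ d d₁ d₂ h
  | _, _, _, .ret d, _, h => normalizes_ret d h
  | _, _, _, .letin hΦ d₁ d₂, _, h => normalizes_letin hΦ d₁ d₂ h
  | _, _, _, .ex d, _, h => normalizes_ex d d.normalizes h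

end CTy

end ExchangeFree

/-! ### Soundness -/

section Inversion

variable {W : Type w} {M : Type u} [StrictSymmPremonoidal.{v} M] {ob : W → M}

theorem VTy.exists_of_lam {Γ : Ctx W} {A A' B : Ty W} {T : List W} {N : Tm ob}
    (d : VTy Γ (.lam A N) (.arrow A' B T)) :
    ∃ (d' : CTy (Ctx.shift 1 Γ ++ [.var 0 A']) N B)
      (e : obj ob T * obj ob A'.sharp = obj ob (Ctx.sharp (Ctx.shift 1 Γ ++ [.var 0 A']))),
      ∀ x a, arrowFn (d.fn x) a =
        Circ.pre (eqToHom e) (d'.run (join (shiftEnv 1 x) (varEnv 0 A' a))) := by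
  cases d with
  | abs d =>
    have e : obj ob (Ctx.sharp Γ) * obj ob A.sharp =
        obj ob (Ctx.sharp (Ctx.shift 1 Γ ++ [.var 0 A])) := by
      rw [obj_sharp_append, Ctx.sharp_shift, obj_sharp_var]
    exact ⟨d, e, VTy.arrowFn_fn_abs d e⟩

theorem VTy.exists_of_lift {Γ : Ctx W} {A : Ty W} {N : Tm ob} (d : VTy Γ (.lift N) (.bang A)) :
    ∃ (d' : CTy Γ N A) (e : 1 = obj ob (Ctx.sharp Γ)),
      ∀ x, bangFn (d.fn x) = Circ.pre (eqToHom e) (d'.run x) := by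
  cases d with
  | lift hΦ d =>
    have e : 1 = obj ob (Ctx.sharp Γ) := by rw [hΦ.sharp_eq]; rfl
    exact ⟨d, e, VTy.bangFn_fn_lift hΦ d e⟩

theorem VTy.natFn_fn_nat {Γ : Ctx W} {n : ℕ} (d : VTy (ob := ob) Γ (.nat n) .nat)
    (x : flatCtx ob Γ) : natFn (d.fn x) = n := by
  cases d; rfl

theorem VTy.exists_of_boxed {Γ : Ctx W} {b c : Bdl} {D : Circuit ob} {T U : BTy W}
    (d : VTy Γ (.boxed b D c) (.circ T U)) :
    D.dom.Valid ∧ D.cod.Valid ∧ ∃ (Q L : LabCtx W) (hb : BdlTy Q b T) (hc : BdlTy L c U)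
      (p : labObj ob Q ⟶ labObj ob D.dom) (q : labObj ob D.cod ⟶ labObj ob L),
      IsPerm ob p ∧ IsPerm ob q ∧ ∀ x, circFn (d.fn x) = boxHom hb hc p q := by
  cases d with
  | circ hΦ hdom hcod hb hc p hp q hq =>
    exact ⟨hdom, hcod, _, _, hb, hc, p, q, hp, hq, fun _ => rfl⟩

end Inversion

section Soundness

variable {W : Type w} {M : Type u} [StrictSymmPremonoidal.{v} M] {ob : W → M}
  {Q L₀ L₁ : LabCtx W}

/-- The configuration `(C, V)` has type `A`, with remaining wires `Q'`, and it denotes `(a, f)`. -/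
def Reaches (C : labObj ob Q ⟶ labObj ob L₁) (V : Val ob) (A : Ty W) (Q' : LabCtx W)
    (a : flat ob A) (f : labObj ob Q ⟶ obj ob A.sharp * labObj ob Q') : Prop :=
  L₁.Valid ∧ ∃ (L : LabCtx W) (p : labObj ob L₁ ⟶ labObj ob (L ++ Q')) (t : VTy L.toCtx V A),
    IsPerm ob p ∧ t.fn (labEnv L) = a ∧
      ∀ e : labObj ob (L ++ Q') = obj ob A.sharp * labObj ob Q', C ≫ p ≫ eqToHom e = f

/-- Every meaning of `(C, N)` is a meaning of `(C', V)`. -/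
def Sound (C : labObj ob Q ⟶ labObj ob L₀) (N : Tm ob) (C' : labObj ob Q ⟶ labObj ob L₁)
    (V : Val ob) : Prop :=
  ∀ ⦃L Q' : LabCtx W⦄ ⦃A : Ty W⦄ ⦃p : labObj ob L₀ ⟶ labObj ob (L ++ Q')⦄, IsPerm ob p →
    ∀ t : CTy L.toCtx N A, L₀.Valid →
    ∀ e : labObj ob (L ++ Q') = obj ob (Ctx.sharp L.toCtx) * labObj ob Q',
      Reaches C' V A Q' (t.run (labEnv L)).1
        (C ≫ p ≫ eqToHom e ≫ rwhisk (t.run (labEnv L)).2 (labObj ob Q'))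

theorem labObj_append_eq (L Q' : LabCtx W) :
    labObj ob (L ++ Q') = obj ob (Ctx.sharp L.toCtx) * labObj ob Q' := by
  rw [labObj_append, labObj_eq_obj_sharp L]

theorem Reaches.of_eq {C : labObj ob Q ⟶ labObj ob L₁} {V : Val ob} {A : Ty W} {Q' : LabCtx W}
    {a a' : flat ob A} {f f' : labObj ob Q ⟶ obj ob A.sharp * labObj ob Q'}
    (h : Reaches C V A Q' a f) (ha : a = a') (hf : f = f') : Reaches C V A Q' a' f' :=
  ha ▸ hf ▸ h

variable {C : labObj ob Q ⟶ labObj ob L₀} {N : Tm ob} {C' : labObj ob Q ⟶ labObj ob L₁}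
  {V : Val ob}

theorem Sound.reaches (h : Sound C N C' V) {L Q' : LabCtx W} {A : Ty W}
    {p : labObj ob L₀ ⟶ labObj ob (L ++ Q')} (hp : IsPerm ob p) (t : CTy L.toCtx N A)
    (hL₀ : L₀.Valid) {m : Circ (labObj ob L) (obj ob A.sharp) (flat ob A)}
    (ht : ∀ e, t.run (labEnv L) = Circ.pre (eqToHom e) m)
    (e : labObj ob (L ++ Q') = labObj ob L * labObj ob Q') :
    Reaches C' V A Q' m.1 (C ≫ p ≫ eqToHom e ≫ rwhisk m.2 (labObj ob Q')) := by
  refine (h hp t hL₀ (labObj_append_eq L Q')).of_eq ?_ ?_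
  · rw [ht (labObj_eq_obj_sharp L).symm, Circ.pre]
  · rw [ht (labObj_eq_obj_sharp L).symm, Circ.pre, rwhisk_comp, rwhisk_eqToHom,
      eqToHom_trans_assoc]

theorem Sound.of_exchangeFree (h : ∀ ⦃L Q' : LabCtx W⦄ ⦃A : Ty W⦄
    ⦃p : labObj ob L₀ ⟶ labObj ob (L ++ Q')⦄ ⦃m : Circ (labObj ob L) (obj ob A.sharp) (flat ob A)⦄,
    IsPerm ob p → ExchangeFree L N A m → L₀.Valid →
    ∀ e : labObj ob (L ++ Q') = labObj ob L * labObj ob Q',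
      Reaches C' V A Q' m.1 (C ≫ p ≫ eqToHom e ≫ rwhisk m.2 (labObj ob Q'))) :
    Sound C N C' V := fun L Q' A p hp t hL₀ e => by
  obtain ⟨L', r, m, hr, hm, ht⟩ := t.normalizes rfl
  have e' := (labObj_eq_obj_sharp (ob := ob) L).symm
  refine (h (hp.trans (hr.rwhisk_block Q')) hm hL₀ (labObj_append ob L' Q')).of_eq ?_ ?_
  · rw [ht _ e', Circ.pre]
  · rw [ht _ e', Circ.pre]
    simp only [rwhisk_comp, rwhisk_eqToHom, Category.assoc, eqToHom_trans_assoc, eqToHom_refl,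
      Category.id_comp]

theorem Sound.app {A : Ty W} {X : Val ob} {N : Tm ob} (h : Sound C (N.sub (single V)) C' X) :
    Sound C (.app (.lam A N) V) C' X := .of_exchangeFree fun L Q' B p m hp hm hL₀ e => by
  cases hm with
  | app d₁ d₂ e₁ =>
    obtain ⟨d, e₂, hd⟩ := d₁.exists_of_lam
    obtain ⟨d', e₃, hd'⟩ := d.subst_one d₂
    exact h.reaches hp d' hL₀ (fun e => by
      rw [hd', hd, Circ.pre_pre, Circ.pre_pre, eqToHom_trans, eqToHom_trans]) e

theorem Sound.dest {V V' X : Val ob} {N : Tm ob} (h : Sound C (N.sub (double V V')) C' X) :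
    Sound C (.dest (.pair V V') N) C' X := .of_exchangeFree fun L Q' B p m hp hm hL₀ e => by
  cases hm with
  | dest d₁ d₂ e₁ =>
    obtain ⟨K, K', d, d', rfl, hd⟩ := d₁.exists_of_pair
    obtain ⟨t, e₂, ht⟩ := d₂.subst_two d d'
    exact h.reaches hp t hL₀ (fun e => by rw [ht, hd, Circ.pre_pre, eqToHom_trans]) e

theorem Sound.force {X : Val ob} {N : Tm ob} (h : Sound C N C' X) :
    Sound C (.force (.lift N)) C' X := .of_exchangeFree fun L Q' B p m hp hm hL₀ e => by
  cases hm with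
  | force d e₁ =>
    obtain ⟨d', e₂, hd⟩ := d.exists_of_lift
    refine h.reaches (L := []) hp d' hL₀ (fun e => ?_) e
    rw [hd, Circ.pre_pre, Circ.pre_pre, eqToHom_trans, eqToHom_trans]
    exact (Circ.pre_id _).symm

theorem Sound.ifz_zero {X : Val ob} {N N' : Tm ob} (h : Sound C N C' X) :
    Sound C (.ifz (.nat 0) N N') C' X := .of_exchangeFree fun L Q' B p m hp hm hL₀ e => by
  cases hm with
  | ifz d d₁ d₂ e₁ =>
    rw [d.natFn_fn_nat]
    exact h.reaches hp d₁ hL₀ (fun e => by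
      rw [Circ.pre_pre, eqToHom_trans, eqToHom_refl, Circ.pre_id]) e

theorem Sound.ifz_succ {X : Val ob} {n : ℕ} {N N' : Tm ob} (h : Sound C N' C' X) :
    Sound C (.ifz (.nat (n + 1)) N N') C' X := .of_exchangeFree fun L Q' B p m hp hm hL₀ e => by
  cases hm with
  | ifz d d₁ d₂ e₁ =>
    rw [d.natFn_fn_nat]
    exact h.reaches hp d₂ hL₀ (fun e => by
      rw [Circ.pre_pre, eqToHom_trans, eqToHom_refl, Circ.pre_id]) e

theorem Sound.ret : Sound C (.ret V) C V := .of_exchangeFree fun L Q' B p m hp hm hL₀ e => by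
  cases hm with
  | ret d e₁ =>
    exact ⟨hL₀, L, p, d, hp, rfl, fun e => by rw [rwhisk_eqToHom, eqToHom_trans]⟩

/-- Exchanging the wires of the first computation to the front, running it there and exchanging back
amounts to running it in place. -/
theorem letin_coherence {X L₀ L₁ P K₀ l₁ l₂ s₁ s₂ a k r U R T y z : M} {c : X ⟶ L₀} {p : L₀ ⟶ P}
    {c' : X ⟶ L₁} {q : L₁ ⟶ K₀} {g : s₁ ⟶ a} (h₁ : l₁ = s₁) (h₂ : l₂ = s₂) (hk : k = a)
    (hU : U = l₂ * r) (hP : P = l₂ * (l₁ * r)) (hK : K₀ = a * U)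
    (hE : l₁ * (l₂ * r) = s₁ * U)
    (hf : c' ≫ q ≫ eqToHom hK =
      c ≫ p ≫ eqToHom hP ≫ sw l₂ l₁ r ≫ eqToHom hE ≫ rwhisk g U)
    (hK' : K₀ = k * (l₂ * r)) (hR : l₂ * (k * r) = R * r) (hT : R = T) (f : T ⟶ z)
    (hP' : P = y * r) (hy : y = s₂ * s₁) (hT' : s₂ * a = T) :
    c' ≫ q ≫ eqToHom hK' ≫ sw k l₂ r ≫ eqToHom hR ≫ rwhisk (eqToHom hT ≫ f) r =
      c ≫ p ≫ eqToHom hP' ≫ rwhisk (eqToHom hy ≫ lwhisk s₂ g ≫ eqToHom hT' ≫ f) r := by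
  subst h₁ h₂ hk hU hT hT' hy hK hP
  simp only [eqToHom_refl, Category.id_comp, Category.comp_id] at hf
  rw [reassoc_of% hf, rwhisk_comp, rwhisk_comp]
  simp only [Category.assoc, rwhisk_comp, eqToHom_refl, Category.id_comp, rwhisk_id,
    eqToHom_trans_assoc, rwhisk_lwhisk_eq]
  rw [reassoc_of% (sw_natural_left g l₂ r), sw_sw_assoc]

theorem Sound.letin {L₂ : LabCtx W} {C'' : labObj ob Q ⟶ labObj ob L₂} {N' : Tm ob} {X : Val ob}
    (h : Sound C N C' V) (h' : Sound C' (N'.sub (single V)) C'' X) :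
    Sound C (.letin N N') C'' X := .of_exchangeFree fun L Q' B p m hp hm hL₀ e => by
  cases hm with
  | @letin L₁ L₂ _ _ A _ d₁ d₂ e₁ e₂ =>
    have eP : L₂ ++ L₁ ++ Q' = L₂ ++ (L₁ ++ Q') := List.append_assoc _ _ _
    obtain ⟨hL₁, K, q, t, hq, ht, hf⟩ :=
      h ((hp.trans (.eqToHom eP)).trans (.swap_block _ _ _)) d₁ hL₀ (labObj_append_eq _ _)
    have eK : L₂ ++ (K ++ Q') = L₂ ++ K ++ Q' := (List.append_assoc _ _ _).symm
    obtain ⟨d, e₃, hd⟩ := d₂.subst_one t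
    have hf := hf ((labObj_append ob _ _).trans (by rw [t.labObj_eq]))
    refine (h' ((hq.trans (.swap_block _ _ _)).trans (.eqToHom eK)) d hL₁
      (labObj_append_eq _ _)).of_eq ?_ ?_
    · rw [hd, ht]; rfl
    · rw [hd, ht]
      simp only [Circ.pre, Category.assoc, eqToHom_trans_assoc] at hf ⊢
      exact letin_coherence (labObj_eq_obj_sharp _) (labObj_eq_obj_sharp _) t.labObj_eq
        (labObj_append ob _ _) _ _ _ hf _ _ _ _ _ _ _

theorem box_coherence {K K₁ K' L L₁ T U I S r : M} {D : K ⟶ K'} {q : K' ⟶ L₁} {g : I * T ⟶ U}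
    (hr : r = 1) (h₁ : L₁ = U * r) (h₂ : K = K₁) (h₃ : K₁ = S * r) (h₄ : S = I * T)
    (hf : D ≫ q ≫ eqToHom h₁ = 𝟙 K ≫ eqToHom h₂ ≫ eqToHom h₃ ≫ rwhisk (eqToHom h₄ ≫ g) r)
    (h₅ : T = K) (h₆ : L₁ = L) (h₇ : L = U) (h₈ : T = I * T) :
    eqToHom h₅ ≫ 𝟙 K ≫ D ≫ (q ≫ eqToHom h₆) ≫ eqToHom h₇ = eqToHom h₈ ≫ g := by
  subst hr h₄
  have h := congrArg (· ≫ eqToHom (mul_one U)) hf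
  simp only [Category.assoc, eqToHom_trans, Category.id_comp, rwhisk_one_eq, eqToHom_trans_assoc,
    eqToHom_refl, Category.comp_id] at h ⊢
  rw [h, eqToHom_trans_assoc]

theorem Sound.box {K K' : LabCtx W} {T : BTy W} {b c : Bdl} {D : labObj ob K ⟶ labObj ob K'}
    (hK : K.Valid) (hb : BdlTy K b T) (h : Sound (𝟙 (labObj ob K)) (.app V b.toVal) D c.toVal) :
    Sound C (.box T V) C (.boxed b ⟨K, K', D⟩ c) :=
      .of_exchangeFree fun L Q' B p m hp hm hL₀ e => by
  cases hm with
  | @box _ _ U d e₁ =>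
    obtain ⟨t⟩ := hb.exists_vTy ob
    obtain ⟨t₀, ht₀⟩ : ∃ t₀ : CTy K.toCtx (.app V b.toVal) U.toTy, ∀ e, t₀.run (labEnv K) =
        Circ.pre (eqToHom e) (arrowFn (d.fn nilEnv) (BTy.pt ob T)) :=
      ⟨CTy.app (Φ := []) (Γ₁ := []) Ctx.IsParam.nil d t, fun e =>
        (CTy.run_app (Φ := []) (Γ₁ := []) Ctx.IsParam.nil d t e (labEnv K)).trans
          (congrArg (fun a => Circ.pre (eqToHom e) (arrowFn (d.fn nilEnv) a)) (BTy.eq_pt T _))⟩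
    obtain ⟨hK', L, q, t', hq, -, hf⟩ := h (L := K) (Q' := [])
      (.eqToHom (List.append_nil K).symm) t₀ hK (labObj_append_eq _ _)
    have hL : L ++ [] = L := List.append_nil L
    refine ⟨hL₀, [], p, .circ (D := ⟨K, K', D⟩) Ctx.IsParam.nil hK hK' hb t'.bdlTy (𝟙 _) (.refl K)
      (q ≫ eqToHom (by rw [hL])) (hq.trans (.eqToHom hL)), hp, ?_, fun e => ?_⟩
    · have hf := hf ((labObj_append ob L []).trans (congrArg (· * _) t'.labObj_eq))
      rw [ht₀ (obj_sharp_of_app (Φ := []) (Γ₁ := []) Ctx.IsParam.nil d t), Circ.pre] at hf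
      exact box_coherence rfl _ _ _ _ hf _ _ _ _
    · rw [rwhisk_eqToHom, eqToHom_trans]

theorem apply_coherence {X L₀ L₁ P P' R R' S Z T U t k u : M} {c : X ⟶ L₀} {p : L₀ ⟶ P'}
    {s : L₀ ⟶ P} {s' : S ⟶ L₁} {q : L₁ ⟶ S} {r : R ⟶ R'} (hr : Central r) (ht : t = T)
    (hU : k = U) (hP : P = T * R)
    (hP' : t * R' = P') (hP₂ : P = t * R)
    (hp : s ≫ eqToHom hP₂ ≫ lwhisk t r ≫ eqToHom hP' = p) (hq : s' ≫ q = 𝟙 _)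
    (E : T ⟶ U) (hS : U * R = S) (hS' : S = k * R) (hZ : k * R' = Z) (hZ' : Z = U * R')
    (h₁ : P' = u * R') (h₂ : u = T) :
    (c ≫ s ≫ eqToHom hP ≫ rwhisk E R ≫ eqToHom hS ≫ s') ≫
        (q ≫ eqToHom hS' ≫ lwhisk k r ≫ eqToHom hZ) ≫ eqToHom hZ' =
      c ≫ p ≫ eqToHom h₁ ≫ rwhisk (eqToHom h₂ ≫ E) R' := by
  subst ht hU hP hP' hp hS hZ h₂
  -- No interchange law is available: `r` moves past `E` because permutations are central.
  simp only [Category.assoc, reassoc_of% hq, eqToHom_refl, Category.id_comp, Category.comp_id]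
  rw [hr E]

theorem Sound.apply {Qb Qc Qt Qk R : LabCtx W} {b c t k : Bdl} {D : Circuit ob} {T U : BTy W}
    (hb : BdlTy Qb b T) (hc : BdlTy Qc c U) (ht : BdlTy Qt t T) (hk : BdlTy Qk k U)
    {p : labObj ob Qb ⟶ labObj ob D.dom} {q : labObj ob D.cod ⟶ labObj ob Qc}
    {s : labObj ob L₀ ⟶ labObj ob (Qt ++ R)} {s' : labObj ob (Qk ++ R) ⟶ labObj ob L₁}
    (hp : IsPerm ob p) (hq : IsPerm ob q) (hs : IsPerm ob s) (hs' : IsPerm ob s')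
    (hL₁ : L₁.Valid) :
    Sound C (.apply (.boxed b D c) t.toVal) (append ht hk C s (boxHom hb hc p q) s') k.toVal :=
      .of_exchangeFree fun L Q' B p₀ m hp₀ hm hL₀ e => by
  cases hm with
  | apply d₁ d₂ e₁ =>
    obtain ⟨hdom, hcod, Q₁, Q₂, hb', hc', p', q', hp', hq', hd₁⟩ := d₁.exists_of_boxed
    have hQb := hdom.perm hp.listPerm.symm
    obtain rfl := LabCtx.eq_of_perm hQb (hp.listPerm.trans hp'.listPerm.symm) (hb.map_fst_eq hb')
    obtain rfl := LabCtx.eq_of_perm (hcod.perm hq.listPerm) (hq.listPerm.symm.trans hq'.listPerm)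
      (hc.map_fst_eq hc')
    obtain rfl := hb.ty_unique hb'
    obtain rfl := hc.ty_unique hc'
    obtain rfl := hp.unique hQb hp'
    obtain rfl := hq.unique hcod hq'
    obtain rfl := ht.ctx_unique d₂.bdlTy
    obtain ⟨r, hr⟩ := exists_isPerm ob ((List.perm_append_left_iff Qt).1
      (hs.listPerm.symm.trans hp₀.listPerm))
    have hsr := (hs.trans (hr.lwhisk_block Qt)).unique hL₀ hp₀
    obtain ⟨v, hv, e'⟩ := hs'.exists_inv
    obtain ⟨tk⟩ := hk.exists_vTy ob
    refine ⟨hL₁, Qk, _, tk, hv.trans (hr.lwhisk_block Qk), BTy.eq_pt _ _, fun e₂ => ?_⟩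
    rw [hd₁]
    exact apply_coherence hr.central (ht.labObj_eq ob) (hk.labObj_eq ob) _ _ _ hsr e' _ _ _ _ _ _ _

theorem Eval.sound {Q L₀ L₁ : LabCtx W} {C : labObj ob Q ⟶ labObj ob L₀} {N : Tm ob}
    {C' : labObj ob Q ⟶ labObj ob L₁} {V : Val ob} (h : Eval C N C' V) : Sound C N C' V := by
  induction h with
  | app _ ih => exact ih.app
  | dest _ ih => exact ih.dest
  | force _ ih => exact ih.force
  | ifz_zero _ ih => exact ih.ifz_zero
  | ifz_succ _ ih => exact ih.ifz_succ
  | ret => exact .ret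
  | letin _ _ ih ih' => exact ih.letin ih'
  | box hK hb _ ih => exact .box hK hb ih
  | apply hb hc ht hk hp hq hs hs' hL => exact .apply hb hc ht hk hp hq hs hs' hL

theorem ConfigTy.sem_apply {Q' : LabCtx W} {A : Ty W} (d : ConfigTy C N A Q')
    (e : labObj ob (d.L ++ Q') = obj ob (Ctx.sharp d.L.toCtx) * labObj ob Q')
    (x : PUnit.{v + 1}) :
    d.sem x = ((d.typing.run (labEnv d.L)).1,
      C ≫ d.perm ≫ eqToHom e ≫ rwhisk (d.typing.run (labEnv d.L)).2 (labObj ob Q')) :=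
  Prod.ext rfl (show ((C ≫ d.perm) ≫ eqToHom e) ≫
    rwhisk (d.typing.run (labEnv d.L)).2 (labObj ob Q') = _ by simp only [Category.assoc])

theorem discrete_functor_map_eqToHom {X Y : M} (h : X = Y) :
    (Discrete.functor (id : M → M)).map (Discrete.eqToHom h : Discrete.mk X ⟶ Discrete.mk Y) =
      eqToHom h := by
  subst h; exact (Discrete.functor (id : M → M)).map_id ⟨X⟩

theorem ValConfigTy.map_sem_apply {Q' : LabCtx W} {A : Ty W} (d : ValConfigTy C V A Q')
    (e : labObj ob (d.L ++ Q') = obj ob A.sharp * labObj ob Q') (x : PUnit.{v + 1}) :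
    J.map d.sem x = (d.typing.fn (labEnv d.L), C ≫ d.perm ≫ eqToHom e) := by
  have h : obj ob (Ctx.sharp d.L.toCtx) = obj ob A.sharp := by rw [d.typing.sharp_eq]
  refine Prod.ext rfl ?_
  change ((C ≫ d.perm) ≫ eqToHom (labObj_append_eq d.L Q')) ≫
    rwhisk ((Discrete.functor (id : M → M)).map (Discrete.eqToHom h)) (labObj ob Q') = _
  rw [discrete_functor_map_eqToHom]
  simp only [rwhisk_eqToHom, Category.assoc, eqToHom_trans]

end Soundness

end ProtoQuipperC

theorem mainTheorem1 {W : Type w} {M : Type u} [StrictSymmPremonoidal.{v} M] (ob : W → M)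
    {Q L₀ L₁ Q' : ProtoQuipperC.LabCtx W}
    (C : ProtoQuipperC.labObj ob Q ⟶ ProtoQuipperC.labObj ob L₀)
    (C' : ProtoQuipperC.labObj ob Q ⟶ ProtoQuipperC.labObj ob L₁)
    (N : ProtoQuipperC.Tm ob) (V : ProtoQuipperC.Val ob) (A : ProtoQuipperC.Ty W)
    (d : ProtoQuipperC.ConfigTy C N A Q') (h : ProtoQuipperC.Eval C N C' V) :
    ∃ d' : ProtoQuipperC.ValConfigTy C' V A Q', d.sem = ProtoQuipperC.J.map d'.sem := by
  obtain ⟨hL₁, L, p, t, hp, ha, hf⟩ := h.sound d.isPerm d.typing d.valid_cod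
    (ProtoQuipperC.labObj_append_eq _ _)
  refine ⟨⟨d.valid_dom, hL₁, L, p, hp, t⟩, ?_⟩
  have e : ProtoQuipperC.labObj ob (L ++ Q') =
      ProtoQuipperC.obj ob A.sharp * ProtoQuipperC.labObj ob Q' := by
    rw [ProtoQuipperC.labObj_append, t.labObj_eq]
  funext x
  refine (d.sem_apply (ProtoQuipperC.labObj_append_eq _ _) x).trans ?_
  refine Eq.trans ?_ (ProtoQuipperC.ValConfigTy.map_sem_apply _ e x).symm
  exact Prod.ext ha.symm (hf e).symm
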